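/- Let $\mathcal H\subset SL(2,\mathbb R)^2$ be the hyperbolicity locus of the full $2$-shift, i.e. the set of pairs $(A_0,A_1)$ such that the cocycle $(x,v)\mapsto(\sigma x,A_{x_0}v)$ over the shift $\sigma$ on $\{0,1\}^{\mathbb Z}$ is uniformly hyperbolic: $\{0,1\}^{\mathbb Z}\times\mathbb R^2$ splits as a continuous direct sum $E^s\oplus E^u$ of invariant line bundles, with $E^s$ uniformly exponentially contracted under forward iteration and $E^u$ under backward iteration. A multicone for $(A,B)$ is a non-empty open set $M\subset\mathbb P^1=\mathbb P(\mathbb R^2)$ with $\overline M\ne\mathbb P^1$, having finitely many connected components with pairwise disjoint closures, and such that $\overline{A(M)}\subset M$ and $\overline{B(M)}\subset M$. A connected component of $\mathcal H$ is called principal if every pair in it has a multicone consisting of a single open interval. A matrix $A\in SL(2,\mathbb R)$ is hyperbolic if $|\operatorname{tr}A|>2$ and parabolic if $|\operatorname{tr}A|=2$ (so $\pm\mathrm{id}$ are parabolic). For $A$ hyperbolic, $u_A$ and $s_A\in\mathbb P^1$ denote its eigendirections with eigenvalue of modulus $>1$ and $<1$ respectively; for $A\neq\pm\mathrm{id}$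 parabolic, $u_A=s_A$ denotes its unique invariant direction; for other $A$ they are undefined. Theorem. (a) Every compact subset of $SL(2,\mathbb R)^2$ intersects only finitely many connected components of $\mathcal H$. (b) The boundary $\partial\mathcal H$ in $SL(2,\mathbb R)^2$ is the disjoint union of the boundaries of the connected components of $\mathcal H$. (c) If $(A,B)\in\partial\mathcal H$, then at least one of the following holds: (i) some product of $A$'s and $B$'s (of positive length) is parabolic; (ii) $u_A$ and $s_B$ are defined and $u_A=s_B$, or $u_B$ and $s_A$ are defined and $u_B=s_A$. (d) If $(A,B)\in\partial\mathcal H$ satisfies (ii), then $(A,B)$ belongs to the boundary of a principal component of $\mathcal H$. -/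

import Mathlib

open Set Topology
open scoped LinearAlgebra.Projectivization Matrix MatrixGroups

namespace FullTwoShift

/-! ### The projective line -/

/-- The projective line `ℙ¹` of `ℝ²`. The group `SL(2, ℝ)` acts on it through Mathlib's action on
`Projectivization`, that is, `A • [v] = [A v]`. -/
abbrev P1 : Type := ℙ ℝ (Fin 2 → ℝ)

/-- `ℙ¹` carries the quotient topology of `ℝ² ∖ {0}`. -/
noncomputable instance instTopologicalSpaceP1 : TopologicalSpace P1 :=
  TopologicalSpace.coinduced (Projectivization.mk' ℝ) inferInstance

/-! ### Uniformly hyperbolic cocycles -/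

section Cocycle

variable {X : Type*} [TopologicalSpace X]

/-- The products `A^n(x) = A(f^{n-1} x) ⋯ A(f x) A(x)`, for `n ≥ 0`. -/
def cocycleIter (f : X ≃ₜ X) (A : X → SL(2, ℝ)) : ℕ → X → SL(2, ℝ)
  | 0, _ => 1
  | n + 1, x => A (f^[n] x) * cocycleIter f A n x

/-- The products `A^{-n}(x) = A(f^{-n} x)⁻¹ ⋯ A(f^{-1} x)⁻¹`, for `n ≥ 0`. -/
def cocycleIterNeg (f : X ≃ₜ X) (A : X → SL(2, ℝ)) (n : ℕ) (x : X) : SL(2, ℝ) :=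
  (cocycleIter f A n (f.symm^[n] x))⁻¹

/-- The cocycle `(x, v) ↦ (f x, A(x) v)` on `X × ℝ²` is uniformly hyperbolic: the bundle `X × ℝ²`
splits as a continuous direct sum `Eˢ ⊕ Eᵘ` of invariant line bundles, `Eˢ` being uniformly
contracted in the future and `Eᵘ` in the past. (Both bundles have rank one, since the matrices have
determinant one; the choice of the norm on `ℝ²` is absorbed by the constant `C`.) -/
def UniformlyHyperbolic (f : X ≃ₜ X) (A : X → SL(2, ℝ)) : Prop :=
  ∃ Es Eu : X → P1,
    Continuous Es ∧ Continuous Eu ∧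
    (∀ x, IsCompl (Es x).submodule (Eu x).submodule) ∧
    (∀ x, A x • Es x = Es (f x)) ∧
    (∀ x, A x • Eu x = Eu (f x)) ∧
    ∃ C r : ℝ, 0 < C ∧ 0 < r ∧ r < 1 ∧ ∀ (n : ℕ) (x : X),
      (∀ v ∈ (Es x).submodule,
        ‖(cocycleIter f A n x : Matrix (Fin 2) (Fin 2) ℝ) *ᵥ v‖ ≤ C * r ^ n * ‖v‖) ∧
      (∀ v ∈ (Eu x).submodule,
        ‖(cocycleIterNeg f A n x : Matrix (Fin 2) (Fin 2) ℝ) *ᵥ v‖ ≤ C * r ^ n * ‖v‖)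

end Cocycle

/-! ### The full 2-shift and its hyperbolicity locus -/

/-- The shift `(x_i) ↦ (x_{i+1})` on the full shift `2^ℤ` (with the product topology). -/
def shift : (ℤ → Fin 2) ≃ₜ (ℤ → Fin 2) where
  toFun x i := x (i + 1)
  invFun x i := x (i - 1)
  left_inv x := by funext i; simp
  right_inv x := by funext i; simp
  continuous_toFun := by fun_prop
  continuous_invFun := by fun_prop

/-- The matrix attached to a letter by the pair `p = (A, B)`: `0 ↦ A`, `1 ↦ B`. -/
def letter (p : SL(2, ℝ) × SL(2, ℝ)) : Fin 2 → SL(2, ℝ) := ![p.1, p.2]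

/-- The hyperbolicity locus `ℋ ⊆ SL(2, ℝ)²` of the full 2-shift. -/
def hypLocus : Set (SL(2, ℝ) × SL(2, ℝ)) :=
  {p | UniformlyHyperbolic shift fun x => letter p (x 0)}

/-- The set of connected components of a subset `S` of a topological space. -/
def componentsOf {X : Type*} [TopologicalSpace X] (S : Set X) : Set (Set X) :=
  {C | ∃ x ∈ S, C = connectedComponentIn S x}

/-! ### Multicones and principal components -/

/-- `M ⊆ ℙ¹` is a multicone for the pair `p`: it is non-empty, open, not dense, has finitely many
components, with pairwise disjoint closures, and is mapped by each of the two matrices into a set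
whose closure is contained in `M`. -/
structure IsMulticone (p : SL(2, ℝ) × SL(2, ℝ)) (M : Set P1) : Prop where
  nonempty : M.Nonempty
  isOpen : IsOpen M
  closure_ne_univ : closure M ≠ univ
  closure_image_subset : ∀ i : Fin 2, closure ((fun x : P1 => letter p i • x) '' M) ⊆ interior M
  finite_components : (componentsOf M).Finite
  disjoint_closures : (componentsOf M).PairwiseDisjoint closure

/-- An open interval of `ℙ¹`: non-empty, open, connected, with more than one point in the
complement. -/
def IsOpenInterval (I : Set P1) : Prop :=
  IsOpen I ∧ IsConnected I ∧ Iᶜ.Nontrivial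

/-- A principal component of `ℋ`: a connected component each of whose elements has a multicone
consisting of a single interval. -/
def IsPrincipalComponent (C : Set (SL(2, ℝ) × SL(2, ℝ))) : Prop :=
  C ∈ componentsOf hypLocus ∧ ∀ p ∈ C, ∃ M, IsMulticone p M ∧ IsOpenInterval M

/-! ### Types of matrices, stable and unstable directions -/

/-- `|tr A| > 2`. -/
def Hyperbolic (A : SL(2, ℝ)) : Prop := 2 < |(A : Matrix (Fin 2) (Fin 2) ℝ).trace|

/-- `|tr A| = 2`; in particular `± id` are parabolic. -/
def Parabolic (A : SL(2, ℝ)) : Prop := |(A : Matrix (Fin 2) (Fin 2) ℝ).trace| = 2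

/-- `d = u_A`: the eigendirection of a hyperbolic `A` whose eigenvalue has modulus larger than one,
or the unique invariant direction of a parabolic `A ≠ ± id`. No direction is `u_A` if `A` is
elliptic or `A = ± id`. -/
def IsUnstableDir (A : SL(2, ℝ)) (d : P1) : Prop :=
  (Hyperbolic A ∧ ∃ c : ℝ, 1 < |c| ∧
    ∀ v ∈ d.submodule, (A : Matrix (Fin 2) (Fin 2) ℝ) *ᵥ v = c • v) ∨
  (Parabolic A ∧ A ≠ 1 ∧ A ≠ -1 ∧ A • d = d)

/-- `d = s_A`: the eigendirection of a hyperbolic `A` whose eigenvalue has modulus less than one,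
or the unique invariant direction of a parabolic `A ≠ ± id`. No direction is `s_A` if `A` is
elliptic or `A = ± id`. -/
def IsStableDir (A : SL(2, ℝ)) (d : P1) : Prop :=
  (Hyperbolic A ∧ ∃ c : ℝ, |c| < 1 ∧
    ∀ v ∈ d.submodule, (A : Matrix (Fin 2) (Fin 2) ℝ) *ᵥ v = c • v) ∨
  (Parabolic A ∧ A ≠ 1 ∧ A ≠ -1 ∧ A • d = d)

/-- `u_A` and `s_B` are defined and `u_A = s_B`. -/
def UnstableEqStable (A B : SL(2, ℝ)) : Prop :=
  ∃ d : P1, IsUnstableDir A d ∧ IsStableDir B d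

/-- Some (non-empty) product of `A`'s and `B`'s is parabolic, where `p = (A, B)`. -/
def HasParabolicProduct (p : SL(2, ℝ) × SL(2, ℝ)) : Prop :=
  ∃ w : List (Fin 2), w ≠ [] ∧ Parabolic (w.map (letter p)).prod

end FullTwoShift

namespace FullTwoShift

open Filter

/-! ### The Frobenius norm of `2 × 2` matrices -/

/-! Write `x, y, z` for the traces of `A`, `B`, `AB`, and `κ = x² + y² + z² - xyz - 2` for the trace
of the commutator (`trComm`). The whole theorem is read off from an explicit list of the components
of `hypLocus` (`hypLocus_eq_iUnion_piece`, `componentsOf_hypLocus`).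

Both matrices of a hyperbolic pair are hyperbolic, and signs do not matter, so let `x, y > 2`. If
the axes are not opposed, that is `κ < 2` or `xy < 2z`, the pair is simultaneously conjugate to two
positive matrices (`exists_conjPair_positive`). Such pairs form one connected set, the quadrant
giving an interval multicone. Otherwise `κ ≥ 2` and `2z < xy`. If `κ = 2`, the matrices share a
direction `u_A = s_B` or `u_B = s_A` (`unstableEqStable_of_trComm_eq_two`), which hyperbolicity
forbids. If `κ > 2`, hyperbolicity gives `|z| > 2`. As long as `z > 2`, replacing the matrix of
larger trace by `AB` keeps `κ` and the opposition of the axes, and lowers `x + y` by at least `√(κ -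
2)`. So the process stops, at a pair with `z < -2`. Up to sign, such a Schottky pair consists of
products of reflections in three disjoint geodesics, and reduced words grow exponentially
(`hasFreeGrowth_of_mem_schottkySet`). The Schottky pairs form two connected sets, told apart by
`orient`.

Exponential growth gives hyperbolicity (`uniformlyHyperbolic_of_growth`). In the other direction
only two facts about hyperbolic pairs are needed: `hyperbolic_of_mem_hypLocus` and
`not_unstable_eq_stable_of_mem_hypLocus`.

The pieces remain disjoint when their inequalities are made weak: on the closed non-principal ones
`κ ≥ 18`, so each reduction step lowers `x + y` by at least 4 and is determined by which trace is
larger (`reduction_unique`). The same gap bounds the number of steps in terms of the traces, so the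
family is locally finite. This gives (a) and (b). At a boundary point of a piece some strict
inequality has become an equality: either a product has trace `±2`, or `κ = 2` with opposed axes;
this is (c). Finally (ii) forces `κ = 2`, which excludes the non-principal pieces and proves (d). -/

/-- Real `2 × 2` matrices. -/
abbrev Mat2 : Type := Matrix (Fin 2) (Fin 2) ℝ

/-- The Frobenius norm of a real `2 × 2` matrix. -/
noncomputable def fro (M : Mat2) : ℝ :=
  √(M 0 0 ^ 2 + M 0 1 ^ 2 + M 1 0 ^ 2 + M 1 1 ^ 2)

section Frobenius

attribute [local instance] Matrix.frobeniusNormedRing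

lemma fro_eq_norm (M : Mat2) : fro M = ‖M‖ := by
  rw [Matrix.frobenius_norm_def, fro, Real.sqrt_eq_rpow]
  simp [Fin.sum_univ_two, add_assoc]

lemma fro_mul_le (M N : Mat2) : fro (M * N) ≤ fro M * fro N := by
  simpa only [fro_eq_norm] using norm_mul_le M N

lemma fro_add_le (M N : Mat2) : fro (M + N) ≤ fro M + fro N := by
  simpa only [fro_eq_norm] using norm_add_le M N

lemma fro_sub_le (M N : Mat2) : fro (M - N) ≤ fro M + fro N := by
  simpa only [fro_eq_norm] using norm_sub_le M N

end Frobenius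

lemma fro_nonneg (M : Mat2) : 0 ≤ fro M := Real.sqrt_nonneg _

lemma fro_sq (M : Mat2) : fro M ^ 2 = M 0 0 ^ 2 + M 0 1 ^ 2 + M 1 0 ^ 2 + M 1 1 ^ 2 :=
  Real.sq_sqrt (by positivity)

lemma fro_transpose (M : Mat2) : fro Mᵀ = fro M := by
  simp only [fro, Matrix.transpose_apply]
  congr 1
  ring

lemma fro_smul (c : ℝ) (M : Mat2) : fro (c • M) = |c| * fro M := by
  rw [fro, fro, ← Real.sqrt_sq_eq_abs, ← Real.sqrt_mul (sq_nonneg c)]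
  congr 1
  simp only [Matrix.smul_apply, smul_eq_mul]
  ring

lemma abs_entry_le_fro (M : Mat2) (i j : Fin 2) : |M i j| ≤ fro M := by
  rw [fro]
  apply Real.abs_le_sqrt
  fin_cases i <;> fin_cases j <;> simp <;> nlinarith [sq_nonneg (M 0 0), sq_nonneg (M 0 1),
    sq_nonneg (M 1 0), sq_nonneg (M 1 1)]

lemma fro_le_of_entries {M : Mat2} {e : ℝ} (h : ∀ i j, |M i j| ≤ e) : fro M ≤ 2 * e := by
  have he : 0 ≤ e := (abs_nonneg _).trans (h 0 0)
  rw [fro]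
  apply Real.sqrt_le_iff.2 ⟨by positivity, ?_⟩
  have h' : ∀ i j, M i j ^ 2 ≤ e ^ 2 := fun i j => sq_le_sq' (abs_le.1 (h i j)).1 (abs_le.1 (h i j)).2
  nlinarith [h' 0 0, h' 0 1, h' 1 0, h' 1 1]

lemma norm_mulVec_le (M : Mat2) (v : Fin 2 → ℝ) : ‖M *ᵥ v‖ ≤ 2 * fro M * ‖v‖ := by
  rw [pi_norm_le_iff_of_nonneg (mul_nonneg (mul_nonneg zero_le_two (fro_nonneg M)) (norm_nonneg v))]
  intro i
  simp only [Matrix.mulVec, dotProduct, Fin.sum_univ_two, Real.norm_eq_abs]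
  have hv := fun j => norm_le_pi_norm v j
  simp only [Real.norm_eq_abs] at hv
  calc |M i 0 * v 0 + M i 1 * v 1| ≤ |M i 0 * v 0| + |M i 1 * v 1| := abs_add_le _ _
    _ = |M i 0| * |v 0| + |M i 1| * |v 1| := by rw [abs_mul, abs_mul]
    _ ≤ fro M * ‖v‖ + fro M * ‖v‖ :=
        add_le_add
          (mul_le_mul (abs_entry_le_fro M i 0) (hv 0) (abs_nonneg _) (fro_nonneg M))
          (mul_le_mul (abs_entry_le_fro M i 1) (hv 1) (abs_nonneg _) (fro_nonneg M))
    _ = 2 * fro M * ‖v‖ := by ring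

/-! ### Elements of `SL(2, ℝ)` -/

lemma det_eq (A : SL(2, ℝ)) : A.1 0 0 * A.1 1 1 - A.1 0 1 * A.1 1 0 = 1 := by
  rw [← Matrix.det_fin_two]; exact A.2

lemma inv_entries (A : SL(2, ℝ)) : (A⁻¹).1 = !![A.1 1 1, -A.1 0 1; -A.1 1 0, A.1 0 0] := by
  rw [Matrix.SpecialLinearGroup.SL2_inv_expl]
  rfl

lemma fro_inv (A : SL(2, ℝ)) : fro (A⁻¹).1 = fro A.1 := by
  rw [inv_entries, fro, fro]
  congr 1
  simp
  ring

lemma one_le_fro (A : SL(2, ℝ)) : 1 ≤ fro A.1 := by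
  rw [fro]
  apply Real.le_sqrt_of_sq_le
  nlinarith [det_eq A, sq_nonneg (A.1 0 0 - A.1 1 1), sq_nonneg (A.1 0 1 + A.1 1 0)]

lemma fro_pos (A : SL(2, ℝ)) : 0 < fro A.1 := zero_lt_one.trans_le (one_le_fro A)

lemma mulVec_ne_zero (A : SL(2, ℝ)) {v : Fin 2 → ℝ} (hv : v ≠ 0) : A.1 *ᵥ v ≠ 0 := by
  intro h
  apply hv
  have : (A⁻¹ * A).1 *ᵥ v = v := by simp
  rw [← this, Matrix.SpecialLinearGroup.coe_mul, ← Matrix.mulVec_mulVec]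
  rw [h, Matrix.mulVec_zero]

lemma coe_mul_inv (A : SL(2, ℝ)) : A.1 * (A⁻¹).1 = 1 := by
  rw [← Matrix.SpecialLinearGroup.coe_mul, mul_inv_cancel, Matrix.SpecialLinearGroup.coe_one]

lemma coe_inv_mul (A : SL(2, ℝ)) : (A⁻¹).1 * A.1 = 1 := by
  rw [← Matrix.SpecialLinearGroup.coe_mul, inv_mul_cancel, Matrix.SpecialLinearGroup.coe_one]

/-! ### Points of the projective line -/

lemma smul_mk_P1 (A : SL(2, ℝ)) {v : Fin 2 → ℝ} (hv : v ≠ 0) :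
    A • (Projectivization.mk ℝ v hv : P1) = Projectivization.mk ℝ (A.1 *ᵥ v) (mulVec_ne_zero A hv) :=
  rfl

lemma mem_submodule_mk {v w : Fin 2 → ℝ} (hv : v ≠ 0) :
    w ∈ (Projectivization.mk ℝ v hv : P1).submodule ↔ ∃ c : ℝ, c • v = w := by
  rw [Projectivization.submodule_mk, Submodule.mem_span_singleton]

lemma mk_eq_of_mem {d : P1} {v : Fin 2 → ℝ} (hv : v ≠ 0) (h : v ∈ d.submodule) :
    Projectivization.mk ℝ v hv = d := by
  induction d using Projectivization.ind with
  | h w hw =>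
    rw [mem_submodule_mk] at h
    rw [Projectivization.mk_eq_mk_iff']
    exact h

lemma mulVec_mem_smul (A : SL(2, ℝ)) {d : P1} {v : Fin 2 → ℝ} (h : v ∈ d.submodule) :
    A.1 *ᵥ v ∈ (A • d).submodule := by
  induction d using Projectivization.ind with
  | h w hw =>
    rw [smul_mk_P1, mem_submodule_mk]
    rw [mem_submodule_mk] at h
    obtain ⟨c, rfl⟩ := h
    exact ⟨c, by rw [Matrix.mulVec_smul]⟩

lemma exists_ne_zero_mem (d : P1) : ∃ v ∈ d.submodule, v ≠ 0 := by
  induction d using Projectivization.ind with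
  | h w hw => exact ⟨w, (mem_submodule_mk hw).2 ⟨1, one_smul _ _⟩, hw⟩

lemma continuous_mk' : Continuous (Projectivization.mk' ℝ : {v : Fin 2 → ℝ // v ≠ 0} → P1) :=
  continuous_coinduced_rng

/-- A field of directions is continuous where it has a continuous non-vanishing section. -/
lemma continuousAt_of_section {X : Type*} [TopologicalSpace X] {E : X → P1} {w : X → Fin 2 → ℝ}
    {x : X} (hw : ContinuousAt w x) (h0 : w x ≠ 0) (h : ∀ y, w y ∈ (E y).submodule) :
    ContinuousAt E x := by
  classical
  have hev : ∀ᶠ y in 𝓝 x, w y ≠ 0 := hw.eventually_ne h0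
  let w' : X → {v : Fin 2 → ℝ // v ≠ 0} := fun y => if hy : w y ≠ 0 then ⟨w y, hy⟩ else ⟨w x, h0⟩
  have hw' : ContinuousAt w' x := by
    refine (Topology.IsInducing.continuousAt_iff (g := Subtype.val) ⟨rfl⟩).2 ?_
    refine hw.congr ?_
    filter_upwards [hev] with y hy
    simp [w', hy]
  have hc : ContinuousAt (fun y => (Projectivization.mk' ℝ (w' y) : P1)) x :=
    continuous_mk'.continuousAt.comp hw'
  refine hc.congr ?_
  filter_upwards [hev] with y hy
  have : w' y = ⟨w y, hy⟩ := by simp [w', hy]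
  rw [this]
  exact mk_eq_of_mem hy (h y)

/-! ### Most expanded directions of a sequence of products -/

/-- The matrix `MᵀM`, normalized to have trace one. When `M` is large, it is close to the orthogonal
projection onto the direction that `M` expands most. -/
noncomputable def expProj (M : SL(2, ℝ)) : Mat2 := (fro M.1 ^ 2)⁻¹ • (M.1ᵀ * M.1)

lemma expProj_trace (M : SL(2, ℝ)) : expProj M 0 0 + expProj M 1 1 = 1 := by
  have h : fro M.1 ^ 2 ≠ 0 := (pow_pos (fro_pos M) 2).ne'
  simp only [expProj, Matrix.smul_apply, Matrix.mul_apply, Fin.sum_univ_two, Matrix.transpose_apply,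
    smul_eq_mul]
  rw [← mul_add, inv_mul_eq_one₀ h, fro_sq]
  ring

/-- Cayley–Hamilton for `MᵀM`, which has determinant one and trace `fro M.1 ^ 2`: its inverse is its
trace minus itself. -/
lemma one_sub_expProj (M : SL(2, ℝ)) :
    1 - expProj M = (fro M.1 ^ 2)⁻¹ • ((M⁻¹).1 * (M⁻¹).1ᵀ) := by
  have h : fro M.1 ^ 2 ≠ 0 := (pow_pos (fro_pos M) 2).ne'
  rw [sub_eq_iff_eq_add, expProj, ← smul_add, eq_inv_smul_iff₀ h, fro_sq, inv_entries]
  ext i j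
  fin_cases i <;> fin_cases j <;> simp [Matrix.mul_apply, Fin.sum_univ_two, Matrix.vecMul, dotProduct] <;> ring

lemma transpose_inv_mul_transpose (M : SL(2, ℝ)) : (M⁻¹).1ᵀ * M.1ᵀ = 1 := by
  rw [← Matrix.transpose_mul, coe_mul_inv, Matrix.transpose_one]

/-- `expProj M` is idempotent up to an error that vanishes as `M` grows. -/
lemma expProj_mul_one_sub (M : SL(2, ℝ)) :
    expProj M * (1 - expProj M) = ((fro M.1 ^ 2)⁻¹ * (fro M.1 ^ 2)⁻¹) • (1 : Mat2) := by
  rw [one_sub_expProj, expProj, Matrix.smul_mul, Matrix.mul_smul, smul_smul]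
  congr 1
  rw [mul_assoc, ← mul_assoc M.1, coe_mul_inv, one_mul, ← Matrix.transpose_mul, coe_inv_mul,
    Matrix.transpose_one]

lemma coe_mul_one_sub_expProj (M : SL(2, ℝ)) :
    M.1 * (1 - expProj M) = (fro M.1 ^ 2)⁻¹ • (M⁻¹).1ᵀ := by
  rw [one_sub_expProj, Matrix.mul_smul, ← mul_assoc, coe_mul_inv, one_mul]

/-- With `P`, `P'` the two matrices, `P - P' = P (1 - P') - (1 - P) P'`. In both products a large
factor cancels, since `M (BM)⁻¹ = B⁻¹`, and only `B` is left between one factor of size `‖M‖` and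
one of size `‖BM‖`. -/
lemma fro_expProj_sub_le (B M : SL(2, ℝ)) :
    fro (expProj M - expProj (B * M)) ≤ 2 * fro B.1 / (fro M.1 * fro (B * M).1) := by
  have hM := fro_pos M
  have hN := fro_pos (B * M)
  have h1 : expProj M * (1 - expProj (B * M)) = ((fro M.1 ^ 2)⁻¹ * (fro (B * M).1 ^ 2)⁻¹) •
      (M.1ᵀ * (B⁻¹).1 * ((B * M)⁻¹).1ᵀ) := by
    rw [one_sub_expProj, expProj, Matrix.smul_mul, Matrix.mul_smul, smul_smul]
    congr 1
    have h : M.1 * ((B * M)⁻¹).1 = (B⁻¹).1 := by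
      rw [← Matrix.SpecialLinearGroup.coe_mul]
      congr 1
      rw [mul_inv_rev, mul_inv_cancel_left]
    rw [mul_assoc, ← mul_assoc M.1, h, mul_assoc]
  have h2 : (1 - expProj M) * expProj (B * M) = ((fro M.1 ^ 2)⁻¹ * (fro (B * M).1 ^ 2)⁻¹) •
      ((M⁻¹).1 * B.1ᵀ * (B * M).1) := by
    rw [one_sub_expProj, expProj, Matrix.smul_mul, Matrix.mul_smul, smul_smul]
    congr 1
    have h : (M⁻¹).1ᵀ * (B * M).1ᵀ = B.1ᵀ := by
      rw [Matrix.SpecialLinearGroup.coe_mul, Matrix.transpose_mul, ← mul_assoc,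
        transpose_inv_mul_transpose, one_mul]
    rw [mul_assoc, ← mul_assoc (M⁻¹).1ᵀ, h, mul_assoc]
  have h3 : expProj M - expProj (B * M) =
      expProj M * (1 - expProj (B * M)) - (1 - expProj M) * expProj (B * M) := by noncomm_ring
  have hs : 0 ≤ (fro M.1 ^ 2)⁻¹ * (fro (B * M).1 ^ 2)⁻¹ := by positivity
  have h4 : fro (M.1ᵀ * (B⁻¹).1 * ((B * M)⁻¹).1ᵀ) ≤ fro M.1 * fro B.1 * fro (B * M).1 := by
    refine (fro_mul_le _ _).trans ?_
    rw [fro_transpose, fro_inv]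
    refine mul_le_mul_of_nonneg_right ((fro_mul_le _ _).trans ?_) hN.le
    rw [fro_transpose, fro_inv]
  have h5 : fro ((M⁻¹).1 * B.1ᵀ * (B * M).1) ≤ fro M.1 * fro B.1 * fro (B * M).1 := by
    refine (fro_mul_le _ _).trans ?_
    refine mul_le_mul_of_nonneg_right ((fro_mul_le _ _).trans ?_) hN.le
    rw [fro_transpose, fro_inv]
  rw [h3, h1, h2]
  refine (fro_sub_le _ _).trans ?_
  rw [fro_smul, fro_smul, abs_of_nonneg hs]
  calc _ ≤ (fro M.1 ^ 2)⁻¹ * (fro (B * M).1 ^ 2)⁻¹ * (fro M.1 * fro B.1 * fro (B * M).1) +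
        (fro M.1 ^ 2)⁻¹ * (fro (B * M).1 ^ 2)⁻¹ * (fro M.1 * fro B.1 * fro (B * M).1) :=
        add_le_add (mul_le_mul_of_nonneg_left h4 hs) (mul_le_mul_of_nonneg_left h5 hs)
    _ = 2 * fro B.1 / (fro M.1 * fro (B * M).1) := by
        field_simp
        ring

/-- A sequence that grows exponentially has arbitrarily late times after which it never falls below
a given smaller exponential rate. -/
lemma exists_good_time {b : ℕ → ℝ} {c l ν : ℝ} (hc : 0 < c) (hν : 1 < ν) (hl : ν < l)
    (hb : ∀ n, c * l ^ n ≤ b n) (N : ℕ) : ∃ n, N ≤ n ∧ ∀ k, b n * ν ^ k ≤ b (n + k) := by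
  have hν0 : 0 < ν := by linarith
  let g : ℕ → ℝ := fun k => b (N + k) / ν ^ (N + k)
  have hg : Tendsto g atTop atTop := by
    have h1 : Tendsto (fun n : ℕ => c * (l / ν) ^ n) atTop atTop :=
      (tendsto_pow_atTop_atTop_of_one_lt ((one_lt_div hν0).2 hl)).const_mul_atTop hc
    have h2 : Tendsto (fun n : ℕ => b n / ν ^ n) atTop atTop := by
      refine tendsto_atTop_mono (fun n => ?_) h1
      rw [div_pow, ← mul_div_assoc]
      exact div_le_div_of_nonneg_right (hb n) (pow_pos hν0 n).le
    exact h2.comp (tendsto_add_atTop_nat N |>.congr fun k => add_comm k N)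
  -- Since `b n / ν ^ n` tends to infinity, it attains its minimum over the times from `N` on; a
  -- minimizing time is a good one.
  rw [← Nat.cofinite_eq_atTop] at hg
  obtain ⟨m, hm⟩ := hg.exists_forall_le
  refine ⟨N + m, Nat.le_add_right _ _, fun k => ?_⟩
  have h := hm (m + k)
  simp only [g] at h
  rw [div_le_div_iff₀ (pow_pos hν0 _) (pow_pos hν0 _), ← add_assoc, pow_add ν (N + m) k] at h
  have hp := pow_pos hν0 (N + m)
  nlinarith

section Sequence

variable {M B : ℕ → SL(2, ℝ)} {c l L : ℝ}

lemma abs_expProj_sub_le (hM : ∀ n, M (n + 1) = B n * M n) (hB : ∀ n, fro (B n).1 ≤ L) (n : ℕ)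
    (i j : Fin 2) :
    dist (expProj (M n) i j) (expProj (M (n + 1)) i j) ≤
      2 * L / (fro (M n).1 * fro (M (n + 1)).1) := by
  have h := fro_expProj_sub_le (B n) (M n)
  rw [← hM] at h
  rw [Real.dist_eq]
  have h2 := abs_entry_le_fro (expProj (M n) - expProj (M (n + 1))) i j
  rw [Matrix.sub_apply] at h2
  refine (h2.trans h).trans ?_
  have := mul_pos (fro_pos (M n)) (fro_pos (M (n + 1)))
  exact div_le_div_of_nonneg_right (by linarith [hB n]) this.le

lemma dist_expProj_le_geometric (hc : 0 < c) (hl : 1 < l) (hM : ∀ n, M (n + 1) = B n * M n)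
    (hB : ∀ n, fro (B n).1 ≤ L) (hg : ∀ n, c * l ^ n ≤ fro (M n).1) (n : ℕ) (i j : Fin 2) :
    dist (expProj (M n) i j) (expProj (M (n + 1)) i j) ≤ 2 * L / c ^ 2 * ((l ^ 2)⁻¹) ^ n := by
  have hL : 0 ≤ L := (fro_nonneg _).trans (hB 0)
  have hl0 : 0 < l := by linarith
  refine (abs_expProj_sub_le hM hB n i j).trans ?_
  have h1 : c ^ 2 * (l ^ 2) ^ n ≤ fro (M n).1 * fro (M (n + 1)).1 := by
    have h2 := mul_le_mul (hg n) (hg (n + 1)) (by positivity) (fro_nonneg _)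
    refine le_trans ?_ h2
    have h3 : c * l ^ n * (c * l ^ (n + 1)) = c ^ 2 * (l ^ 2) ^ n * l := by
      rw [← pow_mul, mul_comm 2 n, pow_mul, pow_succ]; ring
    rw [h3]
    exact le_mul_of_one_le_right (by positivity) hl.le
  calc 2 * L / (fro (M n).1 * fro (M (n + 1)).1) ≤ 2 * L / (c ^ 2 * (l ^ 2) ^ n) :=
        div_le_div_of_nonneg_left (by positivity) (by positivity) h1
    _ = 2 * L / c ^ 2 * ((l ^ 2)⁻¹) ^ n := by rw [inv_pow]; field_simp

lemma exists_tendsto_expProj (hc : 0 < c) (hl : 1 < l) (hM : ∀ n, M (n + 1) = B n * M n)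
    (hB : ∀ n, fro (B n).1 ≤ L) (hg : ∀ n, c * l ^ n ≤ fro (M n).1) :
    ∃ Q : Mat2, ∀ i j, Tendsto (fun n => expProj (M n) i j) atTop (𝓝 (Q i j)) := by
  have hr : (l ^ 2)⁻¹ < 1 := inv_lt_one_of_one_lt₀ (one_lt_pow₀ hl two_ne_zero)
  have h : ∀ i j, ∃ q, Tendsto (fun n => expProj (M n) i j) atTop (𝓝 q) := fun i j =>
    cauchySeq_tendsto_of_complete (cauchySeq_of_le_geometric _ _ hr
      fun n => dist_expProj_le_geometric hc hl hM hB hg n i j)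
  choose q hq using h
  exact ⟨Matrix.of q, hq⟩

variable {Q : Mat2}

lemma dist_expProj_lim_le (hc : 0 < c) (hl : 1 < l) (hM : ∀ n, M (n + 1) = B n * M n)
    (hB : ∀ n, fro (B n).1 ≤ L) (hg : ∀ n, c * l ^ n ≤ fro (M n).1)
    (hQ : ∀ i j, Tendsto (fun n => expProj (M n) i j) atTop (𝓝 (Q i j))) (n : ℕ) (i j : Fin 2) :
    dist (expProj (M n) i j) (Q i j) ≤
      2 * L / c ^ 2 * ((l ^ 2)⁻¹) ^ n / (1 - (l ^ 2)⁻¹) :=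
  dist_le_of_le_geometric_of_tendsto _ _
    (inv_lt_one_of_one_lt₀ (one_lt_pow₀ hl two_ne_zero))
    (fun n => dist_expProj_le_geometric hc hl hM hB hg n i j) (hQ i j) n

lemma lim_trace (hQ : ∀ i j, Tendsto (fun n => expProj (M n) i j) atTop (𝓝 (Q i j))) :
    Q 0 0 + Q 1 1 = 1 := by
  have h := (hQ 0 0).add (hQ 1 1)
  simp only [expProj_trace] at h
  exact tendsto_nhds_unique h tendsto_const_nhds |>.symm ▸ rfl

lemma tendsto_fro_atTop (hc : 0 < c) (hl : 1 < l) (hg : ∀ n, c * l ^ n ≤ fro (M n).1) :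
    Tendsto (fun n => fro (M n).1) atTop atTop :=
  tendsto_atTop_mono hg ((tendsto_pow_atTop_atTop_of_one_lt hl).const_mul_atTop hc)

/-- With `lim_trace`, this makes the limit `Q` a projection of rank one. Its kernel will be the
stable direction. -/
lemma lim_mul_one_sub (hc : 0 < c) (hl : 1 < l) (hg : ∀ n, c * l ^ n ≤ fro (M n).1)
    (hQ : ∀ i j, Tendsto (fun n => expProj (M n) i j) atTop (𝓝 (Q i j))) :
    Q * (1 - Q) = 0 := by
  ext i j
  have h1 : Tendsto (fun n => (expProj (M n) * (1 - expProj (M n))) i j) atTop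
      (𝓝 ((Q * (1 - Q)) i j)) := by
    simp only [Matrix.mul_apply, Fin.sum_univ_two, Matrix.sub_apply]
    exact ((hQ i 0).mul (tendsto_const_nhds.sub (hQ 0 j))).add
      ((hQ i 1).mul (tendsto_const_nhds.sub (hQ 1 j)))
  have h2 : Tendsto (fun n => (fro (M n).1 ^ 2)⁻¹) atTop (𝓝 0) :=
    ((tendsto_pow_atTop two_ne_zero).comp (tendsto_fro_atTop hc hl hg)).inv_tendsto_atTop
  have h3 : Tendsto (fun n => (expProj (M n) * (1 - expProj (M n))) i j) atTop (𝓝 0) := by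
    simp only [expProj_mul_one_sub, Matrix.smul_apply, smul_eq_mul]
    simpa using (h2.mul h2).mul_const ((1 : Mat2) i j)
  exact tendsto_nhds_unique h1 h3

lemma one_sub_mulVec_eq_self_iff {v : Fin 2 → ℝ} : (1 - Q) *ᵥ v = v ↔ Q *ᵥ v = 0 := by
  rw [Matrix.sub_mulVec, Matrix.one_mulVec, sub_eq_self]

/-- At a good time `n` the geometric series can be started from `‖M n‖` itself instead of the lower
bound `c * l ^ n`, so `expProj (M n)` is within `O(‖M n‖⁻²)` of `Q`. At an arbitrary time `‖M n‖`
may be far larger than `c * l ^ n`, and the error multiplied by `M n` would not be controlled. -/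
lemma fro_mul_one_sub_lim_le (hc : 0 < c) (hl : 1 < l) (hM : ∀ n, M (n + 1) = B n * M n)
    (hB : ∀ n, fro (B n).1 ≤ L) (hg : ∀ n, c * l ^ n ≤ fro (M n).1)
    (hQ : ∀ i j, Tendsto (fun n => expProj (M n) i j) atTop (𝓝 (Q i j))) :
    ∃ C, ∀ N, ∃ n, N ≤ n ∧ fro ((M n).1 * (1 - Q)) ≤ C / fro (M n).1 := by
  obtain ⟨ν, hν1, hνl⟩ := exists_between hl
  have hν0 : 0 < ν := by linarith
  have hL : 0 ≤ L := (fro_nonneg _).trans (hB 0)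
  have hr : (ν ^ 2)⁻¹ < 1 := inv_lt_one_of_one_lt₀ (one_lt_pow₀ hν1 two_ne_zero)
  refine ⟨1 + 2 * (2 * L / (1 - (ν ^ 2)⁻¹)), fun N => ?_⟩
  obtain ⟨n, hn, hk⟩ := exists_good_time hc hν1 hνl hg N
  refine ⟨n, hn, ?_⟩
  have hp := fro_pos (M n)
  have hdist : ∀ i j, dist (expProj (M n) i j) (Q i j) ≤
      2 * L / fro (M n).1 ^ 2 / (1 - (ν ^ 2)⁻¹) := by
    intro i j
    have ht : Tendsto (fun k => expProj (M (n + k)) i j) atTop (𝓝 (Q i j)) :=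
      (hQ i j).comp (tendsto_add_atTop_nat n |>.congr fun k => add_comm k n)
    refine dist_le_of_le_geometric_of_tendsto₀ _ _ hr (fun k => ?_) ht
    refine (abs_expProj_sub_le hM hB (n + k) i j).trans ?_
    have h1 : fro (M n).1 ^ 2 * (ν ^ 2) ^ k ≤ fro (M (n + k)).1 * fro (M (n + k + 1)).1 := by
      have h2 := mul_le_mul (hk k) (hk (k + 1)) (by positivity) (fro_nonneg _)
      refine le_trans ?_ h2
      have h3 : fro (M n).1 * ν ^ k * (fro (M n).1 * ν ^ (k + 1)) =
          fro (M n).1 ^ 2 * (ν ^ 2) ^ k * ν := by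
        rw [← pow_mul, mul_comm 2 k, pow_mul, pow_succ]; ring
      rw [h3]
      exact le_mul_of_one_le_right (by positivity) hν1.le
    calc 2 * L / (fro (M (n + k)).1 * fro (M (n + k + 1)).1)
        ≤ 2 * L / (fro (M n).1 ^ 2 * (ν ^ 2) ^ k) :=
          div_le_div_of_nonneg_left (by positivity) (by positivity) h1
      _ = 2 * L / fro (M n).1 ^ 2 * ((ν ^ 2)⁻¹) ^ k := by rw [inv_pow]; field_simp
  have h1 : fro (expProj (M n) - Q) ≤ 2 * (2 * L / fro (M n).1 ^ 2 / (1 - (ν ^ 2)⁻¹)) :=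
    fro_le_of_entries fun i j => hdist i j
  have h2 : (M n).1 * (1 - Q) = (M n).1 * (1 - expProj (M n)) + (M n).1 * (expProj (M n) - Q) := by
    noncomm_ring
  rw [h2]
  refine (fro_add_le _ _).trans ?_
  rw [coe_mul_one_sub_expProj, fro_smul, fro_transpose, fro_inv, abs_of_nonneg (by positivity)]
  have h3 := (fro_mul_le (M n).1 (expProj (M n) - Q)).trans (mul_le_mul_of_nonneg_left h1 hp.le)
  refine (add_le_add le_rfl h3).trans (le_of_eq ?_)
  have : 1 - (ν ^ 2)⁻¹ ≠ 0 := by linarith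
  field_simp

/-- Up to the factor `1/2`, `‖M v‖` is at least `‖MᵀM v‖ / ‖M‖ = ‖M‖ ‖expProj M v‖`, and the last
factor has a positive limit. -/
lemma tendsto_norm_mulVec_atTop (hc : 0 < c) (hl : 1 < l) (hg : ∀ n, c * l ^ n ≤ fro (M n).1)
    (hQ : ∀ i j, Tendsto (fun n => expProj (M n) i j) atTop (𝓝 (Q i j))) {v : Fin 2 → ℝ}
    (hv : Q *ᵥ v ≠ 0) : Tendsto (fun n => ‖(M n).1 *ᵥ v‖) atTop atTop := by
  have h1 : Tendsto (fun n => expProj (M n) *ᵥ v) atTop (𝓝 (Q *ᵥ v)) := by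
    rw [tendsto_pi_nhds]
    intro i
    simp only [Matrix.mulVec, dotProduct, Fin.sum_univ_two]
    exact ((hQ i 0).mul_const _).add ((hQ i 1).mul_const _)
  have h2 := (tendsto_fro_atTop hc hl hg).atTop_mul_pos (norm_pos_iff.2 hv) h1.norm
  refine tendsto_atTop_mono (fun n => ?_) (h2.const_mul_atTop (by norm_num : (0 : ℝ) < 1 / 2))
  have hp := fro_pos (M n)
  have h3 : expProj (M n) *ᵥ v = (fro (M n).1 ^ 2)⁻¹ • ((M n).1ᵀ *ᵥ ((M n).1 *ᵥ v)) := by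
    rw [expProj, Matrix.smul_mulVec, Matrix.mulVec_mulVec]
  have h4 := norm_mulVec_le (M n).1ᵀ ((M n).1 *ᵥ v)
  rw [fro_transpose] at h4
  rw [h3, norm_smul, Real.norm_eq_abs, abs_of_nonneg (by positivity)]
  calc 1 / 2 * (fro (M n).1 * ((fro (M n).1 ^ 2)⁻¹ * ‖(M n).1ᵀ *ᵥ ((M n).1 *ᵥ v)‖))
      ≤ 1 / 2 * (fro (M n).1 * ((fro (M n).1 ^ 2)⁻¹ * (2 * fro (M n).1 * ‖(M n).1 *ᵥ v‖))) := by
        gcongr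
    _ = ‖(M n).1 *ᵥ v‖ := by field_simp

end Sequence

/-! ### Uniform exponential growth implies uniform hyperbolicity -/

section Growth

variable {X : Type*} [TopologicalSpace X]

lemma cocycleIter_add (f : X ≃ₜ X) (A : X → SL(2, ℝ)) (m n : ℕ) (x : X) :
    cocycleIter f A (m + n) x = cocycleIter f A m (f^[n] x) * cocycleIter f A n x := by
  induction m with
  | zero => simp [cocycleIter]
  | succ m ih =>
    rw [Nat.succ_add, cocycleIter, ih, cocycleIter, mul_assoc, ← Function.iterate_add_apply]

lemma cocycleIter_one (f : X ≃ₜ X) (A : X → SL(2, ℝ)) (x : X) : cocycleIter f A 1 x = A x := by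
  simp [cocycleIter]

lemma continuous_cocycleIter (f : X ≃ₜ X) {A : X → SL(2, ℝ)} (hA : Continuous A) (n : ℕ) :
    Continuous (cocycleIter f A n) := by
  induction n with
  | zero => exact continuous_const
  | succ n ih => exact (hA.comp (f.continuous.iterate n)).mul ih

lemma continuous_entry {g : X → SL(2, ℝ)} (hg : Continuous g) (i j : Fin 2) :
    Continuous fun x => (g x).1 i j :=
  (continuous_apply_apply i j).comp
    ((Continuous.comp (g := fun M : SL(2, ℝ) => M.1) continuous_induced_dom hg))

lemma continuous_fro {g : X → Mat2} (hg : ∀ i j, Continuous fun x => g x i j) :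
    Continuous fun x => fro (g x) := by
  simp only [fro]
  exact ((((hg 0 0).pow 2).add ((hg 0 1).pow 2)).add ((hg 1 0).pow 2)).add ((hg 1 1).pow 2) |>.sqrt

lemma continuous_expProj_entry {g : X → SL(2, ℝ)} (hg : Continuous g) (i j : Fin 2) :
    Continuous fun x => expProj (g x) i j := by
  simp only [expProj, Matrix.smul_apply, Matrix.mul_apply, Fin.sum_univ_two,
    Matrix.transpose_apply, smul_eq_mul]
  have h := continuous_entry hg
  refine (((continuous_fro h).pow 2).inv₀ fun x => (pow_pos (fro_pos (g x)) 2).ne').mul ?_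
  exact ((h 0 i).mul (h 0 j)).add ((h 1 i).mul (h 1 j))

/-- The determinant of `v, w` annihilates both diagonal entries of `Q`, hence its trace, which is
one. -/
lemma mem_span_of_mulVec_eq_zero {Q : Mat2} (hQ : Q 0 0 + Q 1 1 = 1) {v w : Fin 2 → ℝ}
    (hv : v ≠ 0) (h1 : Q *ᵥ v = 0) (h2 : Q *ᵥ w = 0) : ∃ c : ℝ, c • v = w := by
  have e1 := fun i => congrFun h1 i
  have e2 := fun i => congrFun h2 i
  simp only [Matrix.mulVec, dotProduct, Fin.sum_univ_two, Pi.zero_apply] at e1 e2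
  have hcross : v 0 * w 1 - v 1 * w 0 = 0 := by
    have a0 : (v 0 * w 1 - v 1 * w 0) * Q 0 0 = 0 := by linear_combination w 1 * e1 0 - v 1 * e2 0
    have a1 : (v 0 * w 1 - v 1 * w 0) * Q 1 1 = 0 := by
      linear_combination v 0 * e2 1 - w 0 * e1 1
    linear_combination a0 + a1 - (v 0 * w 1 - v 1 * w 0) * hQ
  by_cases h0 : v 0 = 0
  · have h1 : v 1 ≠ 0 := by
      intro h
      apply hv
      ext i
      fin_cases i <;> simp [h0, h]
    refine ⟨w 1 / v 1, ?_⟩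
    ext i
    fin_cases i
    · simp only [Pi.smul_apply, smul_eq_mul, Fin.zero_eta]
      field_simp
      linarith
    · simp only [Pi.smul_apply, smul_eq_mul, Fin.mk_one]
      field_simp
  · refine ⟨w 0 / v 0, ?_⟩
    ext i
    fin_cases i
    · simp only [Pi.smul_apply, smul_eq_mul, Fin.zero_eta]
      field_simp
    · simp only [Pi.smul_apply, smul_eq_mul, Fin.mk_one]
      field_simp
      linarith

/-- The image of `1 - Q` lies in the kernel of `Q`; were it zero, `Q` would be the identity, of
trace two. -/
lemma exists_mulVec_eq_zero {Q : Mat2} (hQ : Q 0 0 + Q 1 1 = 1) (h : Q * (1 - Q) = 0) :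
    ∃ v : Fin 2 → ℝ, v ≠ 0 ∧ Q *ᵥ v = 0 := by
  by_contra! hcon
  have h1 : ∀ v : Fin 2 → ℝ, (1 - Q) *ᵥ v = 0 := by
    intro v
    by_contra hne
    apply hcon _ hne
    rw [Matrix.mulVec_mulVec, h, Matrix.zero_mulVec]
  have h2 : (1 - Q) = 0 := Matrix.ext_of_mulVec_single fun i => by rw [h1, Matrix.zero_mulVec]
  have h3 : Q = 1 := (sub_eq_zero.1 h2).symm
  rw [h3] at hQ
  norm_num at hQ

lemma exists_fro_le [CompactSpace X] {A : X → SL(2, ℝ)} (hA : Continuous A) :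
    ∃ L, ∀ x, fro (A x).1 ≤ L := by
  obtain ⟨L, hL⟩ := isCompact_univ.bddAbove_image (continuous_fro (continuous_entry hA)).continuousOn
  exact ⟨L, fun x => hL ⟨x, mem_univ x, rfl⟩⟩

/-- Uniform contraction follows from contraction after a bounded number of steps. -/
lemma exists_contraction (f : X ≃ₜ X) {A : X → SL(2, ℝ)} {L : ℝ} (hL : ∀ x, fro (A x).1 ≤ L)
    {E : X → P1} (hE : ∀ x, A x • E x = E (f x)) {m : ℕ} (hm : 0 < m)
    (h : ∀ x, ∃ k, 1 ≤ k ∧ k ≤ m ∧ ∀ v ∈ (E x).submodule,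
      ‖(cocycleIter f A k x).1 *ᵥ v‖ ≤ 1 / 2 * ‖v‖) :
    ∃ C r : ℝ, 0 < C ∧ 0 < r ∧ r < 1 ∧ ∀ (n : ℕ) (x : X), ∀ v ∈ (E x).submodule,
        ‖(cocycleIter f A n x).1 *ᵥ v‖ ≤ C * r ^ n * ‖v‖ := by
  have hinv : ∀ n x, cocycleIter f A n x • E x = E (f^[n] x) := by
    intro n x
    induction n with
    | zero => simp [cocycleIter]
    | succ n ih => rw [cocycleIter, mul_smul, ih, hE, Function.iterate_succ_apply']
  -- `K` bounds the growth of a vector in one step, and `r` is chosen so that `r ^ m = 1 / 2`.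
  let K := max (2 * L) 1
  have hK1 : 1 ≤ K := le_max_right _ _
  let r : ℝ := (1 / 2 : ℝ) ^ (1 / m : ℝ)
  have hm' : (m : ℝ) ≠ 0 := by positivity
  have hr0 : 0 < r := Real.rpow_pos_of_pos (by norm_num) _
  have hr1 : r < 1 := Real.rpow_lt_one (by norm_num) (by norm_num) (by positivity)
  have hrm : r ^ m = 1 / 2 := by
    rw [← Real.rpow_natCast, ← Real.rpow_mul (by norm_num), one_div_mul_cancel hm', Real.rpow_one]
  have htriv : ∀ n x (v : Fin 2 → ℝ), ‖(cocycleIter f A n x).1 *ᵥ v‖ ≤ K ^ n * ‖v‖ := by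
    intro n x v
    induction n with
    | zero => simp [cocycleIter]
    | succ n ih =>
      rw [cocycleIter, Matrix.SpecialLinearGroup.coe_mul, ← Matrix.mulVec_mulVec]
      refine (norm_mulVec_le _ _).trans ?_
      have h1 : 2 * fro (A (f^[n] x)).1 ≤ K :=
        (mul_le_mul_of_nonneg_left (hL _) zero_le_two).trans (le_max_left _ _)
      calc _ ≤ K * (K ^ n * ‖v‖) := mul_le_mul h1 ih (norm_nonneg _) (by linarith)
        _ = K ^ (n + 1) * ‖v‖ := by ring
  -- For `n < m` the trivial bound `K ^ n` suffices, because `r ^ n ≥ 1 / 2`; this is where the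
  -- factor 2 comes from.
  refine ⟨2 * K ^ m, r, by positivity, hr0, hr1, fun n => ?_⟩
  induction n using Nat.strong_induction_on with
  | _ n ih =>
    intro x v hv
    by_cases hn : n < m
    · refine (htriv n x v).trans (mul_le_mul_of_nonneg_right ?_ (norm_nonneg v))
      have h1 : K ^ n ≤ K ^ m := pow_le_pow_right₀ hK1 hn.le
      have h2 : 1 / 2 ≤ r ^ n := hrm ▸ pow_le_pow_of_le_one hr0.le hr1.le hn.le
      have h3 : 0 < K ^ m := by positivity
      nlinarith
    · push Not at hn
      obtain ⟨k, hk1, hkm, hk⟩ := h x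
      obtain ⟨j, rfl⟩ : ∃ j, n = j + k := ⟨n - k, by omega⟩
      rw [cocycleIter_add, Matrix.SpecialLinearGroup.coe_mul, ← Matrix.mulVec_mulVec]
      have hmem : (cocycleIter f A k x).1 *ᵥ v ∈ (E (f^[k] x)).submodule := by
        rw [← hinv]
        exact mulVec_mem_smul _ hv
      refine (ih j (by omega) _ _ hmem).trans ?_
      have h2 : 1 / 2 ≤ r ^ k := hrm ▸ pow_le_pow_of_le_one hr0.le hr1.le hkm
      have h3 : 0 < 2 * K ^ m * r ^ j := by positivity
      calc 2 * K ^ m * r ^ j * ‖(cocycleIter f A k x).1 *ᵥ v‖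
          ≤ 2 * K ^ m * r ^ j * (r ^ k * ‖v‖) :=
            mul_le_mul_of_nonneg_left
              ((hk v hv).trans (mul_le_mul_of_nonneg_right h2 (norm_nonneg v))) h3.le
        _ = 2 * K ^ m * r ^ (j + k) * ‖v‖ := by rw [pow_add]; ring

/-- Under uniform exponential growth there is a continuous invariant direction field which is
uniformly contracted in the future. -/
theorem exists_stable_field [CompactSpace X] (f : X ≃ₜ X) {A : X → SL(2, ℝ)} (hA : Continuous A)
    {c l : ℝ} (hc : 0 < c) (hl : 1 < l) (hg : ∀ n x, c * l ^ n ≤ fro (cocycleIter f A n x).1) :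
    ∃ E : X → P1, Continuous E ∧ (∀ x, A x • E x = E (f x)) ∧
      ∃ C r : ℝ, 0 < C ∧ 0 < r ∧ r < 1 ∧ ∀ (n : ℕ) (x : X), ∀ v ∈ (E x).submodule,
        ‖(cocycleIter f A n x).1 *ᵥ v‖ ≤ C * r ^ n * ‖v‖ := by
  obtain ⟨L, hL⟩ := exists_fro_le hA
  have hM : ∀ x n, cocycleIter f A (n + 1) x = A (f^[n] x) * cocycleIter f A n x :=
    fun x n => rfl
  have hB : ∀ x n, fro (A (f^[n] x)).1 ≤ L := fun x n => hL _
  choose Q hQ using fun x => exists_tendsto_expProj hc hl (hM x) (hB x) (fun n => hg n x)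
  have htr := fun x => lim_trace (hQ x)
  have hidem := fun x => lim_mul_one_sub hc hl (fun n => hg n x) (hQ x)
  have hQc : ∀ i j, Continuous fun x => Q x i j := by
    intro i j
    have hu : TendstoUniformly (fun n x => expProj (cocycleIter f A n x) i j)
        (fun x => Q x i j) atTop := by
      rw [Metric.tendstoUniformly_iff]
      intro ε hε
      have hr : (l ^ 2)⁻¹ < 1 := inv_lt_one_of_one_lt₀ (one_lt_pow₀ hl two_ne_zero)
      have ht : Tendsto (fun n : ℕ => 2 * L / c ^ 2 * ((l ^ 2)⁻¹) ^ n / (1 - (l ^ 2)⁻¹)) atTop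
          (𝓝 0) := by
        simpa using ((tendsto_pow_atTop_nhds_zero_of_lt_one (by positivity) hr).const_mul
          (2 * L / c ^ 2)).div_const (1 - (l ^ 2)⁻¹)
      filter_upwards [ht.eventually_lt_const hε] with n hn x
      rw [dist_comm]
      exact (dist_expProj_lim_le hc hl (hM x) (hB x) (fun n => hg n x) (hQ x) n i j).trans_lt hn
    exact hu.continuous (Frequently.of_forall fun n =>
      continuous_expProj_entry (continuous_cocycleIter f hA n) i j)
  choose e he0 he using fun x => exists_mulVec_eq_zero (htr x) (hidem x)
  let E : X → P1 := fun x => Projectivization.mk ℝ (e x) (he0 x)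
  have hmem : ∀ x v, v ∈ (E x).submodule ↔ Q x *ᵥ v = 0 := by
    intro x v
    rw [mem_submodule_mk]
    constructor
    · rintro ⟨a, rfl⟩
      rw [Matrix.mulVec_smul, he, smul_zero]
    · exact mem_span_of_mulVec_eq_zero (htr x) (he0 x) (he x)
  have hEc : Continuous E := by
    rw [continuous_iff_continuousAt]
    intro x
    -- Projecting the fixed vector `e x` to the nearby kernels gives a continuous section, equal to
    -- `e x` at `x`.
    refine continuousAt_of_section (w := fun y => (1 - Q y) *ᵥ e x) ?_ ?_ ?_
    · refine Continuous.continuousAt (continuous_pi fun i => ?_)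
      simp only [Matrix.mulVec, dotProduct, Fin.sum_univ_two, Matrix.sub_apply]
      exact ((continuous_const.sub (hQc i 0)).mul_const _).add
        ((continuous_const.sub (hQc i 1)).mul_const _)
    · rw [one_sub_mulVec_eq_self_iff.2 (he x)]
      exact he0 x
    · intro y
      rw [hmem, Matrix.mulVec_mulVec, hidem, Matrix.zero_mulVec]
  have hsmall : ∀ x, ∀ ε > 0, ∀ N, ∃ n, N ≤ n ∧ fro ((cocycleIter f A n x).1 * (1 - Q x)) < ε := by
    intro x ε hε N
    obtain ⟨C, hC⟩ := fro_mul_one_sub_lim_le hc hl (hM x) (hB x) (fun n => hg n x) (hQ x)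
    have ht : Tendsto (fun n => C / fro (cocycleIter f A n x).1) atTop (𝓝 0) :=
      (tendsto_fro_atTop hc hl fun n => hg n x).const_div_atTop C
    obtain ⟨N', hN'⟩ := (ht.eventually_lt_const hε).exists_forall_of_atTop
    obtain ⟨n, hn, h⟩ := hC (max N N')
    exact ⟨n, (le_max_left _ _).trans hn, h.trans_lt (hN' n ((le_max_right _ _).trans hn))⟩
  have hEv : ∀ x n v, v ∈ (E x).submodule →
      ‖(cocycleIter f A n x).1 *ᵥ v‖ ≤ 2 * fro ((cocycleIter f A n x).1 * (1 - Q x)) * ‖v‖ := by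
    intro x n v hv
    have h := norm_mulVec_le ((cocycleIter f A n x).1 * (1 - Q x)) v
    rwa [← Matrix.mulVec_mulVec, one_sub_mulVec_eq_self_iff.2 ((hmem x v).1 hv)] at h
  have hinv : ∀ x, A x • E x = E (f x) := by
    intro x
    rw [smul_mk_P1]
    refine mk_eq_of_mem _ ?_
    rw [hmem]
    -- Outside the kernel of `Q (f x)` the orbit of `A x (e x)` would tend to infinity, whereas the
    -- orbit of `e x` is small at its good times.
    by_contra hne
    have ht := tendsto_norm_mulVec_atTop hc hl (fun n => hg n (f x)) (hQ (f x)) hne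
    have heq : ∀ n, (cocycleIter f A n (f x)).1 *ᵥ ((A x).1 *ᵥ e x) =
        (cocycleIter f A (n + 1) x).1 *ᵥ e x := by
      intro n
      rw [cocycleIter_add, cocycleIter_one, Matrix.SpecialLinearGroup.coe_mul,
        ← Matrix.mulVec_mulVec]
      rfl
    simp only [heq] at ht
    obtain ⟨N, hN⟩ := (ht.eventually_gt_atTop (2 * ‖e x‖)).exists_forall_of_atTop
    obtain ⟨n, hn, hlt⟩ := hsmall x 1 one_pos (N + 1)
    obtain ⟨k, rfl⟩ : ∃ k, n = k + 1 := ⟨n - 1, by omega⟩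
    have h1 := hN k (by omega)
    have h2 := hEv x (k + 1) (e x) ((hmem x _).2 (he x))
    have h3 := norm_nonneg (e x)
    nlinarith
  refine ⟨E, hEc, hinv, ?_⟩
  -- The contraction time depends on the point, but contraction by a given time is an open
  -- condition; compactness bounds the times.
  let W : ℕ → Set X := fun m => ⋃ k ∈ Icc 1 m,
    {x | fro ((cocycleIter f A k x).1 * (1 - Q x)) < 1 / 4}
  have hWo : ∀ m, IsOpen (W m) := by
    intro m
    refine isOpen_biUnion fun k _ => isOpen_lt (continuous_fro fun i j => ?_) continuous_const
    simp only [Matrix.mul_apply, Fin.sum_univ_two, Matrix.sub_apply]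
    have h := continuous_entry (continuous_cocycleIter f hA k)
    exact ((h i 0).mul (continuous_const.sub (hQc 0 j))).add
      ((h i 1).mul (continuous_const.sub (hQc 1 j)))
  have hWm : Monotone W := fun a b hab =>
    biUnion_subset_biUnion_left fun k hk => ⟨hk.1, hk.2.trans hab⟩
  have hcov : univ ⊆ ⋃ m, W m := by
    intro x _
    obtain ⟨n, hn, h⟩ := hsmall x (1 / 4) (by norm_num) 1
    exact mem_iUnion.2 ⟨n, mem_iUnion₂.2 ⟨n, ⟨hn, le_rfl⟩, h⟩⟩
  obtain ⟨m, hm⟩ := isCompact_univ.elim_directed_cover W hWo hcov (directed_of_isDirected_le hWm)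
  refine exists_contraction f hL hinv (m := m + 1) (Nat.succ_pos m) fun x => ?_
  obtain ⟨k, hk, hx⟩ := mem_iUnion₂.1 (hm (mem_univ x))
  refine ⟨k, hk.1, hk.2.trans (Nat.le_succ m), fun v hv => (hEv x k v hv).trans ?_⟩
  have hx' : fro ((cocycleIter f A k x).1 * (1 - Q x)) < 1 / 4 := hx
  exact mul_le_mul_of_nonneg_right (by linarith) (norm_nonneg v)

lemma cocycleIter_symm (f : X ≃ₜ X) (A : X → SL(2, ℝ)) (n : ℕ) (x : X) :
    cocycleIter f.symm (fun y => (A (f.symm y))⁻¹) n x = cocycleIterNeg f A n x := by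
  induction n with
  | zero => simp [cocycleIter, cocycleIterNeg]
  | succ n ih =>
    rw [cocycleIter, ih, cocycleIterNeg, cocycleIterNeg, cocycleIter_add, cocycleIter_one, mul_inv_rev,
      Function.iterate_succ_apply']
    simp

/-- A matrix and its inverse have the same norm, so the inverse cocycle grows as well, and its
stable field is `Eu`. A direction common to `Es` and `Eu` would be contracted in going back `n`
steps and contracted again in returning, although the composition is the identity. -/
theorem uniformlyHyperbolic_of_growth [CompactSpace X] (f : X ≃ₜ X) {A : X → SL(2, ℝ)}
    (hA : Continuous A) {c l : ℝ} (hc : 0 < c) (hl : 1 < l)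
    (hg : ∀ n x, c * l ^ n ≤ fro (cocycleIter f A n x).1) : UniformlyHyperbolic f A := by
  obtain ⟨Es, hEs, hsinv, C, r, hC, hr0, hr1, hs⟩ := exists_stable_field f hA hc hl hg
  have hg' : ∀ n x, c * l ^ n ≤
      fro (cocycleIter f.symm (fun y => (A (f.symm y))⁻¹) n x).1 := by
    intro n x
    rw [cocycleIter_symm, cocycleIterNeg, fro_inv]
    exact hg n _
  obtain ⟨Eu, hEu, huinv, C', r', hC', hr0', hr1', hu⟩ :=
    exists_stable_field f.symm (A := fun y => (A (f.symm y))⁻¹) (hA.comp f.symm.continuous).inv hc hl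
      hg'
  simp only [cocycleIter_symm] at hu
  have huinv' : ∀ x, A x • Eu x = Eu (f x) := by
    intro x
    have h := huinv (f x)
    simp only [Homeomorph.symm_apply_apply] at h
    rw [← h, smul_inv_smul]
  have hsinv' : ∀ n x, cocycleIterNeg f A n x • Es x = Es (f.symm^[n] x) := by
    intro n x
    induction n with
    | zero => simp [cocycleIter, cocycleIterNeg]
    | succ n ih =>
      rw [← cocycleIter_symm, cocycleIter, cocycleIter_symm, mul_smul, ih,
        Function.iterate_succ_apply', inv_smul_eq_iff, hsinv, f.apply_symm_apply]
  refine ⟨Es, Eu, hEs, hEu, fun x => ?_, hsinv, huinv', max C C', max r r',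
    hC.trans_le (le_max_left _ _), hr0.trans_le (le_max_left _ _), max_lt hr1 hr1', fun n x => ⟨?_, ?_⟩⟩
  · have hne : Es x ≠ Eu x := by
      intro heq
      obtain ⟨v, hv, hv0⟩ := exists_ne_zero_mem (Es x)
      have hvn : 0 < ‖v‖ := norm_pos_iff.2 hv0
      have hle : ∀ n : ℕ, 1 ≤ C * C' * (r * r') ^ n := by
        intro n
        have h1 := hu n x v (heq ▸ hv)
        have h2 := hs n (f.symm^[n] x) (cocycleIterNeg f A n x *ᵥ v)
          (hsinv' n x ▸ mulVec_mem_smul _ hv)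
        rw [Matrix.mulVec_mulVec] at h2
        have h3 : (cocycleIter f A n (f.symm^[n] x)).1 * (cocycleIterNeg f A n x).1 = 1 :=
          coe_mul_inv _
        rw [h3, Matrix.one_mulVec] at h2
        have h4 : ‖v‖ ≤ C * C' * (r * r') ^ n * ‖v‖ :=
          calc ‖v‖ ≤ C * r ^ n * ‖(cocycleIterNeg f A n x).1 *ᵥ v‖ := h2
            _ ≤ C * r ^ n * (C' * r' ^ n * ‖v‖) := mul_le_mul_of_nonneg_left h1 (by positivity)
            _ = C * C' * (r * r') ^ n * ‖v‖ := by rw [mul_pow]; ring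
        exact le_of_mul_le_mul_right (by linarith) hvn
      have hlim : Tendsto (fun n : ℕ => C * C' * (r * r') ^ n) atTop (𝓝 0) := by
        simpa using (tendsto_pow_atTop_nhds_zero_of_lt_one (by positivity)
          (mul_lt_one_of_nonneg_of_lt_one_left hr0.le hr1 hr1'.le)).const_mul (C * C')
      have := ge_of_tendsto' hlim hle
      linarith
    have hdisj : Disjoint (Es x).submodule (Eu x).submodule := by
      rw [Submodule.disjoint_def]
      intro v hv1 hv2
      by_contra hv0
      exact hne ((mk_eq_of_mem hv0 hv1).symm.trans (mk_eq_of_mem hv0 hv2))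
    refine ⟨hdisj, ?_⟩
    rw [codisjoint_iff]
    apply Submodule.eq_top_of_finrank_eq
    have h := Submodule.finrank_sup_add_finrank_inf_eq (Es x).submodule (Eu x).submodule
    rw [hdisj.eq_bot, finrank_bot, Projectivization.finrank_submodule,
      Projectivization.finrank_submodule] at h
    simp at h ⊢
    omega
  · intro v hv
    refine (hs n x v hv).trans (mul_le_mul_of_nonneg_right ?_ (norm_nonneg v))
    exact mul_le_mul (le_max_left _ _) (pow_le_pow_left₀ hr0.le (le_max_left _ _) n)
      (by positivity) (hC.le.trans (le_max_left _ _))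
  · intro v hv
    refine (hu n x v hv).trans (mul_le_mul_of_nonneg_right ?_ (norm_nonneg v))
    exact mul_le_mul (le_max_right _ _) (pow_le_pow_left₀ hr0'.le (le_max_right _ _) n)
      (by positivity) (hC.le.trans (le_max_left _ _))

end Growth

/-! ### Consequences of uniform hyperbolicity -/

lemma one_le_false_of_geometric {C r a : ℝ} (hr0 : 0 ≤ r) (hr1 : r < 1) (ha : 1 ≤ a)
    (h : ∀ n : ℕ, a ^ n ≤ C * r ^ n) : False := by
  have hlim : Tendsto (fun n : ℕ => C * r ^ n) atTop (𝓝 0) := by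
    simpa using (tendsto_pow_atTop_nhds_zero_of_lt_one hr0 hr1).const_mul C
  have := ge_of_tendsto' hlim fun n => (one_le_pow₀ ha).trans (h n)
  linarith

lemma shift_iterate_apply (n : ℕ) (x : ℤ → Fin 2) (i : ℤ) : (shift^[n] x) i = x (i + n) := by
  induction n generalizing i with
  | zero => simp
  | succ n ih =>
    rw [Function.iterate_succ_apply']
    change (shift^[n] x) (i + 1) = _
    rw [ih]
    push_cast
    congr 1
    ring

lemma shift_symm_iterate_apply (n : ℕ) (x : ℤ → Fin 2) (i : ℤ) :
    (shift.symm^[n] x) i = x (i - n) := by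
  induction n generalizing i with
  | zero => simp
  | succ n ih =>
    rw [Function.iterate_succ_apply']
    change (shift.symm^[n] x) (i - 1) = _
    rw [ih]
    push_cast
    congr 1
    ring

/-- The latest letter multiplies on the left, whence the reversal. -/
lemma cocycleIter_shift (p : SL(2, ℝ) × SL(2, ℝ)) (n : ℕ) (x : ℤ → Fin 2) :
    cocycleIter shift (fun x => letter p (x 0)) n x =
      ((List.ofFn fun i : Fin n => x (i : ℕ)).reverse.map (letter p)).prod := by
  induction n with
  | zero => simp [cocycleIter]
  | succ n ih =>
    rw [cocycleIter, ih, List.ofFn_succ_last, List.reverse_append, List.map_append, List.prod_append]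
    simp [shift_iterate_apply]

/-- Exponential growth of all products of the two matrices. -/
def HasGrowth (p : SL(2, ℝ) × SL(2, ℝ)) : Prop :=
  ∃ c l : ℝ, 0 < c ∧ 1 < l ∧ ∀ w : List (Fin 2), c * l ^ w.length ≤ fro (w.map (letter p)).prod.1

lemma HasGrowth.mem_hypLocus {p : SL(2, ℝ) × SL(2, ℝ)} (h : HasGrowth p) : p ∈ hypLocus := by
  obtain ⟨c, l, hc, hl, h⟩ := h
  refine uniformlyHyperbolic_of_growth shift ?_ hc hl fun n x => ?_
  · exact continuous_of_discreteTopology.comp (continuous_apply 0)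
  · rw [cocycleIter_shift]
    simpa using h (List.ofFn fun i : Fin n => x (i : ℕ)).reverse

lemma charpoly_eq_zero {P : SL(2, ℝ)} {v : Fin 2 → ℝ} (hv : v ≠ 0) {μ : ℝ} (h : P.1 *ᵥ v = μ • v) :
    μ ^ 2 - P.1.trace * μ + 1 = 0 := by
  have e := fun i => congrFun h i
  simp only [Matrix.mulVec, dotProduct, Fin.sum_univ_two, Pi.smul_apply, smul_eq_mul] at e
  have hd := det_eq P
  rw [Matrix.trace_fin_two]
  have h0 : (μ ^ 2 - (P.1 0 0 + P.1 1 1) * μ + 1) * v 0 = 0 := by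
    linear_combination (P.1 1 1 - μ) * e 0 - P.1 0 1 * e 1 - v 0 * hd
  have h1 : (μ ^ 2 - (P.1 0 0 + P.1 1 1) * μ + 1) * v 1 = 0 := by
    linear_combination (P.1 0 0 - μ) * e 1 - P.1 1 0 * e 0 - v 1 * hd
  by_contra hne
  apply hv
  ext i
  fin_cases i
  · exact (mul_eq_zero.1 h0).resolve_left hne
  · exact (mul_eq_zero.1 h1).resolve_left hne

/-- The other eigenvalue is `μ⁻¹`, and `|μ| + |μ|⁻¹ > 2`. -/
lemma hyperbolic_of_contracted {P : SL(2, ℝ)} {v : Fin 2 → ℝ} (hv : v ≠ 0) {μ : ℝ}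
    (h : P.1 *ᵥ v = μ • v) (hμ : |μ| < 1) : Hyperbolic P := by
  have hc := charpoly_eq_zero hv h
  have hμ0 : 0 < |μ| := by
    rw [abs_pos]
    rintro rfl
    simp at hc
  have h1 : |P.1.trace| * |μ| = |μ| ^ 2 + 1 := by
    rw [← abs_mul, sq_abs, show P.1.trace * μ = μ ^ 2 + 1 by linarith]
    exact abs_of_pos (by positivity)
  rw [Hyperbolic]
  by_contra! hle
  nlinarith [mul_le_mul_of_nonneg_right hle hμ0.le, sq_nonneg (1 - |μ|), sq_pos_of_pos (sub_pos.2 hμ)]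

/-- At the periodic point `x` that repeats the reversed word, the product of `w` fixes the direction
`Es x`, and uniform contraction along the powers of the product makes the eigenvalue there smaller
than one in modulus. -/
theorem hyperbolic_of_mem_hypLocus {p : SL(2, ℝ) × SL(2, ℝ)} (hp : p ∈ hypLocus)
    {w : List (Fin 2)} (hw : w ≠ []) : Hyperbolic (w.map (letter p)).prod := by
  obtain ⟨Es, Eu, -, -, -, hs, -, C, r, hC, hr0, hr1, hcon⟩ := hp
  have hn : 0 < w.length := List.length_pos_iff.2 hw
  let x : ℤ → Fin 2 := fun i => w.reverse.getD (i % w.length).toNat 0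
  have hper : shift^[w.length] x = x := by
    ext i
    rw [shift_iterate_apply]
    simp [x]
  set f := fun x : ℤ → Fin 2 => letter p (x 0)
  have hP : cocycleIter shift f w.length x = (w.map (letter p)).prod := by
    rw [cocycleIter_shift]
    congr 2
    rw [List.reverse_eq_iff]
    refine List.ext_getElem (by simp) fun i h1 h2 => ?_
    have hi : i < w.length := by simpa using h1
    have : ((i : ℤ) % (w.length : ℤ)).toNat = i := by
      rw [Int.emod_eq_of_lt (by positivity) (by exact_mod_cast hi)]
      simp
    simp only [List.getElem_ofFn, x, this]
    exact List.getD_eq_getElem _ _ h2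
  have hPk : ∀ k, cocycleIter shift f (k * w.length) x = (w.map (letter p)).prod ^ k := by
    intro k
    induction k with
    | zero => simp [cocycleIter]
    | succ k ih => rw [Nat.succ_mul, cocycleIter_add, hper, ih, hP, pow_succ]
  have hinv : ∀ n, cocycleIter shift f n x • Es x = Es (shift^[n] x) := by
    intro n
    induction n with
    | zero => simp [cocycleIter]
    | succ n ih => rw [cocycleIter, mul_smul, ih, hs, Function.iterate_succ_apply']
  obtain ⟨v, hv, hv0⟩ := exists_ne_zero_mem (Es x)
  set P := (w.map (letter p)).prod
  have h1 : P.1 *ᵥ v ∈ (Es x).submodule := by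
    have h2 := mulVec_mem_smul (cocycleIter shift f w.length x) hv
    rwa [hinv, hper, hP] at h2
  rw [← mk_eq_of_mem hv0 hv, mem_submodule_mk] at h1
  obtain ⟨μ, hμ⟩ := h1
  have hpow : ∀ k : ℕ, (P ^ k).1 *ᵥ v = μ ^ k • v := by
    intro k
    induction k with
    | zero => simp
    | succ k ih =>
      rw [pow_succ, Matrix.SpecialLinearGroup.coe_mul, ← Matrix.mulVec_mulVec, ← hμ,
        Matrix.mulVec_smul, ih, smul_smul, pow_succ, mul_comm]
  refine hyperbolic_of_contracted hv0 hμ.symm ?_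
  by_contra! hge
  refine one_le_false_of_geometric (C := C) (r := r ^ w.length) (by positivity)
    (pow_lt_one₀ hr0.le hr1 hn.ne') hge fun k => ?_
  have h3 := (hcon (k * w.length) x).1 v hv
  rw [hPk, hpow, norm_smul, norm_pow, Real.norm_eq_abs, mul_comm k, pow_mul] at h3
  exact le_of_mul_le_mul_right h3 (norm_pos_iff.2 hv0)

lemma cocycleIter_mulVec_of_eigen {p : SL(2, ℝ) × SL(2, ℝ)} {a : Fin 2} {c : ℝ} {v : Fin 2 → ℝ}
    (hv : (letter p a).1 *ᵥ v = c • v) {x : ℤ → Fin 2} {n : ℕ} (hx : ∀ k : ℕ, k < n → x k = a) :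
    (cocycleIter shift (fun x => letter p (x 0)) n x).1 *ᵥ v = c ^ n • v := by
  induction n with
  | zero => simp [cocycleIter]
  | succ n ih =>
    rw [cocycleIter, Matrix.SpecialLinearGroup.coe_mul, ← Matrix.mulVec_mulVec,
      ih fun k hk => hx k (hk.trans n.lt_succ_self), shift_iterate_apply, zero_add,
      hx n n.lt_succ_self, Matrix.mulVec_smul, hv, smul_smul, pow_succ]

/-- At the point `…aaa.bbb…` the direction `d` is contracted in the future, so it is `Es`. By
invariance it is also `Es` at all points of the past orbit, but from there it is expanded by powers
of `c`. -/
theorem not_unstable_eq_stable_of_mem_hypLocus {p : SL(2, ℝ) × SL(2, ℝ)} (hp : p ∈ hypLocus)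
    {a b : Fin 2} {d : P1} {c c' : ℝ} (hc : 1 < |c|) (hc' : |c'| < 1)
    (hu : ∀ v ∈ d.submodule, (letter p a).1 *ᵥ v = c • v)
    (hst : ∀ v ∈ d.submodule, (letter p b).1 *ᵥ v = c' • v) : False := by
  obtain ⟨Es, Eu, -, -, hcompl, hs, hu', C, r, hC, hr0, hr1, hcon⟩ := hp
  set f := fun x : ℤ → Fin 2 => letter p (x 0)
  have hinv : ∀ (E : (ℤ → Fin 2) → P1), (∀ x, f x • E x = E (shift x)) → ∀ n x,
      cocycleIter shift f n x • E x = E (shift^[n] x) := by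
    intro E hE n x
    induction n with
    | zero => simp [cocycleIter]
    | succ n ih => rw [cocycleIter, mul_smul, ih, hE, Function.iterate_succ_apply']
  let x : ℤ → Fin 2 := fun i => if i < 0 then a else b
  obtain ⟨v, hv, hv0⟩ := exists_ne_zero_mem d
  have hfwd : ∀ n, (cocycleIter shift f n x).1 *ᵥ v = c' ^ n • v := fun n =>
    cocycleIter_mulVec_of_eigen (hst v hv) fun k _ => by simp [x]
  -- Split `v = s + u`. Since `v` and `s` are contracted in the future, so is `u`; but `u` is
  -- recovered from its future by a contraction, hence vanishes.
  have hmem : v ∈ (Es x).submodule := by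
    have htop : v ∈ (Es x).submodule ⊔ (Eu x).submodule := by
      rw [(hcompl x).sup_eq_top]
      trivial
    obtain ⟨s, hsm, u, hum, hsu⟩ := Submodule.mem_sup.1 htop
    suffices hu0 : u = 0 by rw [← hsu, hu0, add_zero]; exact hsm
    have hbound : ∀ n : ℕ, ‖u‖ ≤ C * r ^ n * (|c'| ^ n * ‖v‖ + C * r ^ n * ‖s‖) := by
      intro n
      have h1 := (hcon n (shift^[n] x)).2 ((cocycleIter shift f n x).1 *ᵥ u)
        (hinv Eu hu' n x ▸ mulVec_mem_smul _ hum)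
      have h2 : cocycleIterNeg shift f n (shift^[n] x) = (cocycleIter shift f n x)⁻¹ := by
        rw [cocycleIterNeg]
        congr 2
        exact Function.LeftInverse.iterate shift.symm_apply_apply n x
      rw [h2, Matrix.mulVec_mulVec, coe_inv_mul, Matrix.one_mulVec] at h1
      refine h1.trans (mul_le_mul_of_nonneg_left ?_ (by positivity))
      have h3 : u = v - s := by rw [← hsu]; abel
      rw [h3, Matrix.mulVec_sub, hfwd]
      refine (norm_sub_le _ _).trans (add_le_add ?_ ((hcon n x).1 s hsm))
      rw [norm_smul, norm_pow, Real.norm_eq_abs]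
    have hr := tendsto_pow_atTop_nhds_zero_of_lt_one hr0.le hr1
    have hlim : Tendsto (fun n : ℕ => C * r ^ n * (|c'| ^ n * ‖v‖ + C * r ^ n * ‖s‖)) atTop
        (𝓝 0) := by
      have h4 := (hr.const_mul C).mul
        (((tendsto_pow_atTop_nhds_zero_of_lt_one (abs_nonneg c') hc').mul_const ‖v‖).add
          ((hr.const_mul C).mul_const ‖s‖))
      simpa using h4
    exact norm_le_zero_iff.1 (ge_of_tendsto' hlim hbound)
  have hd : d = Es x := (mk_eq_of_mem hv0 hv).symm.trans (mk_eq_of_mem hv0 hmem)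
  refine one_le_false_of_geometric (C := C) hr0.le hr1 hc.le fun n => ?_
  set y := shift.symm^[n] x
  have hyx : shift^[n] y = x := Function.LeftInverse.iterate shift.apply_symm_apply n x
  have hbwd : (cocycleIter shift f n y).1 *ᵥ v = c ^ n • v :=
    cocycleIter_mulVec_of_eigen (hu v hv) fun k hk => by
      simp only [y, x, shift_symm_iterate_apply]
      rw [if_pos (by omega)]
  have hfix : cocycleIter shift f n y • d = d := by
    have h1 : (cocycleIter shift f n y).1 *ᵥ v ∈ d.submodule := by
      rw [hbwd]
      exact Submodule.smul_mem _ _ hv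
    have h2 := mulVec_mem_smul (cocycleIter shift f n y) hv
    have h3 := mulVec_ne_zero (cocycleIter shift f n y) hv0
    exact (mk_eq_of_mem h3 h2).symm.trans (mk_eq_of_mem h3 h1)
  have hy : Es y = d := by
    have h1 := hinv Es hs n y
    rw [hyx, ← hd] at h1
    exact smul_left_cancel _ (h1.trans hfix.symm)
  have h5 := (hcon n y).1 v (hy ▸ hv)
  rw [hbwd, norm_smul, norm_pow, Real.norm_eq_abs] at h5
  exact le_of_mul_le_mul_right h5 (norm_pos_iff.2 hv0)

/-! ### Changing signs -/

lemma neg_smul_P1 (A : SL(2, ℝ)) (d : P1) : (-A) • d = A • d := by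
  induction d using Projectivization.ind with
  | h v hv =>
    rw [smul_mk_P1, smul_mk_P1, Projectivization.mk_eq_mk_iff']
    exact ⟨-1, by simp [Matrix.neg_mulVec]⟩

theorem UniformlyHyperbolic.of_eq_or_eq_neg {X : Type*} [TopologicalSpace X] {f : X ≃ₜ X}
    {A A' : X → SL(2, ℝ)} (h : UniformlyHyperbolic f A) (hA : ∀ x, A' x = A x ∨ A' x = -A x) :
    UniformlyHyperbolic f A' := by
  have hsm : ∀ x (d : P1), A' x • d = A x • d := by
    intro x d
    rcases hA x with h | h
    · rw [h]
    · rw [h, neg_smul_P1]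
  have hit : ∀ n x, cocycleIter f A' n x = cocycleIter f A n x ∨
      cocycleIter f A' n x = -cocycleIter f A n x := by
    intro n x
    induction n with
    | zero => exact Or.inl rfl
    | succ n ih =>
      simp only [cocycleIter]
      rcases ih with h1 | h1 <;> rcases hA (f^[n] x) with h2 | h2 <;> simp [h1, h2]
  obtain ⟨Es, Eu, hEs, hEu, hc, hs, hu, C, r, hC, hr0, hr1, hcon⟩ := h
  refine ⟨Es, Eu, hEs, hEu, hc, fun x => (hsm x _).trans (hs x), fun x => (hsm x _).trans (hu x), C,
    r, hC, hr0, hr1, fun n x => ⟨fun v hv => ?_, fun v hv => ?_⟩⟩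
  · have h := (hcon n x).1 v hv
    rcases hit n x with h1 | h1
    · rwa [h1]
    · rwa [h1, Matrix.SpecialLinearGroup.coe_neg, Matrix.neg_mulVec, norm_neg]
  · have h := (hcon n x).2 v hv
    rw [cocycleIterNeg] at h ⊢
    rcases hit n (f.symm^[n] x) with h1 | h1
    · rwa [h1]
    · rwa [h1, inv_neg, Matrix.SpecialLinearGroup.coe_neg, Matrix.neg_mulVec, norm_neg]

lemma mem_hypLocus_of_eq_or_eq_neg {p q : SL(2, ℝ) × SL(2, ℝ)} (h : p ∈ hypLocus)
    (h1 : q.1 = p.1 ∨ q.1 = -p.1) (h2 : q.2 = p.2 ∨ q.2 = -p.2) : q ∈ hypLocus := by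
  refine UniformlyHyperbolic.of_eq_or_eq_neg h fun x => ?_
  obtain h0 | h0 : x 0 = 0 ∨ x 0 = 1 := by
    generalize x 0 = i
    fin_cases i <;> simp
  · simpa [h0, letter] using h1
  · simpa [h0, letter] using h2

/-! ### Traces of a pair and conjugation -/

/-- The trace of the first matrix. -/
def trA (p : SL(2, ℝ) × SL(2, ℝ)) : ℝ := p.1.1.trace

/-- The trace of the second matrix. -/
def trB (p : SL(2, ℝ) × SL(2, ℝ)) : ℝ := p.2.1.trace

/-- The trace of the product. -/
def trAB (p : SL(2, ℝ) × SL(2, ℝ)) : ℝ := (p.1 * p.2).1.trace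

/-- The trace of the commutator, as a polynomial in the three traces. -/
def trComm (p : SL(2, ℝ) × SL(2, ℝ)) : ℝ :=
  trA p ^ 2 + trB p ^ 2 + trAB p ^ 2 - trA p * trB p * trAB p - 2

/-- Simultaneous conjugation. -/
def conjPair (g : SL(2, ℝ)) (p : SL(2, ℝ) × SL(2, ℝ)) : SL(2, ℝ) × SL(2, ℝ) :=
  (g * p.1 * g⁻¹, g * p.2 * g⁻¹)

lemma trace_conj (g : SL(2, ℝ)) (M : Mat2) : (g.1 * M * (g⁻¹).1).trace = M.trace := by
  rw [Matrix.trace_mul_cycle, coe_inv_mul, one_mul]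

lemma trA_conjPair (g : SL(2, ℝ)) (p : SL(2, ℝ) × SL(2, ℝ)) : trA (conjPair g p) = trA p :=
  trace_conj g _

lemma trB_conjPair (g : SL(2, ℝ)) (p : SL(2, ℝ) × SL(2, ℝ)) : trB (conjPair g p) = trB p :=
  trace_conj g _

lemma trAB_conjPair (g : SL(2, ℝ)) (p : SL(2, ℝ) × SL(2, ℝ)) : trAB (conjPair g p) = trAB p := by
  have h : (conjPair g p).1 * (conjPair g p).2 = g * (p.1 * p.2) * g⁻¹ := by
    simp [conjPair, mul_assoc]
  rw [trAB, h]
  exact trace_conj g _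

lemma trComm_conjPair (g : SL(2, ℝ)) (p : SL(2, ℝ) × SL(2, ℝ)) :
    trComm (conjPair g p) = trComm p := by
  rw [trComm, trA_conjPair, trB_conjPair, trAB_conjPair, trComm]

lemma letter_conjPair (g : SL(2, ℝ)) (p : SL(2, ℝ) × SL(2, ℝ)) (i : Fin 2) :
    letter (conjPair g p) i = g * letter p i * g⁻¹ := by
  fin_cases i <;> rfl

lemma prod_letter_conjPair (g : SL(2, ℝ)) (p : SL(2, ℝ) × SL(2, ℝ)) (w : List (Fin 2)) :
    (w.map (letter (conjPair g p))).prod = g * (w.map (letter p)).prod * g⁻¹ := by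
  induction w with
  | nil => simp
  | cons a w ih => simp [ih, letter_conjPair, mul_assoc]

lemma HasGrowth.of_conjPair {g : SL(2, ℝ)} {p : SL(2, ℝ) × SL(2, ℝ)}
    (h : HasGrowth (conjPair g p)) : HasGrowth p := by
  obtain ⟨c, l, hc, hl, h⟩ := h
  have hg := fro_pos g
  refine ⟨c / fro g.1 ^ 2, l, by positivity, hl, fun w => ?_⟩
  have h1 := h w
  rw [prod_letter_conjPair, Matrix.SpecialLinearGroup.coe_mul, Matrix.SpecialLinearGroup.coe_mul]
    at h1
  have h2 := (fro_mul_le (g.1 * (w.map (letter p)).prod.1) (g⁻¹).1).trans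
    (mul_le_mul_of_nonneg_right (fro_mul_le _ _) (fro_nonneg _))
  rw [fro_inv] at h2
  rw [div_mul_eq_mul_div, div_le_iff₀ (by positivity)]
  nlinarith [h1.trans h2]

lemma conjPair_conjPair (g h : SL(2, ℝ)) (p : SL(2, ℝ) × SL(2, ℝ)) :
    conjPair g (conjPair h p) = conjPair (g * h) p := by
  simp [conjPair, mul_assoc]

lemma conjPair_one (p : SL(2, ℝ) × SL(2, ℝ)) : conjPair 1 p = p := by
  simp [conjPair]

/-! ### Simultaneous conjugation of two real involutions. -/

/-- A traceless matrix of negative determinant is diagonalizable. -/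
lemma exists_diagonalize {M : Mat2} {r : ℝ} (hr : 0 < r) (ht : M 0 0 + M 1 1 = 0)
    (hd : M 0 0 ^ 2 + M 0 1 * M 1 0 = r ^ 2) :
    ∃ g : SL(2, ℝ), g.1 * M * (g⁻¹).1 = !![r, 0; 0, -r] := by
  suffices h : ∃ a b c d : ℝ, 0 < a * d - b * c ∧ M 0 0 * a + M 0 1 * c = r * a ∧
      M 1 0 * a + M 1 1 * c = r * c ∧ M 0 0 * b + M 0 1 * d = -r * b ∧
      M 1 0 * b + M 1 1 * d = -r * d by
    obtain ⟨a, b, c, d, hD, h1, h2, h3, h4⟩ := h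
    set s := √(a * d - b * c) with hs
    have hs0 : 0 < s := Real.sqrt_pos.2 hD
    have hs2 : s ^ 2 = a * d - b * c := Real.sq_sqrt hD.le
    let P : SL(2, ℝ) := ⟨!![a / s, b / s; c / s, d / s], by
      rw [Matrix.det_fin_two_of]
      field_simp
      linarith⟩
    refine ⟨P⁻¹, ?_⟩
    have hP : M * P.1 = P.1 * !![r, 0; 0, -r] := by
      ext i j
      fin_cases i <;> fin_cases j <;> simp [P, Matrix.mul_apply, Fin.sum_univ_two] <;>
        field_simp <;> linarith
    rw [inv_inv, mul_assoc, hP, ← mul_assoc, coe_inv_mul, one_mul]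
  have ht' : M 1 1 = -M 0 0 := by linarith
  -- The eigenvectors are, up to sign, columns of `M + r` and `M - r`. The two choices have
  -- determinants `2r(r + M 0 0)` and `2r(r - M 0 0)`, and the sign of `M 0 0` tells which one is
  -- safely positive.
  rcases le_total 0 (M 0 0) with h0 | h0
  · refine ⟨M 0 0 + r, -M 0 1, M 1 0, M 0 0 + r, ?_, ?_, ?_, ?_, ?_⟩ <;> (try rw [ht']) <;> nlinarith
  · refine ⟨M 0 1, M 0 0 - r, r - M 0 0, M 1 0, ?_, ?_, ?_, ?_, ?_⟩ <;> (try rw [ht']) <;> nlinarith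

lemma conj_neg_det (g : SL(2, ℝ)) {R : Mat2} (ht : R 0 0 + R 1 1 = 0) {e : ℝ}
    (hd : R 0 0 ^ 2 + R 0 1 * R 1 0 = e) :
    (g.1 * R * (g⁻¹).1) 0 0 + (g.1 * R * (g⁻¹).1) 1 1 = 0 ∧
    (g.1 * R * (g⁻¹).1) 0 0 ^ 2 + (g.1 * R * (g⁻¹).1) 0 1 * (g.1 * R * (g⁻¹).1) 1 0 = e := by
  have h1 : (g.1 * R * (g⁻¹).1) 0 0 + (g.1 * R * (g⁻¹).1) 1 1 = 0 := by
    rw [← Matrix.trace_fin_two, trace_conj, Matrix.trace_fin_two, ht]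
  have h2 : (g.1 * R * (g⁻¹).1).det = R.det := by
    rw [Matrix.det_mul, Matrix.det_mul, g.2, (g⁻¹).2, one_mul, mul_one]
  rw [Matrix.det_fin_two, Matrix.det_fin_two] at h2
  refine ⟨h1, ?_⟩
  have h3 : R 1 1 = -R 0 0 := by linarith
  have h4 : (g.1 * R * (g⁻¹).1) 1 1 = -(g.1 * R * (g⁻¹).1) 0 0 := by linarith
  rw [h3, h4] at h2
  linarith

/-- For `b, c ≠ 0`, the choice `k² = |c| / |b|` reduces the inequality to `|bc| - bc < 2h²`. This is
clear for `bc ≥ 0`, and otherwise `-2bc = 2h² - 2`. -/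
lemma exists_balance {h b c : ℝ} (hh : 0 < h) (hd : h ^ 2 + b * c = 1) :
    ∃ k : ℝ, 0 < k ∧ |k ^ 2 * b - c| < 2 * k * h := by
  by_cases hb : b = 0
  · subst hb
    have h1 : h = 1 := by nlinarith
    subst h1
    refine ⟨|c| + 1, by positivity, ?_⟩
    simp
    linarith [abs_nonneg c]
  by_cases hc : c = 0
  · subst hc
    have h1 : h = 1 := by nlinarith
    subst h1
    refine ⟨1 / |b|, by positivity, ?_⟩
    have hb' : 0 < |b| := abs_pos.2 hb
    rw [sub_zero, abs_mul, abs_of_nonneg (by positivity)]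
    field_simp
    norm_num
  have hb' : 0 < |b| := abs_pos.2 hb
  have hc' : 0 < |c| := abs_pos.2 hc
  have hk0 : 0 < |c| / |b| := by positivity
  refine ⟨√(|c| / |b|), Real.sqrt_pos.2 hk0, ?_⟩
  have hk2 := Real.sq_sqrt hk0.le
  apply abs_lt_of_sq_lt_sq _ (by positivity)
  rw [mul_pow, mul_pow, hk2]
  have h2 : (|c| / |b| * b - c) ^ 2 = |c| / |b| * (2 * |b| * |c| - 2 * (b * c)) := by
    have e1 := sq_abs b
    have e2 := sq_abs c
    field_simp
    linear_combination (-|c| ^ 2) * e1 - |b| ^ 2 * e2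
  rw [h2, show (2 : ℝ) ^ 2 * (|c| / |b|) * h ^ 2 = |c| / |b| * (4 * h ^ 2) by ring]
  refine mul_lt_mul_of_pos_left ?_ hk0
  have h3 : |b| * |c| = |b * c| := (abs_mul b c).symm
  rw [mul_assoc, h3]
  rcases abs_cases (b * c) with ⟨h4, _⟩ | ⟨h4, _⟩ <;> rw [h4] <;> nlinarith [sq_pos_of_pos hh]

/-- The matrix `g` takes the directions `(1, k)` and `(1, -k)` to the coordinate axes. -/
lemma exists_conj_offdiag_formula {k : ℝ} (hk : 0 < k) : ∃ g : SL(2, ℝ), ∀ T : Mat2,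
    T 1 1 = -T 0 0 →
      (g.1 * T * (g⁻¹).1) 0 1 = (2 * k * T 0 0 + (k ^ 2 * T 0 1 - T 1 0)) / (2 * k) ∧
      (g.1 * T * (g⁻¹).1) 1 0 = (2 * k * T 0 0 - (k ^ 2 * T 0 1 - T 1 0)) / (2 * k) := by
  obtain ⟨s, hs0, hs2⟩ : ∃ s : ℝ, 0 < s ∧ 2 * k = s ^ 2 :=
    ⟨√(2 * k), Real.sqrt_pos.2 (by positivity), (Real.sq_sqrt (by positivity)).symm⟩
  obtain ⟨g, hg⟩ : ∃ g : SL(2, ℝ), g.1 = !![k / s, -1 / s; k / s, 1 / s] :=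
    ⟨⟨_, by rw [Matrix.det_fin_two_of]; field_simp; linarith⟩, rfl⟩
  refine ⟨g, fun T hT => ?_⟩
  rw [inv_entries, hg]
  constructor <;> simp [Matrix.mul_apply, Fin.sum_univ_two, Matrix.vecMul, dotProduct, hT] <;>
    field_simp <;> rw [← hs2] <;> ring

/-- Exchanging `R` and `S` only changes the sign of `k² b - c` in the formula, so the bound of
`exists_balance` on its absolute value serves both. -/
lemma exists_conj_offdiag_pos_of_balanced {R S : Mat2} {h : ℝ} (hh : 0 < h) (r00 : R 0 0 = h)
    (r11 : R 1 1 = -h) (s00 : S 0 0 = h) (s11 : S 1 1 = -h) (s01 : S 0 1 = -R 0 1)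
    (s10 : S 1 0 = -R 1 0) (hd : h ^ 2 + R 0 1 * R 1 0 = 1) :
    ∃ g : SL(2, ℝ), 0 < (g.1 * R * (g⁻¹).1) 0 1 ∧ 0 < (g.1 * R * (g⁻¹).1) 1 0 ∧
      0 < (g.1 * S * (g⁻¹).1) 0 1 ∧ 0 < (g.1 * S * (g⁻¹).1) 1 0 := by
  obtain ⟨k, hk0, hk⟩ := exists_balance hh hd
  rw [abs_lt] at hk
  obtain ⟨g, hg⟩ := exists_conj_offdiag_formula hk0
  obtain ⟨k1, k2⟩ := hg R (by rw [r00, r11])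
  obtain ⟨k3, k4⟩ := hg S (by rw [s00, s11])
  refine ⟨g, ?_⟩
  rw [k1, k2, k3, k4, s01, s10, r00, s00]
  refine ⟨?_, ?_, ?_, ?_⟩ <;> apply div_pos _ (by positivity) <;> linarith [hk.1, hk.2]

/-- Two involutions with real axes that are not opposed can be simultaneously conjugated to have
positive off-diagonal entries. -/
lemma exists_conj_offdiag_pos {R S : Mat2} (htR : R 0 0 + R 1 1 = 0) (htS : S 0 0 + S 1 1 = 0)
    (hR : R 0 0 ^ 2 + R 0 1 * R 1 0 = 1) (hS : S 0 0 ^ 2 + S 0 1 * S 1 0 = 1)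
    (hRS : -2 < 2 * (R 0 0 * S 0 0) + R 0 1 * S 1 0 + R 1 0 * S 0 1) :
    ∃ g : SL(2, ℝ), 0 < (g.1 * R * (g⁻¹).1) 0 1 ∧ 0 < (g.1 * R * (g⁻¹).1) 1 0 ∧
      0 < (g.1 * S * (g⁻¹).1) 0 1 ∧ 0 < (g.1 * S * (g⁻¹).1) 1 0 := by
  obtain ⟨r, hr0, hr2⟩ : ∃ r : ℝ, 0 < r ∧
      r ^ 2 = 2 + (2 * (R 0 0 * S 0 0) + R 0 1 * S 1 0 + R 1 0 * S 0 1) :=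
    ⟨_, Real.sqrt_pos.2 (by linarith), Real.sq_sqrt (by linarith)⟩
  -- The square of `R + S` is the scalar `2 + tr RS`, positive by `hRS`. Once the sum is diagonal,
  -- `R` and `S` have opposite off-diagonal entries, and since both have square one, equal
  -- diagonals.
  obtain ⟨g₁, hg₁⟩ := exists_diagonalize (M := R + S) hr0
    (by simp only [Matrix.add_apply]; linarith) (by simp only [Matrix.add_apply]; rw [hr2]; linarith)
  obtain ⟨htR', hR'⟩ := conj_neg_det g₁ htR hR
  obtain ⟨htS', hS'⟩ := conj_neg_det g₁ htS hS
  rw [mul_add, add_mul] at hg₁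
  have hex : ∃ g : SL(2, ℝ), 0 < (g.1 * (g₁.1 * R * (g₁⁻¹).1) * (g⁻¹).1) 0 1 ∧
      0 < (g.1 * (g₁.1 * R * (g₁⁻¹).1) * (g⁻¹).1) 1 0 ∧
      0 < (g.1 * (g₁.1 * S * (g₁⁻¹).1) * (g⁻¹).1) 0 1 ∧
      0 < (g.1 * (g₁.1 * S * (g₁⁻¹).1) * (g⁻¹).1) 1 0 := by
    generalize g₁.1 * R * (g₁⁻¹).1 = R' at *
    generalize g₁.1 * S * (g₁⁻¹).1 = S' at *
    have e00 := congrFun (congrFun hg₁ 0) 0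
    have e01 := congrFun (congrFun hg₁ 0) 1
    have e10 := congrFun (congrFun hg₁ 1) 0
    simp at e00 e01 e10
    have s01 : S' 0 1 = -R' 0 1 := by linarith
    have s10 : S' 1 0 = -R' 1 0 := by linarith
    have hh : R' 0 0 = r / 2 := by
      have h1 : S' 0 0 = r - R' 0 0 := by linarith
      rw [h1, s01, s10] at hS'
      have h2 : r * (r - 2 * R' 0 0) = 0 := by linarith
      have := (mul_eq_zero.1 h2).resolve_left hr0.ne'
      linarith
    refine exists_conj_offdiag_pos_of_balanced (half_pos hr0) hh ?_ ?_ ?_ s01 s10 (hh ▸ hR') <;>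
      linarith
  obtain ⟨g₂, hg₂⟩ := hex
  have hconj : ∀ T : Mat2, (g₂ * g₁).1 * T * ((g₂ * g₁)⁻¹).1 =
      g₂.1 * (g₁.1 * T * (g₁⁻¹).1) * (g₂⁻¹).1 := by
    intro T
    rw [mul_inv_rev, Matrix.SpecialLinearGroup.coe_mul, Matrix.SpecialLinearGroup.coe_mul]
    simp only [mul_assoc]
  exact ⟨g₂ * g₁, by simpa only [hconj] using hg₂⟩

/-! ### Pairs conjugate to positive pairs. -/

/-- All entries of both matrices are positive. -/
def PositivePair (p : SL(2, ℝ) × SL(2, ℝ)) : Prop :=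
  (∀ i j, 0 < p.1.1 i j) ∧ ∀ i j, 0 < p.2.1 i j

/-- The pairs with traces larger than two whose axes are not opposed. -/
def principalSet : Set (SL(2, ℝ) × SL(2, ℝ)) :=
  {p | 2 < trA p ∧ 2 < trB p ∧ (trComm p < 2 ∨ trA p * trB p < 2 * trAB p)}

lemma trAB_eq (p : SL(2, ℝ) × SL(2, ℝ)) : trAB p = p.1.1 0 0 * p.2.1 0 0 + p.1.1 0 1 * p.2.1 1 0 +
    p.1.1 1 0 * p.2.1 0 1 + p.1.1 1 1 * p.2.1 1 1 := by
  rw [trAB, Matrix.trace_fin_two, Matrix.SpecialLinearGroup.coe_mul]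
  simp only [Matrix.mul_apply, Fin.sum_univ_two]
  ring

lemma trA_eq (p : SL(2, ℝ) × SL(2, ℝ)) : trA p = p.1.1 0 0 + p.1.1 1 1 := Matrix.trace_fin_two _

lemma trB_eq (p : SL(2, ℝ) × SL(2, ℝ)) : trB p = p.2.1 0 0 + p.2.1 1 1 := Matrix.trace_fin_two _

/-- For traces `x, y > 2`, write `A = x/2 + (α/2) R` and `B = y/2 + (β/2) S` with involutions `R, S`
and `α² = x² - 4`, `β² = y² - 4`. Then `2z - xy = (αβ/2) tr RS`, so `trComm - 2` compares `|tr RS|`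
with 2. -/
lemma four_mul_trComm_sub (p : SL(2, ℝ) × SL(2, ℝ)) :
    4 * (trComm p - 2) = (2 * trAB p - trA p * trB p) ^ 2 - (trA p ^ 2 - 4) * (trB p ^ 2 - 4) := by
  rw [trComm]; ring

lemma diag_pos_of_offdiag_pos {A : SL(2, ℝ)} (ht : 0 < A.1 0 0 + A.1 1 1) (h01 : 0 < A.1 0 1)
    (h10 : 0 < A.1 1 0) : ∀ i j, 0 < A.1 i j := by
  have hd := det_eq A
  have h1 : 0 < A.1 0 0 * A.1 1 1 := by nlinarith [mul_pos h01 h10]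
  have h00 : 0 < A.1 0 0 := by
    by_contra! hle
    have h2 : 0 < A.1 1 1 := by linarith
    nlinarith
  have h11 : 0 < A.1 1 1 := by
    by_contra! hle
    nlinarith
  intro i j
  fin_cases i <;> fin_cases j <;> assumption

/-- Membership in `principalSet` gives `tr RS > -2` for the normalized traceless parts `R, S`.
Conjugating these to positive off-diagonal entries does it for `A` and `B`, whose diagonals are then
positive by determinant and trace. -/
theorem exists_conjPair_positive {p : SL(2, ℝ) × SL(2, ℝ)} (hp : p ∈ principalSet) :
    ∃ g, PositivePair (conjPair g p) := by
  obtain ⟨hx, hy, hz⟩ := hp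
  have hx4 : 0 < trA p ^ 2 - 4 := by nlinarith
  have hy4 : 0 < trB p ^ 2 - 4 := by nlinarith
  set α := √(trA p ^ 2 - 4)
  set β := √(trB p ^ 2 - 4)
  have hα : 0 < α := Real.sqrt_pos.2 hx4
  have hβ : 0 < β := Real.sqrt_pos.2 hy4
  have hα2 : α ^ 2 = trA p ^ 2 - 4 := Real.sq_sqrt hx4.le
  have hβ2 : β ^ 2 = trB p ^ 2 - 4 := Real.sq_sqrt hy4.le
  have hmain : -(α * β) < 2 * trAB p - trA p * trB p := by
    rcases hz with hz | hz
    · have h1 := four_mul_trComm_sub p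
      rw [← hα2, ← hβ2] at h1
      have h2 : (2 * trAB p - trA p * trB p) ^ 2 < (α * β) ^ 2 := by nlinarith
      exact (abs_lt.1 (abs_lt_of_sq_lt_sq h2 (by positivity))).1
    · nlinarith [mul_pos hα hβ]
  have hdA := det_eq p.1
  have hdB := det_eq p.2
  rw [trA_eq] at hx hα2 hmain
  rw [trB_eq] at hy hβ2 hmain
  rw [trAB_eq] at hmain
  let R : Mat2 := (α⁻¹) • ((2 : ℝ) • p.1.1 - (p.1.1 0 0 + p.1.1 1 1) • (1 : Mat2))
  let S : Mat2 := (β⁻¹) • ((2 : ℝ) • p.2.1 - (p.2.1 0 0 + p.2.1 1 1) • (1 : Mat2))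
  have hAR : p.1.1 = ((p.1.1 0 0 + p.1.1 1 1) / 2) • (1 : Mat2) + (α / 2) • R := by
    ext i j
    fin_cases i <;> fin_cases j <;> simp [R] <;> field_simp <;> ring
  have hBS : p.2.1 = ((p.2.1 0 0 + p.2.1 1 1) / 2) • (1 : Mat2) + (β / 2) • S := by
    ext i j
    fin_cases i <;> fin_cases j <;> simp [S] <;> field_simp <;> ring
  obtain ⟨g, h1, h2, h3, h4⟩ := exists_conj_offdiag_pos (R := R) (S := S)
    (by simp [R]; ring) (by simp [S]; ring)
    (by simp [R]; field_simp; linear_combination -4 * hdA - hα2)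
    (by simp [S]; field_simp; linear_combination -4 * hdB - hβ2)
    (by
      have e : 2 * (R 0 0 * S 0 0) + R 0 1 * S 1 0 + R 1 0 * S 0 1 =
          2 * (2 * (p.1.1 0 0 * p.2.1 0 0 + p.1.1 0 1 * p.2.1 1 0 + p.1.1 1 0 * p.2.1 0 1 +
            p.1.1 1 1 * p.2.1 1 1) - (p.1.1 0 0 + p.1.1 1 1) * (p.2.1 0 0 + p.2.1 1 1)) /
            (α * β) := by
        simp [R, S]; field_simp; ring
      rw [e, lt_div_iff₀ (by positivity)]
      linarith)
  refine ⟨g, ?_, ?_⟩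
  · have e : (conjPair g p).1.1 =
        ((p.1.1 0 0 + p.1.1 1 1) / 2) • (1 : Mat2) + (α / 2) • (g.1 * R * (g⁻¹).1) := by
      change (g * p.1 * g⁻¹).1 = _
      rw [Matrix.SpecialLinearGroup.coe_mul, Matrix.SpecialLinearGroup.coe_mul]
      conv_lhs => rw [hAR]
      rw [mul_add, add_mul, mul_smul_comm, smul_mul_assoc, mul_one, coe_mul_inv, mul_smul_comm,
        smul_mul_assoc]
    have ht := trA_conjPair g p
    rw [trA_eq, trA_eq] at ht
    refine diag_pos_of_offdiag_pos (by linarith) ?_ ?_ <;> rw [e] <;> simp <;> positivity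
  · have e : (conjPair g p).2.1 =
        ((p.2.1 0 0 + p.2.1 1 1) / 2) • (1 : Mat2) + (β / 2) • (g.1 * S * (g⁻¹).1) := by
      change (g * p.2 * g⁻¹).1 = _
      rw [Matrix.SpecialLinearGroup.coe_mul, Matrix.SpecialLinearGroup.coe_mul]
      conv_lhs => rw [hBS]
      rw [mul_add, add_mul, mul_smul_comm, smul_mul_assoc, mul_one, coe_mul_inv, mul_smul_comm,
        smul_mul_assoc]
    have ht := trB_conjPair g p
    rw [trB_eq, trB_eq] at ht
    refine diag_pos_of_offdiag_pos (by linarith) ?_ ?_ <;> rw [e] <;> simp <;> positivity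

lemma two_lt_trace_of_pos {A : SL(2, ℝ)} (h : ∀ i j, 0 < A.1 i j) : 2 < A.1 0 0 + A.1 1 1 := by
  have hd := det_eq A
  have := mul_pos (h 0 1) (h 1 0)
  nlinarith [sq_nonneg (A.1 0 0 - A.1 1 1), h 0 0, h 1 1]

theorem PositivePair.mem_principalSet {p : SL(2, ℝ) × SL(2, ℝ)} (h : PositivePair p) :
    p ∈ principalSet := by
  refine ⟨?_, ?_, ?_⟩
  · rw [trA_eq]; exact two_lt_trace_of_pos h.1
  · rw [trB_eq]; exact two_lt_trace_of_pos h.2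
  · by_contra! hcon
    obtain ⟨h1, h2⟩ := hcon
    have h3 := four_mul_trComm_sub p
    rw [trAB_eq, trA_eq, trB_eq] at h2
    rw [trAB_eq, trA_eq, trB_eq] at h3
    have hdA := det_eq p.1
    have hdB := det_eq p.2
    obtain ⟨hA, hB⟩ := h
    have a1 := mul_pos (hA 0 1) (hA 1 0)
    have b1 := mul_pos (hB 0 1) (hB 1 0)
    have c1 := mul_pos (hA 0 1) (hB 1 0)
    have c2 := mul_pos (hA 1 0) (hB 0 1)
    generalize p.1.1 0 0 = a at *
    generalize p.1.1 0 1 = b at *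
    generalize p.1.1 1 0 = c at *
    generalize p.1.1 1 1 = d at *
    generalize p.2.1 0 0 = e at *
    generalize p.2.1 0 1 = f at *
    generalize p.2.1 1 0 = g at *
    generalize p.2.1 1 1 = k at *
    set u := a - d
    set v := e - k
    have e1 : 2 * (a * e + b * g + c * f + d * k) - (a + d) * (e + k) = u * v + 2 * (b * g + c * f) := by
      simp only [u, v]; ring
    have e2 : (a + d) ^ 2 - 4 = u ^ 2 + 4 * (b * c) := by
      simp only [u]; linear_combination 4 * hdA
    have e3 : (e + k) ^ 2 - 4 = v ^ 2 + 4 * (f * g) := by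
      simp only [v]; linear_combination 4 * hdB
    rw [e1, e2, e3] at h3
    have h4 : u * v + 2 * (b * g + c * f) ≤ 0 := by linarith
    have h5 : (u ^ 2 + 4 * (b * c)) * (v ^ 2 + 4 * (f * g)) ≤ (u * v + 2 * (b * g + c * f)) ^ 2 := by
      linarith
    -- With `s = bg + cf` and `u²v²` cancelled in `h5`, the left side is positive, while the right
    -- side is `4s(uv + s) ≤ -4s²` by `h4`.
    have h6 : 0 ≤ (b * g - c * f) ^ 2 := sq_nonneg _
    have h7 : 0 < (b * g + c * f) := by linarith
    nlinarith [mul_pos a1 b1, mul_nonneg (sq_nonneg u) b1.le, mul_nonneg (sq_nonneg v) a1.le,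
      mul_pos c1 c2]

/-- Inequalities between traces give openness and closure; positivity up to conjugation gives
connectedness, growth and the multicone. -/
lemma principalSet_eq : principalSet = {p | ∃ g, PositivePair (conjPair g p)} := by
  ext p
  refine ⟨exists_conjPair_positive, ?_⟩
  rintro ⟨g, hg⟩
  obtain ⟨h1, h2, h3⟩ := hg.mem_principalSet
  rw [trA_conjPair] at h1
  rw [trB_conjPair] at h2
  rw [trA_conjPair, trB_conjPair, trAB_conjPair, trComm_conjPair] at h3
  exact ⟨h1, h2, h3⟩

lemma PositivePair.letter_pos {p : SL(2, ℝ) × SL(2, ℝ)} (h : PositivePair p) (a i j : Fin 2) :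
    0 < (letter p a).1 i j := by
  fin_cases a
  · exact h.1 i j
  · exact h.2 i j

/-- The product of the two coordinates of a positive vector is multiplied by at least `ad + bc = 1 +
2bc` under a positive matrix with rows `(a, b)`, `(c, d)`. -/
theorem PositivePair.hasGrowth {p : SL(2, ℝ) × SL(2, ℝ)} (h : PositivePair p) : HasGrowth p := by
  let m := min (p.1.1 0 1 * p.1.1 1 0) (p.2.1 0 1 * p.2.1 1 0)
  have hm : 0 < m := lt_min (mul_pos (h.1 0 1) (h.1 1 0)) (mul_pos (h.2 0 1) (h.2 1 0))
  have hm' : ∀ a, m ≤ (letter p a).1 0 1 * (letter p a).1 1 0 := by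
    intro a
    fin_cases a
    · exact min_le_left _ _
    · exact min_le_right _ _
  have key : ∀ w : List (Fin 2), 0 < ((w.map (letter p)).prod.1 *ᵥ ![1, 1]) 0 ∧
      0 < ((w.map (letter p)).prod.1 *ᵥ ![1, 1]) 1 ∧
      (1 + 2 * m) ^ w.length ≤ ((w.map (letter p)).prod.1 *ᵥ ![1, 1]) 0 *
        ((w.map (letter p)).prod.1 *ᵥ ![1, 1]) 1 := by
    intro w
    induction w with
    | nil => simp
    | cons a w ih =>
      obtain ⟨h0, h1, h2⟩ := ih
      rw [List.map_cons, List.prod_cons, Matrix.SpecialLinearGroup.coe_mul, ← Matrix.mulVec_mulVec]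
      set u := (w.map (letter p)).prod.1 *ᵥ ![1, 1]
      have hp := h.letter_pos a
      have hd := det_eq (letter p a)
      have hma := hm' a
      simp only [Matrix.mulVec, dotProduct, Fin.sum_univ_two]
      generalize (letter p a).1 = A at *
      refine ⟨add_pos (mul_pos (hp 0 0) h0) (mul_pos (hp 0 1) h1),
        add_pos (mul_pos (hp 1 0) h0) (mul_pos (hp 1 1) h1), ?_⟩
      rw [List.length_cons, pow_succ]
      have e1 : (A 0 0 * u 0 + A 0 1 * u 1) * (A 1 0 * u 0 + A 1 1 * u 1) =
          A 0 0 * A 1 0 * u 0 ^ 2 + A 0 1 * A 1 1 * u 1 ^ 2 +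
          (1 + 2 * (A 0 1 * A 1 0)) * (u 0 * u 1) := by linear_combination (u 0 * u 1) * hd
      rw [e1]
      have p1 := mul_nonneg (mul_pos (hp 0 0) (hp 1 0)).le (sq_nonneg (u 0))
      have p2 := mul_nonneg (mul_pos (hp 0 1) (hp 1 1)).le (sq_nonneg (u 1))
      have p3 : (1 + 2 * m) ^ w.length * (1 + 2 * m) ≤
          (u 0 * u 1) * (1 + 2 * (A 0 1 * A 1 0)) :=
        mul_le_mul h2 (by linarith) (by linarith) (mul_pos h0 h1).le
      linarith
  have hs1 : 1 < √(1 + 2 * m) := Real.lt_sqrt_of_sq_lt (by linarith)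
  refine ⟨1 / 2, √(1 + 2 * m), by norm_num, hs1, fun w => ?_⟩
  obtain ⟨h0, h1, h2⟩ := key w
  set M := (w.map (letter p)).prod
  have hv : ‖(![1, 1] : Fin 2 → ℝ)‖ ≤ 1 := by
    rw [pi_norm_le_iff_of_nonneg zero_le_one]
    intro i
    fin_cases i <;> simp
  have hn : ∀ i, (M.1 *ᵥ ![1, 1]) i ≤ 2 * fro M.1 := by
    intro i
    have h3 := norm_le_pi_norm (M.1 *ᵥ ![1, 1]) i
    have h4 := norm_mulVec_le M.1 ![1, 1]
    have h5 := mul_le_mul_of_nonneg_left hv (mul_nonneg zero_le_two (fro_nonneg M.1))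
    exact (le_abs_self _).trans (by rw [Real.norm_eq_abs] at h3; linarith)
  have h3 : (1 + 2 * m) ^ w.length ≤ (2 * fro M.1) ^ 2 := by
    rw [sq]
    exact h2.trans (mul_le_mul (hn 0) (hn 1) h1.le (by linarith [fro_nonneg M.1]))
  have h4 : √(1 + 2 * m) ^ w.length ≤ 2 * fro M.1 := by
    apply le_of_sq_le_sq _ (by linarith [fro_nonneg M.1])
    rwa [← pow_mul, mul_comm w.length 2, pow_mul, Real.sq_sqrt (by linarith)]
  linarith

lemma principalSet_subset_hypLocus : principalSet ⊆ hypLocus := by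
  intro p hp
  obtain ⟨g, hg⟩ := exists_conjPair_positive hp
  exact hg.hasGrowth.of_conjPair.mem_hypLocus

/-! ### Interval multicones of pairs in the principal set -/

/-- The product of the two coordinates of `g v`. -/
noncomputable def coordProd (g : SL(2, ℝ)) (v : Fin 2 → ℝ) : ℝ := (g.1 *ᵥ v) 0 * (g.1 *ᵥ v) 1

lemma coordProd_smul (g : SL(2, ℝ)) (c : ℝ) (v : Fin 2 → ℝ) :
    coordProd g (c • v) = c ^ 2 * coordProd g v := by
  simp only [coordProd, Matrix.mulVec_smul, Pi.smul_apply, smul_eq_mul]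
  ring

lemma continuous_coordProd (g : SL(2, ℝ)) : Continuous (coordProd g) := by
  change Continuous fun v => (g.1 *ᵥ v) 0 * (g.1 *ᵥ v) 1
  simp only [Matrix.mulVec, dotProduct, Fin.sum_univ_two]
  fun_prop

/-- The interval of directions in the image of the open quadrant under `g⁻¹`. -/
def openQuadrant (g : SL(2, ℝ)) : Set P1 := {d | ∀ v ∈ d.submodule, v ≠ 0 → 0 < coordProd g v}

/-- The interval of directions in the image of the closed quadrant under `g⁻¹`. -/
def closedQuadrant (g : SL(2, ℝ)) : Set P1 := {d | ∀ v ∈ d.submodule, v ≠ 0 → 0 ≤ coordProd g v}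

lemma mk_mem_openQuadrant {g : SL(2, ℝ)} {v : Fin 2 → ℝ} (hv : v ≠ 0) :
    Projectivization.mk ℝ v hv ∈ openQuadrant g ↔ 0 < coordProd g v := by
  refine ⟨fun h => h v ((mem_submodule_mk hv).2 ⟨1, one_smul _ _⟩) hv, fun h w hw hw0 => ?_⟩
  obtain ⟨c, rfl⟩ := (mem_submodule_mk hv).1 hw
  have hc : c ≠ 0 := fun hc => hw0 (by rw [hc, zero_smul])
  rw [coordProd_smul]
  positivity

lemma mk_mem_closedQuadrant {g : SL(2, ℝ)} {v : Fin 2 → ℝ} (hv : v ≠ 0) :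
    Projectivization.mk ℝ v hv ∈ closedQuadrant g ↔ 0 ≤ coordProd g v := by
  refine ⟨fun h => h v ((mem_submodule_mk hv).2 ⟨1, one_smul _ _⟩) hv, fun h w hw hw0 => ?_⟩
  obtain ⟨c, rfl⟩ := (mem_submodule_mk hv).1 hw
  rw [coordProd_smul]
  positivity

lemma isOpen_openQuadrant (g : SL(2, ℝ)) : IsOpen (openQuadrant g) := by
  rw [isOpen_coinduced]
  have h : Projectivization.mk' ℝ ⁻¹' openQuadrant g =
      {v : {v : Fin 2 → ℝ // v ≠ 0} | 0 < coordProd g v.1} := by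
    ext v
    exact mk_mem_openQuadrant v.2
  rw [h]
  exact isOpen_lt continuous_const ((continuous_coordProd g).comp continuous_subtype_val)

lemma isClosed_closedQuadrant (g : SL(2, ℝ)) : IsClosed (closedQuadrant g) := by
  rw [isClosed_coinduced]
  have h : Projectivization.mk' ℝ ⁻¹' closedQuadrant g =
      {v : {v : Fin 2 → ℝ // v ≠ 0} | 0 ≤ coordProd g v.1} := by
    ext v
    exact mk_mem_closedQuadrant v.2
  rw [h]
  exact isClosed_le continuous_const ((continuous_coordProd g).comp continuous_subtype_val)

lemma openQuadrant_subset_closedQuadrant (g : SL(2, ℝ)) : openQuadrant g ⊆ closedQuadrant g :=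
  fun _ hd v hv hv0 => (hd v hv hv0).le

lemma vec_one_ne_zero (s : ℝ) : (![1, s] : Fin 2 → ℝ) ≠ 0 := by
  intro h
  have := congrFun h 0
  simp at this

/-- The direction of `g⁻¹ (1, s)`. -/
noncomputable def slopePt (g : SL(2, ℝ)) (s : ℝ) : P1 :=
  Projectivization.mk' ℝ ⟨(g⁻¹).1 *ᵥ ![1, s], mulVec_ne_zero _ (vec_one_ne_zero s)⟩

lemma coordProd_slope (g : SL(2, ℝ)) (s : ℝ) : coordProd g ((g⁻¹).1 *ᵥ ![1, s]) = s := by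
  rw [coordProd, Matrix.mulVec_mulVec, coe_mul_inv, Matrix.one_mulVec]
  simp

lemma slopePt_mem_openQuadrant {g : SL(2, ℝ)} {s : ℝ} : slopePt g s ∈ openQuadrant g ↔ 0 < s := by
  have h := mk_mem_openQuadrant (g := g) (mulVec_ne_zero g⁻¹ (vec_one_ne_zero s))
  rwa [coordProd_slope] at h

lemma slopePt_mem_closedQuadrant {g : SL(2, ℝ)} {s : ℝ} :
    slopePt g s ∈ closedQuadrant g ↔ 0 ≤ s := by
  have h := mk_mem_closedQuadrant (g := g) (mulVec_ne_zero g⁻¹ (vec_one_ne_zero s))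
  rwa [coordProd_slope] at h

lemma continuous_slopePt (g : SL(2, ℝ)) : Continuous (slopePt g) := by
  refine continuous_mk'.comp (Continuous.subtype_mk ?_ _)
  refine continuous_pi fun i => ?_
  simp only [Matrix.mulVec, dotProduct, Fin.sum_univ_two]
  simp
  fun_prop

lemma openQuadrant_eq_image (g : SL(2, ℝ)) : openQuadrant g = slopePt g '' Ioi 0 := by
  ext d
  constructor
  · induction d using Projectivization.ind with
    | h v hv =>
      intro hd
      have h := (mk_mem_openQuadrant hv).1 hd
      rw [coordProd] at h
      have h0 : (g.1 *ᵥ v) 0 ≠ 0 := by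
        intro h0
        rw [h0, zero_mul] at h
        exact h.false
      refine ⟨(g.1 *ᵥ v) 1 / (g.1 *ᵥ v) 0, ?_, ?_⟩
      · rw [mem_Ioi, ← mul_div_mul_left _ _ h0]
        exact div_pos h (mul_self_pos.2 h0)
      · refine (Projectivization.mk_eq_mk_iff' _ _ _ _ _).2 ⟨((g.1 *ᵥ v) 0)⁻¹, ?_⟩
        have h1 : ![1, (g.1 *ᵥ v) 1 / (g.1 *ᵥ v) 0] = ((g.1 *ᵥ v) 0)⁻¹ • (g.1 *ᵥ v) := by
          ext i
          fin_cases i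
          · exact (inv_mul_cancel₀ h0).symm
          · simp [div_eq_inv_mul]
        change _ = (g⁻¹).1 *ᵥ ![1, (g.1 *ᵥ v) 1 / (g.1 *ᵥ v) 0]
        rw [h1, Matrix.mulVec_smul, Matrix.mulVec_mulVec, coe_inv_mul, Matrix.one_mulVec]
  · rintro ⟨s, hs, rfl⟩
    exact slopePt_mem_openQuadrant.2 hs

lemma isConnected_openQuadrant (g : SL(2, ℝ)) : IsConnected (openQuadrant g) := by
  rw [openQuadrant_eq_image]
  exact isConnected_Ioi.image _ (continuous_slopePt g).continuousOn

lemma slopePt_ne (g : SL(2, ℝ)) : slopePt g 0 ≠ slopePt g (-1) := by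
  intro h
  have h1 : slopePt g 0 ∈ closedQuadrant g := slopePt_mem_closedQuadrant.2 le_rfl
  rw [h, slopePt_mem_closedQuadrant] at h1
  linarith

lemma isOpenInterval_openQuadrant (g : SL(2, ℝ)) : IsOpenInterval (openQuadrant g) := by
  refine ⟨isOpen_openQuadrant g, isConnected_openQuadrant g, slopePt g 0, ?_, slopePt g (-1), ?_,
    slopePt_ne g⟩
  · rw [mem_compl_iff, slopePt_mem_openQuadrant]
    exact lt_irrefl _
  · rw [mem_compl_iff, slopePt_mem_openQuadrant]
    norm_num

lemma componentsOf_of_isConnected {X : Type*} [TopologicalSpace X] {S : Set X}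
    (h : IsConnected S) : componentsOf S = {S} := by
  ext C
  constructor
  · rintro ⟨x, hx, rfl⟩
    exact h.isPreconnected.connectedComponentIn hx
  · rintro rfl
    obtain ⟨x, hx⟩ := h.nonempty
    exact ⟨x, hx, (h.isPreconnected.connectedComponentIn hx).symm⟩

/-- A matrix which is positive after conjugation by `g` maps the closed quadrant into the open
one. -/
lemma closedQuadrant_mul_inv_subset {g A : SL(2, ℝ)} (h : ∀ i j, 0 < (g * A * g⁻¹).1 i j) :
    closedQuadrant (g * A⁻¹) ⊆ openQuadrant g := by
  intro d
  induction d using Projectivization.ind with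
  | h v hv =>
    rw [mk_mem_closedQuadrant, mk_mem_openQuadrant, coordProd, coordProd]
    have e : g.1 *ᵥ v = (g * A * g⁻¹).1 *ᵥ ((g * A⁻¹).1 *ᵥ v) := by
      have e' : g * A * g⁻¹ * (g * A⁻¹) = g := by simp [mul_assoc]
      rw [Matrix.mulVec_mulVec, ← Matrix.SpecialLinearGroup.coe_mul, e']
    have hne := mulVec_ne_zero (g * A⁻¹) hv
    rw [e]
    generalize (g * A⁻¹).1 *ᵥ v = u at *
    generalize (g * A * g⁻¹).1 = M at *
    intro hu
    simp only [Matrix.mulVec, dotProduct, Fin.sum_univ_two]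
    have h1 := mul_pos (h 0 0) (h 1 0)
    have h2 := mul_pos (h 0 1) (h 1 1)
    have h3 := mul_pos (h 0 0) (h 1 1)
    have h4 := mul_pos (h 0 1) (h 1 0)
    have hsq : 0 < M 0 0 * M 1 0 * u 0 ^ 2 + M 0 1 * M 1 1 * u 1 ^ 2 := by
      by_cases h0 : u 0 = 0
      · have h1 : u 1 ≠ 0 := by
          intro h1
          apply hne
          ext i
          fin_cases i <;> simp [h0, h1]
        positivity
      · positivity
    nlinarith [mul_nonneg (add_pos h3 h4).le hu]

/-- The image of the quadrant under a letter `A` lies in `closedQuadrant (g * A⁻¹)`, the image of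
the closed quadrant. This set is closed, and positivity puts it inside the open quadrant. -/
lemma isMulticone_openQuadrant {g : SL(2, ℝ)} {p : SL(2, ℝ) × SL(2, ℝ)}
    (h : PositivePair (conjPair g p)) : IsMulticone p (openQuadrant g) where
  nonempty := (isConnected_openQuadrant g).nonempty
  isOpen := isOpen_openQuadrant g
  closure_ne_univ := by
    intro hu
    have h1 : slopePt g (-1) ∈ closure (openQuadrant g) := hu ▸ mem_univ _
    have h2 := closure_minimal (openQuadrant_subset_closedQuadrant g) (isClosed_closedQuadrant g) h1
    rw [slopePt_mem_closedQuadrant] at h2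
    linarith
  closure_image_subset i := by
    rw [(isOpen_openQuadrant g).interior_eq]
    have hpos : ∀ a b, 0 < (g * letter p i * g⁻¹).1 a b := by
      rw [← letter_conjPair]
      exact h.letter_pos i
    refine (closure_minimal ?_ (isClosed_closedQuadrant (g * (letter p i)⁻¹))).trans
      (closedQuadrant_mul_inv_subset hpos)
    rintro _ ⟨d, hd, rfl⟩
    induction d using Projectivization.ind with
    | h v hv =>
      change letter p i • (Projectivization.mk ℝ v hv : P1) ∈ _
      rw [smul_mk_P1, mk_mem_closedQuadrant]
      have h1 := (mk_mem_openQuadrant hv).1 hd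
      have e : (g * (letter p i)⁻¹).1 *ᵥ ((letter p i).1 *ᵥ v) = g.1 *ᵥ v := by
        rw [Matrix.mulVec_mulVec, ← Matrix.SpecialLinearGroup.coe_mul, inv_mul_cancel_right]
      rw [coordProd, e]
      exact h1.le
  finite_components := by
    rw [componentsOf_of_isConnected (isConnected_openQuadrant g)]
    exact finite_singleton _
  disjoint_closures := by
    rw [componentsOf_of_isConnected (isConnected_openQuadrant g)]
    exact pairwiseDisjoint_singleton _ _

/-! ### Connectedness -/

lemma continuous_mk_SL {X : Type*} [TopologicalSpace X] {f : X → SL(2, ℝ)}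
    (h : ∀ i j, Continuous fun x => (f x).1 i j) : Continuous f :=
  continuous_induced_rng.2 (continuous_matrix h)

/-- Every matrix is a product of four triangular unipotents, alternately lower and upper, so the
group is a continuous image of `ℝ⁴`. Three factors suffice if the lower left entry is nonzero; the
fourth makes it so. -/
instance : ConnectedSpace SL(2, ℝ) := by
  let U : ℝ → SL(2, ℝ) := fun t => ⟨!![1, t; 0, 1], by simp⟩
  let V : ℝ → SL(2, ℝ) := fun t => ⟨!![1, 0; t, 1], by simp⟩
  have hU : Continuous U := continuous_mk_SL fun i j => by
    fin_cases i <;> fin_cases j <;> simp [U] <;> fun_prop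
  have hV : Continuous V := continuous_mk_SL fun i j => by
    fin_cases i <;> fin_cases j <;> simp [V] <;> fun_prop
  have hUv : ∀ t, (U t).1 = !![1, t; 0, 1] := fun t => rfl
  have hVv : ∀ t, (V t).1 = !![1, 0; t, 1] := fun t => rfl
  clear_value U V
  let F : ℝ × ℝ × ℝ × ℝ → SL(2, ℝ) := fun q => V q.1 * (U q.2.1 * (V q.2.2.1 * U q.2.2.2))
  have hF : Continuous F := by fun_prop
  have h3 : ∀ A : SL(2, ℝ), A.1 1 0 ≠ 0 → ∃ r s t, A = U r * (V s * U t) := by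
    intro A hA
    have hd := det_eq A
    refine ⟨(A.1 0 0 - 1) / A.1 1 0, A.1 1 0, (A.1 1 1 - 1) / A.1 1 0, ?_⟩
    ext i j
    fin_cases i <;> fin_cases j <;>
      simp [hUv, hVv, Matrix.mul_apply, Fin.sum_univ_two] <;> field_simp <;> linarith
  have hs : Function.Surjective F := by
    intro A
    by_cases hA : A.1 1 0 = 0
    · have h00 : A.1 0 0 ≠ 0 := by
        intro h
        have := det_eq A
        rw [hA, h] at this
        simp at this
      obtain ⟨r, s, t, h⟩ := h3 (V 1 * A) (by
        simp [hVv, Matrix.mul_apply, Fin.sum_univ_two, hA, h00])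
      refine ⟨(-1, r, s, t), ?_⟩
      simp only [F]
      rw [← h, ← mul_assoc]
      have : V (-1) * V 1 = 1 := by
        ext i j
        fin_cases i <;> fin_cases j <;> simp [hVv]
      rw [this, one_mul]
    · obtain ⟨r, s, t, h⟩ := h3 A hA
      refine ⟨(0, r, s, t), ?_⟩
      simp only [F]
      rw [← h]
      have : V 0 = 1 := by
        ext i j
        fin_cases i <;> fin_cases j <;> simp [hVv]
      rw [this, one_mul]
  exact hs.connectedSpace hF

lemma isConnected_pos : IsConnected {A : SL(2, ℝ) | ∀ i j, 0 < A.1 i j} := by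
  let F : Ioi (0 : ℝ) × Ioi (0 : ℝ) × Ioi (0 : ℝ) → SL(2, ℝ) := fun q =>
    ⟨!![q.1.1, q.2.1.1; q.2.2.1, (1 + q.2.1.1 * q.2.2.1) / q.1.1], by
      have h : q.1.1 ≠ 0 := (mem_Ioi.1 q.1.2).ne'
      rw [Matrix.det_fin_two_of]
      field_simp
      ring⟩
  have hF : Continuous F := continuous_mk_SL fun i j => by
    fin_cases i <;> fin_cases j <;> simp [F]
    · fun_prop
    · fun_prop
    · fun_prop
    · exact Continuous.div (by fun_prop) (by fun_prop) fun q => (mem_Ioi.1 q.1.2).ne'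
  have hr : {A : SL(2, ℝ) | ∀ i j, 0 < A.1 i j} = range F := by
    ext A
    constructor
    · intro h
      refine ⟨(⟨A.1 0 0, h 0 0⟩, ⟨A.1 0 1, h 0 1⟩, ⟨A.1 1 0, h 1 0⟩), ?_⟩
      have hd := det_eq A
      have h0 := (h 0 0).ne'
      ext i j
      fin_cases i <;> fin_cases j <;> simp [F]
      field_simp
      linarith
    · rintro ⟨⟨⟨a, ha⟩, ⟨b, hb⟩, ⟨c, hc⟩⟩, rfl⟩ i j
      rw [mem_Ioi] at ha hb hc
      fin_cases i <;> fin_cases j <;> simp [F] <;> positivity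
  have : ConnectedSpace (Ioi (0 : ℝ)) := Subtype.connectedSpace isConnected_Ioi
  rw [hr]
  exact isConnected_range hF

lemma isConnected_principalSet : IsConnected principalSet := by
  have h : principalSet = (fun q : SL(2, ℝ) × (SL(2, ℝ) × SL(2, ℝ)) => conjPair q.1 q.2) ''
      (univ ×ˢ ({A : SL(2, ℝ) | ∀ i j, 0 < A.1 i j} ×ˢ {A : SL(2, ℝ) | ∀ i j, 0 < A.1 i j})) := by
    rw [principalSet_eq]
    ext p
    constructor
    · rintro ⟨g, h1, h2⟩
      refine ⟨(g⁻¹, conjPair g p), ⟨mem_univ _, h1, h2⟩, ?_⟩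
      simp only
      rw [conjPair_conjPair, inv_mul_cancel, conjPair_one]
    · rintro ⟨⟨g, q⟩, ⟨-, h1, h2⟩, rfl⟩
      refine ⟨g⁻¹, ?_⟩
      simp only
      rw [conjPair_conjPair, inv_mul_cancel, conjPair_one]
      exact ⟨h1, h2⟩
  rw [h]
  refine (isConnected_univ.prod (isConnected_pos.prod isConnected_pos)).image _
    (Continuous.continuousOn ?_)
  simp only [conjPair]
  fun_prop

/-! ### Growth in reflection groups with three generators

Three involutions `n i` of determinant `-1` whose Gram matrix `g` has off-diagonal entries smaller
than `-1` generate a group in which reduced words grow exponentially. This is seen in the geometric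
representation, on the coefficients of combinations of the `n i`. -/

section Reflections

variable (g : Fin 3 → Fin 3 → ℝ)

/-- The action of the `i`-th reflection on coefficient vectors. -/
def refl (i : Fin 3) (c : Fin 3 → ℝ) : Fin 3 → ℝ :=
  Function.update c i (c i - 2 * ∑ j, g i j * c j)

variable {g}

lemma refl_refl (hg : ∀ i, g i i = 1) (i : Fin 3) (c : Fin 3 → ℝ) : refl g i (refl g i c) = c := by
  have h : ∑ j, g i j * refl g i c j = -∑ j, g i j * c j := by
    have h1 : ∀ j, g i j * refl g i c j =
        g i j * c j + if j = i then -2 * ∑ j, g i j * c j else 0 := by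
      intro j
      by_cases hj : j = i
      · subst hj
        simp [refl, hg]
        ring
      · simp [refl, hj]
    simp only [h1, Finset.sum_add_distrib, Finset.sum_ite_eq', Finset.mem_univ, if_true]
    ring
  rw [refl, h]
  ext j
  by_cases hj : j = i
  · subst hj
    simp [refl]
  · simp [refl, hj]

/-- The coefficient vector `c` is nonnegative, with largest coefficient the `i`-th one, which is
at least `m`. -/
def Dominated (i : Fin 3) (c : Fin 3 → ℝ) (m : ℝ) : Prop :=
  m ≤ c i ∧ ∀ j, 0 ≤ c j ∧ c j ≤ c i

lemma Dominated.mono {i : Fin 3} {c : Fin 3 → ℝ} {m m' : ℝ} (h : Dominated i c m) (hm : m' ≤ m) :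
    Dominated i c m' := ⟨hm.trans h.1, h.2⟩

/-- The off-diagonal Gram entries are negative and the coefficients nonnegative, so the term of the
third index may be dropped. -/
lemma Dominated.sum_le {ε : ℝ} (hε : 0 < ε) (hg : ∀ i, g i i = 1)
    (hg' : ∀ i j, i ≠ j → g i j ≤ -(1 + ε)) {i j : Fin 3} (hij : i ≠ j) {c : Fin 3 → ℝ} {m : ℝ}
    (h : Dominated i c m) : ∑ k, g j k * c k ≤ c j - (1 + ε) * c i := by
  have h1 : ∀ k, g j k * c k ≤ (if k = j then c j else 0) + if k = i then -(1 + ε) * c i else 0 := by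
    intro k
    by_cases hkj : k = j
    · subst hkj
      simp [hg, hij.symm]
    · have h2 := mul_le_mul_of_nonneg_right (hg' j k (Ne.symm hkj)) (h.2 k).1
      by_cases hki : k = i
      · subst hki
        simpa [hkj] using h2
      · simp only [hkj, hki, if_false, add_zero]
        nlinarith [(h.2 k).1]
  refine (Finset.sum_le_sum fun k _ => h1 k).trans (le_of_eq ?_)
  simp [Finset.sum_add_distrib]
  ring

/-- The new `j`-th coefficient is at least `2(1 + ε) c i - c j`, and `c j ≤ c i`. -/
lemma Dominated.refl {ε : ℝ} (hε : 0 < ε) (hg : ∀ i, g i i = 1)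
    (hg' : ∀ i j, i ≠ j → g i j ≤ -(1 + ε)) {i j : Fin 3} (hij : i ≠ j) {c : Fin 3 → ℝ} {m : ℝ}
    (h : Dominated i c m) : Dominated j (refl g j c) ((1 + 2 * ε) * m) := by
  have hs := h.sum_le hε hg hg' hij
  have hj := h.2 j
  have hi := h.2 i
  have hnew : (1 + 2 * ε) * c i ≤ c j - 2 * ∑ k, g j k * c k := by nlinarith
  have e : FullTwoShift.refl g j c j = c j - 2 * ∑ k, g j k * c k := by simp [FullTwoShift.refl]
  have hge : c i ≤ c j - 2 * ∑ k, g j k * c k := by nlinarith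
  refine ⟨?_, fun k => ?_⟩
  · rw [e]
    nlinarith [h.1]
  · rw [e]
    by_cases hk : k = j
    · subst hk
      rw [e]
      exact ⟨hi.1.trans hge, le_rfl⟩
    · have e' : FullTwoShift.refl g j c k = c k := by simp [FullTwoShift.refl, hk]
      rw [e']
      exact ⟨(h.2 k).1, (h.2 k).2.trans hge⟩

/-- The action of the letters `A^{±1}`, `B^{±1}` on coefficients, when `A` is the product of the
first two reflections and `B` that of the last two. -/
def letterAct (g : Fin 3 → Fin 3 → ℝ) : Fin 2 × Bool → (Fin 3 → ℝ) → Fin 3 → ℝ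
  | (0, true), c => refl g 0 (refl g 1 c)
  | (0, false), c => refl g 1 (refl g 0 c)
  | (1, true), c => refl g 1 (refl g 2 c)
  | (1, false), c => refl g 2 (refl g 1 c)

/-- What is known on the coefficients after the action of a reduced word with given first letter. -/
def WordState (g : Fin 3 → Fin 3 → ℝ) : Fin 2 × Bool → (Fin 3 → ℝ) → ℝ → Prop
  | (0, true), c, m => Dominated 0 c m
  | (0, false), c, m => Dominated 1 c m ∧ Dominated 0 (refl g 1 c) m
  | (1, true), c, m => Dominated 1 c m ∧ Dominated 2 (refl g 1 c) m
  | (1, false), c, m => Dominated 2 c m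

/-- Rewriting a reduced word in the reflections, the only cancellation is of two middle reflections,
in `A B` and in `B⁻¹ A⁻¹`. So when the last reflection applied is the middle one, the state also
records the vector with that reflection undone. Each letter then still contributes an uncancelled
reflection, hence a factor `1 + 2ε`. -/
lemma WordState.step {ε : ℝ} (hε : 0 < ε) (hg : ∀ i, g i i = 1)
    (hg' : ∀ i j, i ≠ j → g i j ≤ -(1 + ε)) {a b : Fin 2 × Bool} (hab : a.1 = b.1 → a.2 = b.2)
    {c : Fin 3 → ℝ} {m : ℝ} (hm : 0 ≤ m) (h : WordState g b c m) :
    WordState g a (letterAct g a c) ((1 + 2 * ε) * m) := by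
  have hm1 : (1 + 2 * ε) * m ≤ (1 + 2 * ε) * ((1 + 2 * ε) * m) := by
    have : 0 ≤ (1 + 2 * ε) * m := by positivity
    nlinarith
  have R : ∀ {i j : Fin 3}, i ≠ j → ∀ {c : Fin 3 → ℝ} {m : ℝ}, Dominated i c m →
      Dominated j (refl g j c) ((1 + 2 * ε) * m) := fun hij _ _ h => h.refl hε hg hg' hij
  have h01 : (0 : Fin 3) ≠ 1 := by decide
  have h02 : (0 : Fin 3) ≠ 2 := by decide
  have h12 : (1 : Fin 3) ≠ 2 := by decide
  obtain ⟨a, s⟩ := a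
  obtain ⟨b, t⟩ := b
  fin_cases a <;> fin_cases b <;> cases s <;> cases t <;> simp [WordState, letterAct] at hab h ⊢
  · rw [refl_refl hg]
    exact ⟨(R h01 (R h01.symm h.1)).mono hm1, R h01.symm h.1⟩
  · exact (R h01.symm (R h01 h)).mono hm1
  · rw [refl_refl hg]
    exact ⟨(R h01 (R h02.symm h)).mono hm1, R h02.symm h⟩
  · rw [refl_refl hg]
    exact ⟨(R h01 (R h01.symm h.1)).mono hm1, R h01.symm h.1⟩
  · exact (R h01.symm (R h12.symm h)).mono hm1
  · exact R h02.symm h.2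
  · exact R h02 h.2
  · exact (R h12 (R h01 h)).mono hm1
  · rw [refl_refl hg]
    exact ⟨(R h12.symm (R h12 h.1)).mono hm1, R h12 h.1⟩
  · rw [refl_refl hg]
    exact ⟨(R h12.symm (R h02 h)).mono hm1, R h02 h⟩
  · exact (R h12 (R h12.symm h)).mono hm1
  · rw [refl_refl hg]
    exact ⟨(R h12.symm (R h12 h.1)).mono hm1, R h12 h.1⟩

lemma WordState.exists_dominated {a : Fin 2 × Bool} {c : Fin 3 → ℝ} {m : ℝ}
    (h : WordState g a c m) : ∃ i, Dominated i c m := by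
  obtain ⟨a, s⟩ := a
  fin_cases a <;> cases s <;> simp [WordState] at h
  · exact ⟨1, h.1⟩
  · exact ⟨0, h⟩
  · exact ⟨2, h⟩
  · exact ⟨1, h.1⟩

lemma wordState_foldr {ε : ℝ} (hε : 0 < ε) (hg : ∀ i, g i i = 1)
    (hg' : ∀ i j, i ≠ j → g i j ≤ -(1 + ε)) (L : List (Fin 2 × Bool)) (a : Fin 2 × Bool)
    (hL : FreeGroup.IsReduced (a :: L)) :
    WordState g a ((a :: L).foldr (letterAct g) 1) ((1 + 2 * ε) ^ (a :: L).length) := by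
  induction L generalizing a with
  | nil =>
    have h1 : ∀ i, Dominated i (1 : Fin 3 → ℝ) 1 := fun i =>
      ⟨le_rfl, fun j => ⟨zero_le_one, le_rfl⟩⟩
    -- A fictitious preceding letter, not inverse to `a`, chosen among the two whose state is a
    -- single domination.
    obtain ⟨b, hb, hb'⟩ : ∃ b, (a.1 = b.1 → a.2 = b.2) ∧ WordState g b 1 1 := by
      obtain ⟨a, s⟩ := a
      by_cases hs : (a = 0 ∧ s = true) ∨ (a = 1 ∧ s = true)
      · exact ⟨(0, true), by rcases hs with ⟨rfl, rfl⟩ | ⟨rfl, rfl⟩ <;> simp, h1 0⟩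
      · refine ⟨(1, false), ?_, h1 2⟩
        rintro rfl
        simpa using hs
    have h := WordState.step hε hg hg' hb zero_le_one hb'
    simpa using h
  | cons b L ih =>
    rw [FreeGroup.isReduced_cons_cons] at hL
    have h := WordState.step hε hg hg' hL.1 (by positivity) (ih b hL.2)
    rw [List.length_cons, pow_succ']
    exact h

variable {n : Fin 3 → Mat2}

/-- The combination of the reflections with given coefficients. -/
def comb (n : Fin 3 → Mat2) (c : Fin 3 → ℝ) : Mat2 := ∑ i, c i • n i

/-- Conjugation by `n i` is minus a reflection in the space of traceless matrices. The signs cancel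
for `A` and `B`, which are products of two of the `n i` up to sign. -/
lemma mul_comb_mul (hn : ∀ i j, n i * n j + n j * n i = (2 * g i j) • (1 : Mat2))
    (hn1 : ∀ i, n i * n i = 1) (i : Fin 3) (c : Fin 3 → ℝ) :
    n i * comb n c * n i = -comb n (refl g i c) := by
  have h1 : ∀ j, n i * n j * n i = (2 * g i j) • n i - n j := by
    intro j
    have h2 : n i * n j = (2 * g i j) • (1 : Mat2) - n j * n i := by rw [← hn]; abel
    rw [h2, sub_mul, smul_mul_assoc, one_mul, mul_assoc, hn1, mul_one]
  have h3 : comb n (refl g i c) = comb n c - (2 * ∑ j, g i j * c j) • n i := by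
    have h4 : ∀ j, refl g i c j • n j =
        c j • n j - if j = i then (2 * ∑ j, g i j * c j) • n i else 0 := by
      intro j
      by_cases hj : j = i
      · subst hj
        simp [refl, sub_smul]
      · simp [refl, hj]
    simp only [comb, h4, Finset.sum_sub_distrib, Finset.sum_ite_eq', Finset.mem_univ, if_true]
  rw [h3, comb, Finset.mul_sum, Finset.sum_mul]
  have h5 : ∀ j, n i * c j • n j * n i = (2 * (g i j * c j)) • n i - c j • n j := by
    intro j
    rw [mul_smul_comm, smul_mul_assoc, h1, smul_sub, smul_smul]
    congr 2
    ring
  simp only [h5, Finset.sum_sub_distrib]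
  rw [← Finset.sum_smul, ← Finset.mul_sum]
  abel

end Reflections

/-! ### Growth in the free group -/

/-- Exponential growth along the free group generated by two matrices. -/
def HasFreeGrowth (p : SL(2, ℝ) × SL(2, ℝ)) : Prop :=
  ∃ c l : ℝ, 0 < c ∧ 1 < l ∧ ∀ w : FreeGroup (Fin 2),
    c * l ^ w.norm ≤ fro (FreeGroup.lift (letter p) w).1

lemma two_mul_fro_ge_trace (M : Mat2) : |M.trace| ≤ 2 * fro M := by
  rw [Matrix.trace_fin_two]
  refine (abs_add_le _ _).trans ?_
  linarith [abs_entry_le_fro M 0 0, abs_entry_le_fro M 1 1]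

lemma conj_eq_of_neg_mul {A : SL(2, ℝ)} {m n : Mat2} (hA : m * n = -A.1) (hm : m * m = 1)
    (hn : n * n = 1) (V : Mat2) : A.1 * V * (A⁻¹).1 = m * (n * V * n) * m ∧
      (A⁻¹).1 * V * A.1 = n * (m * V * m) * n := by
  have hA' : A.1 = -(m * n) := by rw [hA, neg_neg]
  have hinv : (A⁻¹).1 = -(n * m) := by
    have h1 : A.1 * (-(n * m)) = 1 := by
      rw [hA', neg_mul_neg, mul_assoc, ← mul_assoc n, hn, one_mul, hm]
    calc (A⁻¹).1 = (A⁻¹).1 * (A.1 * (-(n * m))) := by rw [h1, mul_one]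
      _ = -(n * m) := by rw [← mul_assoc, coe_inv_mul, one_mul]
  rw [hinv, hA']
  constructor <;> noncomm_ring

/-- Conjugating `n 0 + n 1 + n 2` by a word multiplies its norm by at most the square of the norm of
the word. The resulting coefficients have a dominant one, `c i ≥ (1 + 2ε) ^ length`, and the trace
against some `n k` with `k ≠ i` is at most `-2ε c i`. So growth of the coefficients forces growth of
the matrix, at the rate of the square root. -/
theorem hasFreeGrowth_of_reflections {p : SL(2, ℝ) × SL(2, ℝ)} {n : Fin 3 → Mat2}
    {g : Fin 3 → Fin 3 → ℝ} {ε : ℝ} (hε : 0 < ε) (hg : ∀ i, g i i = 1)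
    (hg' : ∀ i j, i ≠ j → g i j ≤ -(1 + ε))
    (hn : ∀ i j, n i * n j + n j * n i = (2 * g i j) • (1 : Mat2)) (hA : n 0 * n 1 = -p.1.1)
    (hB : n 1 * n 2 = -p.2.1) : HasFreeGrowth p := by
  have hn1 : ∀ i, n i * n i = 1 := by
    intro i
    have h := hn i i
    rw [hg, mul_one, ← two_smul ℝ, smul_right_inj two_ne_zero] at h
    exact h
  have hact : ∀ (a : Fin 2 × Bool) (c : Fin 3 → ℝ),
      (cond a.2 (letter p a.1) (letter p a.1)⁻¹).1 * comb n c *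
        ((cond a.2 (letter p a.1) (letter p a.1)⁻¹)⁻¹).1 = comb n (letterAct g a c) := by
    have key : ∀ i j c, n i * (n j * comb n c * n j) * n i = comb n (refl g i (refl g j c)) := by
      intro i j c
      rw [mul_comb_mul hn hn1, mul_neg, neg_mul, mul_comb_mul hn hn1, neg_neg]
    rintro ⟨a, s⟩ c
    fin_cases a <;> cases s <;>
      simp only [letter, letterAct, cond_true, cond_false, inv_inv, Fin.zero_eta, Fin.mk_one,
        Matrix.cons_val_zero, Matrix.cons_val_one]
    · rw [(conj_eq_of_neg_mul hA (hn1 0) (hn1 1) _).2, key]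
    · rw [(conj_eq_of_neg_mul hA (hn1 0) (hn1 1) _).1, key]
    · rw [(conj_eq_of_neg_mul hB (hn1 1) (hn1 2) _).2, key]
    · rw [(conj_eq_of_neg_mul hB (hn1 1) (hn1 2) _).1, key]
  have hfold : ∀ L : List (Fin 2 × Bool),
      (FreeGroup.lift (letter p) (FreeGroup.mk L)).1 * comb n 1 *
        ((FreeGroup.lift (letter p) (FreeGroup.mk L))⁻¹).1 = comb n (L.foldr (letterAct g) 1) := by
    intro L
    induction L with
    | nil => simp
    | cons a L ih =>
      rw [List.foldr_cons, ← hact, ← ih, FreeGroup.lift_mk, FreeGroup.lift_mk, List.map_cons,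
        List.prod_cons, mul_inv_rev, Matrix.SpecialLinearGroup.coe_mul,
        Matrix.SpecialLinearGroup.coe_mul]
      simp only [mul_assoc]
  -- The summand `ε` makes `ε / K ≤ 1`, as the empty word requires.
  set K := (∑ i, fro (n i)) * fro (comb n 1) + ε with hK
  have hS : ∀ i, fro (n i) ≤ ∑ i, fro (n i) := fun i =>
    Finset.single_le_sum (fun j _ => fro_nonneg (n j)) (Finset.mem_univ i)
  have hS0 : 0 ≤ ∑ i, fro (n i) := Finset.sum_nonneg fun j _ => fro_nonneg (n j)
  have hKε : ε ≤ K := by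
    have := mul_nonneg hS0 (fro_nonneg (comb n 1))
    linarith
  have hK0 : 0 < K := hε.trans_le hKε
  have hl1 : 1 < √(1 + 2 * ε) := Real.lt_sqrt_of_sq_lt (by linarith)
  refine ⟨√(ε / K), √(1 + 2 * ε), Real.sqrt_pos.2 (by positivity), hl1, fun w => ?_⟩
  suffices h : ε / K * (1 + 2 * ε) ^ w.norm ≤ fro (FreeGroup.lift (letter p) w).1 ^ 2 by
    apply le_of_sq_le_sq _ (fro_nonneg _)
    rwa [mul_pow, Real.sq_sqrt (by positivity), ← pow_mul, mul_comm w.norm 2, pow_mul,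
      Real.sq_sqrt (by positivity)]
  rcases hw : w.toWord with _ | ⟨a, L⟩
  · rw [FreeGroup.toWord_eq_nil_iff] at hw
    subst hw
    have h1 : ε / K ≤ 1 := (div_le_one hK0).2 hKε
    have h2 := one_le_fro (FreeGroup.lift (letter p) 1)
    rw [FreeGroup.norm_one, pow_zero, mul_one]
    nlinarith
  · have hred : FreeGroup.IsReduced (a :: L) := hw ▸ FreeGroup.isReduced_toWord
    obtain ⟨i, hi⟩ := (wordState_foldr hε hg hg' L a hred).exists_dominated
    have hV := hfold (a :: L)
    rw [← hw, FreeGroup.mk_toWord] at hV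
    rw [← hw] at hi
    set c := w.toWord.foldr (letterAct g) 1
    set M := FreeGroup.lift (letter p) w
    obtain ⟨k, hk⟩ : ∃ k, i ≠ k := ⟨i + 1, by fin_cases i <;> decide⟩
    have hs := hi.sum_le hε hg hg' hk
    have htr : (n k * comb n c).trace = 2 * ∑ j, g k j * c j := by
      rw [comb, Finset.mul_sum, Matrix.trace_sum, Finset.mul_sum]
      refine Finset.sum_congr rfl fun j _ => ?_
      rw [mul_smul_comm, Matrix.trace_smul, smul_eq_mul]
      have h1 := congrArg Matrix.trace (hn k j)
      rw [Matrix.trace_add, Matrix.trace_mul_comm (n j), Matrix.trace_smul, Matrix.trace_one] at h1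
      simp at h1
      rw [show (n k * n j).trace = 2 * g k j by linarith]
      ring
    have h1 : ε * (1 + 2 * ε) ^ w.norm ≤ fro (n k) * fro (comb n c) := by
      have h2 := (neg_abs_le _).trans' (neg_le_neg (two_mul_fro_ge_trace (n k * comb n c)))
      have h3 := fro_mul_le (n k) (comb n c)
      rw [htr] at h2
      have h4 := hi.2 k
      have h5 := hi.1
      have h6 : ε * (1 + 2 * ε) ^ w.norm ≤ ε * c i := mul_le_mul_of_nonneg_left h5 hε.le
      linarith
    have h2 : fro (comb n c) ≤ fro M.1 * fro (comb n 1) * fro M.1 := by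
      rw [← hV]
      refine (fro_mul_le _ _).trans ?_
      rw [fro_inv]
      exact mul_le_mul_of_nonneg_right (fro_mul_le _ _) (fro_nonneg _)
    rw [div_mul_eq_mul_div, div_le_iff₀ hK0]
    have h3 : fro (n k) * fro (comb n c) ≤
        (∑ i, fro (n i)) * (fro M.1 * fro (comb n 1) * fro M.1) :=
      mul_le_mul (hS k) h2 (fro_nonneg _) hS0
    have h4 : 0 ≤ fro M.1 ^ 2 * ε := by positivity
    rw [hK]
    nlinarith

lemma norm_lift_le {f : Fin 2 → FreeGroup (Fin 2)} {K : ℕ} (hf : ∀ i, (f i).norm ≤ K)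
    (w : FreeGroup (Fin 2)) : (FreeGroup.lift f w).norm ≤ K * w.norm := by
  have h : ∀ L : List (Fin 2 × Bool), (FreeGroup.lift f (FreeGroup.mk L)).norm ≤ K * L.length := by
    intro L
    induction L with
    | nil => simp [← FreeGroup.one_eq_mk]
    | cons a L ih =>
      rw [FreeGroup.lift_mk] at ih ⊢
      rw [List.map_cons, List.prod_cons, List.length_cons, mul_add, mul_one, add_comm]
      refine (FreeGroup.norm_mul_le _ _).trans (add_le_add ?_ ih)
      cases a.2
      · simpa [FreeGroup.norm_inv_eq] using hf a.1
      · simpa using hf a.1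
  have h1 := h w.toWord
  rwa [FreeGroup.mk_toWord] at h1

/-- Exponential growth is inherited by other bases of the free group. -/
lemma HasFreeGrowth.of_basis_change {p q : SL(2, ℝ) × SL(2, ℝ)} (h : HasFreeGrowth q)
    {u v : Fin 2 → FreeGroup (Fin 2)} (hu : ∀ i, FreeGroup.lift (letter q) (u i) = letter p i)
    (huv : ∀ i, FreeGroup.lift v (u i) = FreeGroup.of i) (hv : ∀ i, (v i).norm ≤ 2) :
    HasFreeGrowth p := by
  obtain ⟨c, l, hc, hl, h⟩ := h
  -- Going back to the old basis at most doubles word lengths, hence the square root.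
  have hl1 : 1 < √l := Real.lt_sqrt_of_sq_lt (by linarith)
  refine ⟨c, √l, hc, hl1, fun w => ?_⟩
  have e1 : FreeGroup.lift (letter q) (FreeGroup.lift u w) = FreeGroup.lift (letter p) w := by
    rw [← MonoidHom.comp_apply]
    congr 1
    ext i
    simp [hu]
  have e2 : FreeGroup.lift v (FreeGroup.lift u w) = w := by
    have : (FreeGroup.lift v).comp (FreeGroup.lift u) = MonoidHom.id _ := by
      ext i
      simp [huv]
    exact DFunLike.congr_fun this w
  have h1 := norm_lift_le hv (FreeGroup.lift u w)
  rw [e2] at h1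
  have h2 := h (FreeGroup.lift u w)
  rw [e1] at h2
  refine le_trans (mul_le_mul_of_nonneg_left ?_ hc.le) h2
  calc √l ^ w.norm ≤ √l ^ (2 * (FreeGroup.lift u w).norm) := pow_le_pow_right₀ hl1.le h1
    _ = l ^ (FreeGroup.lift u w).norm := by rw [pow_mul, Real.sq_sqrt (by linarith)]

lemma HasFreeGrowth.hasGrowth {p : SL(2, ℝ) × SL(2, ℝ)} (h : HasFreeGrowth p) : HasGrowth p := by
  obtain ⟨c, l, hc, hl, h⟩ := h
  refine ⟨c, l, hc, hl, fun w => ?_⟩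
  have h1 := h (FreeGroup.mk (w.map fun i => (i, true)))
  have hred : FreeGroup.IsReduced (w.map fun i => (i, true)) := by
    clear h1
    induction w with
    | nil => simp
    | cons a w ih =>
      cases w with
      | nil => simp
      | cons b w =>
        rw [List.map_cons] at ih
        rw [List.map_cons, List.map_cons, FreeGroup.isReduced_cons_cons]
        exact ⟨fun _ => rfl, ih⟩
  rw [FreeGroup.norm, FreeGroup.toWord_mk, hred.reduce_eq, List.length_map, FreeGroup.lift_mk,
    List.map_map] at h1
  exact h1

/-! ### Schottky pairs -/

/-- The pairs with `tr A > 2`, `tr B > 2` and `tr AB < -2`. -/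
def schottkySet : Set (SL(2, ℝ) × SL(2, ℝ)) := {p | 2 < trA p ∧ 2 < trB p ∧ trAB p < -2}

lemma coe_add_inv (A : SL(2, ℝ)) : A.1 + (A⁻¹).1 = (A.1.trace) • (1 : Mat2) := by
  rw [inv_entries, Matrix.trace_fin_two]
  ext i j
  fin_cases i <;> fin_cases j <;> simp [add_comm]

/-- The commutator anticommutes with the traceless part of `A`. Normalized, it is the involution
that conjugates both generators to their inverses. -/
lemma commutator_mul_left (A B : SL(2, ℝ)) :
    (A.1 * B.1 - B.1 * A.1) * A.1 = (A⁻¹).1 * (A.1 * B.1 - B.1 * A.1) := by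
  have h1 : (A⁻¹).1 = (A.1.trace) • (1 : Mat2) - A.1 := by rw [← coe_add_inv]; abel
  have h2 : A.1 * A.1 = (A.1.trace) • A.1 - 1 := by
    have := coe_mul_inv A
    rw [h1, mul_sub, mul_smul_comm, mul_one, sub_eq_iff_eq_add] at this
    rw [this]
    abel
  rw [mul_sub, ← mul_assoc, coe_inv_mul, one_mul, sub_mul, h1, mul_assoc B.1, h2]
  simp only [sub_mul, mul_sub, smul_mul_assoc, mul_smul_comm, one_mul, mul_one, mul_assoc]
  abel

lemma commutator_mul_right (A B : SL(2, ℝ)) :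
    (A.1 * B.1 - B.1 * A.1) * B.1 = (B⁻¹).1 * (A.1 * B.1 - B.1 * A.1) := by
  have h := commutator_mul_left B A
  rw [← neg_sub (B.1 * A.1), neg_mul, h, mul_neg]

/-- Cayley–Hamilton: `AB - BA` is traceless, of determinant `2 - trComm p`. -/
lemma commutator_sq (p : SL(2, ℝ) × SL(2, ℝ)) :
    (p.1.1 * p.2.1 - p.2.1 * p.1.1) * (p.1.1 * p.2.1 - p.2.1 * p.1.1) =
      (trComm p - 2) • (1 : Mat2) := by
  have hdA := det_eq p.1
  have hdB := det_eq p.2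
  have h3 := four_mul_trComm_sub p
  have e2 : trA p ^ 2 - 4 = (p.1.1 0 0 - p.1.1 1 1) ^ 2 + 4 * (p.1.1 0 1 * p.1.1 1 0) := by
    rw [trA_eq]; linear_combination 4 * hdA
  have e3 : trB p ^ 2 - 4 = (p.2.1 0 0 - p.2.1 1 1) ^ 2 + 4 * (p.2.1 0 1 * p.2.1 1 0) := by
    rw [trB_eq]; linear_combination 4 * hdB
  rw [e2, e3, trAB_eq, trA_eq, trB_eq] at h3
  ext i j
  fin_cases i <;> fin_cases j <;> simp [Matrix.mul_apply, Fin.sum_univ_two] <;> linarith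

/-- With `Y` the normalized commutator, `AY`, `-Y` and `YB` are involutions whose consecutive
products are `-A` and `-B`. Their off-diagonal Gram entries `-tr A / 2`, `-tr B / 2`, `tr AB / 2`
are all below `-1`: the reflecting geodesics are pairwise disjoint. -/
theorem hasFreeGrowth_of_mem_schottkySet {p : SL(2, ℝ) × SL(2, ℝ)} (hp : p ∈ schottkySet) :
    HasFreeGrowth p := by
  obtain ⟨hx, hy, hz⟩ := hp
  have hk : 0 < trComm p - 2 := by
    rw [trComm]
    nlinarith [mul_pos (sub_pos.2 hx) (sub_pos.2 hy), mul_pos (by linarith : 0 < trA p)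
      (by linarith : 0 < trB p)]
  obtain ⟨r, hr0, hr2⟩ : ∃ r : ℝ, 0 < r ∧ r ^ 2 = trComm p - 2 :=
    ⟨_, Real.sqrt_pos.2 hk, Real.sq_sqrt hk.le⟩
  obtain ⟨Y, hY, hYA, hYB⟩ : ∃ Y : Mat2, Y * Y = 1 ∧ Y * p.1.1 = (p.1⁻¹).1 * Y ∧
      Y * p.2.1 = (p.2⁻¹).1 * Y := by
    refine ⟨r⁻¹ • (p.1.1 * p.2.1 - p.2.1 * p.1.1), ?_, ?_, ?_⟩
    · rw [smul_mul_smul_comm, commutator_sq, ← hr2, smul_smul]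
      convert one_smul ℝ (1 : Mat2)
      field_simp
    · rw [smul_mul_assoc, commutator_mul_left, mul_smul_comm]
    · rw [smul_mul_assoc, commutator_mul_right, mul_smul_comm]
  have hxA : p.1.1 + (p.1⁻¹).1 = (trA p) • (1 : Mat2) := coe_add_inv p.1
  have hyB : p.2.1 + (p.2⁻¹).1 = (trB p) • (1 : Mat2) := coe_add_inv p.2
  have hzAB : p.1.1 * p.2.1 + (p.2⁻¹).1 * (p.1⁻¹).1 = (trAB p) • (1 : Mat2) := by
    have := coe_add_inv (p.1 * p.2)
    rwa [mul_inv_rev, Matrix.SpecialLinearGroup.coe_mul, Matrix.SpecialLinearGroup.coe_mul] at this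
  have hA1 := coe_mul_inv p.1
  have hB1 := coe_inv_mul p.2
  generalize (p.1⁻¹).1 = A' at *
  generalize (p.2⁻¹).1 = B' at *
  have n00 : (p.1.1 * Y) * (p.1.1 * Y) = 1 := by
    rw [mul_assoc, ← mul_assoc Y, hYA, mul_assoc A', hY, mul_one, hA1]
  have n22 : (Y * p.2.1) * (Y * p.2.1) = 1 := by
    nth_rewrite 1 [hYB]
    rw [mul_assoc, ← mul_assoc Y, hY, one_mul, hB1]
  have n01 : (p.1.1 * Y) * (-Y) = -p.1.1 := by rw [mul_neg, mul_assoc, hY, mul_one]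
  have n10 : (-Y) * (p.1.1 * Y) = -A' := by
    rw [neg_mul, ← mul_assoc, hYA, mul_assoc, hY, mul_one]
  have n12 : (-Y) * (Y * p.2.1) = -p.2.1 := by rw [neg_mul, ← mul_assoc, hY, one_mul]
  have n21 : (Y * p.2.1) * (-Y) = -B' := by rw [hYB, mul_neg, mul_assoc, hY, mul_one]
  have n02 : (p.1.1 * Y) * (Y * p.2.1) = p.1.1 * p.2.1 := by
    rw [mul_assoc, ← mul_assoc Y, hY, one_mul]
  have n20 : (Y * p.2.1) * (p.1.1 * Y) = B' * A' := by
    rw [hYB, mul_assoc, ← mul_assoc Y, hYA, mul_assoc A', hY, mul_one]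
  have n11 : (-Y) * (-Y) = 1 := by rw [neg_mul_neg, hY]
  have htwo : (1 : Mat2) + 1 = (2 : ℝ) • (1 : Mat2) := (two_smul ℝ _).symm
  refine hasFreeGrowth_of_reflections (n := ![p.1.1 * Y, -Y, Y * p.2.1])
    (g := ![![1, -(trA p / 2), trAB p / 2], ![-(trA p / 2), 1, -(trB p / 2)],
      ![trAB p / 2, -(trB p / 2), 1]])
    (ε := min (trA p / 2 - 1) (min (trB p / 2 - 1) (-(trAB p / 2) - 1))) ?_ ?_ ?_ ?_ n01 n12
  · exact lt_min (by linarith) (lt_min (by linarith) (by linarith))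
  · intro i
    fin_cases i <;> rfl
  · have m1 := min_le_left (trA p / 2 - 1) (min (trB p / 2 - 1) (-(trAB p / 2) - 1))
    have m2 := (min_le_right (trA p / 2 - 1) (min (trB p / 2 - 1) (-(trAB p / 2) - 1))).trans
      (min_le_left _ _)
    have m3 := (min_le_right (trA p / 2 - 1) (min (trB p / 2 - 1) (-(trAB p / 2) - 1))).trans
      (min_le_right _ _)
    generalize min (trA p / 2 - 1) (min (trB p / 2 - 1) (-(trAB p / 2) - 1)) = ε at *
    intro i j hij
    fin_cases i <;> fin_cases j <;> simp at hij ⊢ <;> linarith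
  · have e1 : 2 * -(trA p / 2) = -trA p := by ring
    have e2 : 2 * -(trB p / 2) = -trB p := by ring
    have e3 : 2 * (trAB p / 2) = trAB p := by ring
    intro i j
    fin_cases i <;> fin_cases j <;>
      simp only [Fin.zero_eta, Fin.mk_one, Fin.reduceFinMk, Matrix.cons_val]
    · rw [n00, htwo, mul_one]
    · rw [n01, n10, e1, neg_smul, ← hxA]; abel
    · rw [n02, n20, e3, hzAB]
    · rw [n01, n10, e1, neg_smul, ← hxA]; abel
    · rw [n11, htwo, mul_one]
    · rw [n12, n21, e2, neg_smul, ← hyB]; abel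
    · rw [n02, n20, e3, ← hzAB]; abel
    · rw [n12, n21, e2, neg_smul, ← hyB]; abel
    · rw [n22, htwo, mul_one]

/-! ### The reduction algorithm -/

/-- One step of the reduction: `(A, B) ↦ (A, AB)` or `(A, B) ↦ (AB, B)`. -/
def stepHomeo : Bool → (SL(2, ℝ) × SL(2, ℝ)) ≃ₜ (SL(2, ℝ) × SL(2, ℝ))
  | true =>
    { toFun := fun p => (p.1, p.1 * p.2)
      invFun := fun p => (p.1, p.1⁻¹ * p.2)
      left_inv := fun p => by simp
      right_inv := fun p => by simp
      continuous_toFun := by fun_prop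
      continuous_invFun := by fun_prop }
  | false =>
    { toFun := fun p => (p.1 * p.2, p.2)
      invFun := fun p => (p.1 * p.2⁻¹, p.2)
      left_inv := fun p => by simp
      right_inv := fun p => by simp
      continuous_toFun := by fun_prop
      continuous_invFun := by fun_prop }

/-- A sequence of reduction steps. -/
def reduction : List Bool → (SL(2, ℝ) × SL(2, ℝ)) ≃ₜ (SL(2, ℝ) × SL(2, ℝ))
  | [] => Homeomorph.refl _
  | b :: F => (stepHomeo b).trans (reduction F)

lemma stepHomeo_true (p : SL(2, ℝ) × SL(2, ℝ)) : stepHomeo true p = (p.1, p.1 * p.2) := rfl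

lemma stepHomeo_false (p : SL(2, ℝ) × SL(2, ℝ)) : stepHomeo false p = (p.1 * p.2, p.2) := rfl

lemma reduction_nil (p : SL(2, ℝ) × SL(2, ℝ)) : reduction [] p = p := rfl

lemma reduction_cons (b : Bool) (F : List Bool) (p : SL(2, ℝ) × SL(2, ℝ)) :
    reduction (b :: F) p = reduction F (stepHomeo b p) := rfl

lemma HasFreeGrowth.of_stepHomeo {b : Bool} {p : SL(2, ℝ) × SL(2, ℝ)}
    (h : HasFreeGrowth (stepHomeo b p)) : HasFreeGrowth p := by
  have hnorm : ((FreeGroup.of 0 : FreeGroup (Fin 2)) * FreeGroup.of 1).norm ≤ 2 :=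
    (FreeGroup.norm_mul_le _ _).trans (by simp)
  cases b
  · refine h.of_basis_change (u := ![FreeGroup.of 0 * (FreeGroup.of 1)⁻¹, FreeGroup.of 1])
      (v := ![FreeGroup.of 0 * FreeGroup.of 1, FreeGroup.of 1]) ?_ ?_ ?_ <;>
    · intro i
      fin_cases i <;> simp [letter, stepHomeo_false, hnorm]
  · refine h.of_basis_change (u := ![FreeGroup.of 0, (FreeGroup.of 0)⁻¹ * FreeGroup.of 1])
      (v := ![FreeGroup.of 0, FreeGroup.of 0 * FreeGroup.of 1]) ?_ ?_ ?_ <;>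
    · intro i
      fin_cases i <;> simp [letter, stepHomeo_true, hnorm]

lemma hasFreeGrowth_of_reduction {F : List Bool} {p : SL(2, ℝ) × SL(2, ℝ)}
    (h : reduction F p ∈ schottkySet) : HasFreeGrowth p := by
  induction F generalizing p with
  | nil => exact hasFreeGrowth_of_mem_schottkySet h
  | cons b F ih => exact (ih h).of_stepHomeo

/-- Products of the reduced pair are products of the original pair. -/
lemma exists_word_stepHomeo (b : Bool) (p : SL(2, ℝ) × SL(2, ℝ)) {w : List (Fin 2)} (hw : w ≠ []) :
    ∃ w' : List (Fin 2), w' ≠ [] ∧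
      (w.map (letter (stepHomeo b p))).prod = (w'.map (letter p)).prod := by
  have hletter : ∀ i, ∃ u : List (Fin 2), u ≠ [] ∧
      letter (stepHomeo b p) i = (u.map (letter p)).prod := by
    intro i
    cases b <;> fin_cases i
    · exact ⟨[0, 1], by simp, by simp [letter, stepHomeo_false]⟩
    · exact ⟨[1], by simp, by simp [letter, stepHomeo_false]⟩
    · exact ⟨[0], by simp, by simp [letter, stepHomeo_true]⟩
    · exact ⟨[0, 1], by simp, by simp [letter, stepHomeo_true]⟩
  induction w with
  | nil => exact absurd rfl hw
  | cons a w ih =>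
    obtain ⟨u, hu, hu'⟩ := hletter a
    by_cases hw' : w = []
    · subst hw'
      exact ⟨u, hu, by simp [hu']⟩
    · obtain ⟨w', -, hw2⟩ := ih hw'
      exact ⟨u ++ w', by simp [hu], by simp [hu', hw2]⟩

lemma exists_word_reduction (F : List Bool) (p : SL(2, ℝ) × SL(2, ℝ)) {w : List (Fin 2)}
    (hw : w ≠ []) : ∃ w' : List (Fin 2), w' ≠ [] ∧
      (w.map (letter (reduction F p))).prod = (w'.map (letter p)).prod := by
  induction F generalizing p with
  | nil => exact ⟨w, hw, rfl⟩
  | cons b F ih =>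
    obtain ⟨w₁, h1, e1⟩ := ih (stepHomeo b p)
    obtain ⟨w₂, h2, e2⟩ := exists_word_stepHomeo b p h1
    exact ⟨w₂, h2, by rw [reduction_cons, e1, e2]⟩

lemma trace_mul_mul_left (A B : SL(2, ℝ)) :
    (A * (A * B)).1.trace = A.1.trace * (A * B).1.trace - B.1.trace := by
  have hd := det_eq A
  simp only [Matrix.SpecialLinearGroup.coe_mul, Matrix.trace_fin_two, Matrix.mul_apply,
    Fin.sum_univ_two]
  linear_combination (-B.1 0 0 - B.1 1 1) * hd

lemma trace_mul_mul_right (A B : SL(2, ℝ)) :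
    (A * B * B).1.trace = (A * B).1.trace * B.1.trace - A.1.trace := by
  have hd := det_eq B
  simp only [Matrix.SpecialLinearGroup.coe_mul, Matrix.trace_fin_two, Matrix.mul_apply,
    Fin.sum_univ_two]
  linear_combination (-A.1 0 0 - A.1 1 1) * hd

section Traces

variable (p : SL(2, ℝ) × SL(2, ℝ))

lemma trA_step_true : trA (stepHomeo true p) = trA p := rfl

lemma trB_step_true : trB (stepHomeo true p) = trAB p := rfl

lemma trAB_step_true : trAB (stepHomeo true p) = trA p * trAB p - trB p := trace_mul_mul_left _ _

lemma trA_step_false : trA (stepHomeo false p) = trAB p := rfl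

lemma trB_step_false : trB (stepHomeo false p) = trB p := rfl

lemma trAB_step_false : trAB (stepHomeo false p) = trAB p * trB p - trA p := trace_mul_mul_right _ _

/-- The invariant of the descent: a step is a Vieta jump on the cubic surface where `trComm` is
constant. -/
lemma trComm_step (b : Bool) : trComm (stepHomeo b p) = trComm p := by
  cases b
  · rw [trComm, trA_step_false, trB_step_false, trAB_step_false, trComm]; ring
  · rw [trComm, trA_step_true, trB_step_true, trAB_step_true, trComm]; ring

end Traces

/-! ### Descent of the traces for opposed pairs. -/

/-- The pairs with traces larger than two and opposed axes. -/
def opposedSet : Set (SL(2, ℝ) × SL(2, ℝ)) :=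
  {p | 2 < trA p ∧ 2 < trB p ∧ 2 * trAB p < trA p * trB p ∧ 2 < trComm p}

/-- As `tr A(AB) = xz - y`, the conclusion says that the axes of `(A, AB)` are again opposed. If it
failed, the identity `h3` would make `κ - 2` nonpositive. -/
lemma two_mul_lt_of_opposed {x y z : ℝ} (hx : 2 < x) (hxy : x ≤ y) (hz : 2 * z < x * y)
    (hk : 2 < x ^ 2 + y ^ 2 + z ^ 2 - x * y * z - 2) : x * z < 2 * y := by
  by_contra! h
  have h1 : 0 ≤ (x * z - 2 * y) * (x ^ 2 * y - x * z - 2 * y) := by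
    apply mul_nonneg (by linarith)
    nlinarith [mul_pos (by linarith : 0 < x) (by linarith : 0 < y),
      mul_nonneg (by nlinarith : 0 ≤ x ^ 2 - 4) (by linarith : 0 ≤ y),
      mul_pos (by linarith : 0 < x) (sub_pos.2 hz)]
  have h2 : 0 < x ^ 2 * (x ^ 2 + y ^ 2 + z ^ 2 - x * y * z - 4) := by
    apply mul_pos (by nlinarith) (by linarith)
  have h3 : x ^ 2 * (x ^ 2 + y ^ 2 + z ^ 2 - x * y * z - 4) =
      -((x * z - 2 * y) * (x ^ 2 * y - x * z - 2 * y)) - (x ^ 2 - 4) * (y ^ 2 - x ^ 2) := by ring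
  have h4 : 0 ≤ (x ^ 2 - 4) * (y ^ 2 - x ^ 2) := mul_nonneg (by nlinarith) (by nlinarith)
  linarith

/-- For equal traces `κ - 2` factors as `(z - 2)(z + 2 - x²)`, which is negative. -/
lemma ne_of_opposed {x z : ℝ} (hz2 : 2 < z) (hz : 2 * z < x * x)
    (hk : 2 < x ^ 2 + x ^ 2 + z ^ 2 - x * x * z - 2) : False := by
  nlinarith [mul_pos (sub_pos.2 hz2) (by nlinarith : 0 < x * x - z - 2)]

/-- The identity of `four_mul_trComm_sub` with `y` and `z` exchanged: `(2y - xz)² = 4(κ - 2) + (x² -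
4)(z² - 4)`. So `2y ≥ xz + 2δ`, and `x, z ≥ 2`. -/
lemma reduction_gap {x y z δ : ℝ} (hx : 2 ≤ x) (hz : 2 ≤ z)
    (hk : δ ^ 2 + 2 ≤ x ^ 2 + y ^ 2 + z ^ 2 - x * y * z - 2) (h : x * z ≤ 2 * y) :
    z + δ ≤ y ∧ x + δ ≤ y := by
  have h1 : (2 * δ) ^ 2 ≤ (2 * y - x * z) ^ 2 := by
    have h2 : 0 ≤ (x ^ 2 - 4) * (z ^ 2 - 4) := mul_nonneg (by nlinarith) (by nlinarith)
    nlinarith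
  have h2 : 2 * δ ≤ 2 * y - x * z := le_of_sq_le_sq h1 (by linarith)
  constructor <;> nlinarith

/-- The reduction stays among opposed pairs and decreases the traces. -/
lemma exists_step_of_mem_opposedSet {p : SL(2, ℝ) × SL(2, ℝ)} (hp : p ∈ opposedSet)
    (hz : 2 < trAB p) : ∃ b, stepHomeo b p ∈ opposedSet ∧
      trA (stepHomeo b p) + trB (stepHomeo b p) + √(trComm p - 2) ≤ trA p + trB p := by
  obtain ⟨hx, hy, hxy, hk⟩ := hp
  have hδ := Real.sq_sqrt (sub_pos.2 hk).le
  have hk' := hk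
  rw [trComm] at hk'
  -- The matrix of larger trace is the one replaced by the product.
  rcases lt_trichotomy (trA p) (trB p) with h | h | h
  · have h1 := two_mul_lt_of_opposed hx h.le hxy hk'
    have h2 := (reduction_gap hx.le hz.le (y := trB p) (by rw [hδ, trComm]; linarith) h1.le).1
    refine ⟨true, ⟨?_, ?_, ?_, ?_⟩, ?_⟩
    · exact hx
    · exact hz
    · rw [trAB_step_true, trA_step_true, trB_step_true]; linarith
    · rw [trComm_step]; exact hk
    · rw [trA_step_true, trB_step_true]; linarith
  · exfalso
    rw [← h] at hxy hk'
    exact ne_of_opposed hz hxy hk'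
  · have h1 := two_mul_lt_of_opposed (x := trB p) (y := trA p) (z := trAB p) hy h.le
      (by linarith) (by linarith)
    have h2 := (reduction_gap hy.le hz.le (y := trA p) (by rw [hδ, trComm]; linarith) h1.le).1
    refine ⟨false, ⟨?_, ?_, ?_, ?_⟩, ?_⟩
    · exact hz
    · exact hy
    · rw [trAB_step_false, trA_step_false, trB_step_false]; linarith
    · rw [trComm_step]; exact hk
    · rw [trA_step_false, trB_step_false]; linarith

/-- An opposed pair all of whose products are hyperbolic reduces to a Schottky pair. -/
theorem exists_reduction_mem_schottkySet {p : SL(2, ℝ) × SL(2, ℝ)} (hp : p ∈ opposedSet)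
    (hh : ∀ w : List (Fin 2), w ≠ [] → Hyperbolic (w.map (letter p)).prod) :
    ∃ F, reduction F p ∈ schottkySet := by
  set δ := √(trComm p - 2) with hδ
  have hδ0 : 0 < δ := Real.sqrt_pos.2 (sub_pos.2 hp.2.2.2)
  -- Each step lowers the sum of the traces by at least the constant `δ`, and the sum stays above 4.
  obtain ⟨n, hn⟩ := exists_nat_gt ((trA p + trB p - 4) / δ)
  rw [div_lt_iff₀ hδ0] at hn
  clear_value δ
  induction n generalizing p with
  | zero =>
    obtain ⟨hx, hy, -, -⟩ := hp
    exfalso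
    simp at hn
    linarith
  | succ n ih =>
    have hAB : 2 < |trAB p| := by
      have := hh [0, 1] (by simp)
      simpa [Hyperbolic, letter, trAB] using this
    rcases lt_abs.1 hAB with h | h
    · obtain ⟨b, hb, hlt⟩ := exists_step_of_mem_opposedSet hp h
      have hh' : ∀ w : List (Fin 2), w ≠ [] → Hyperbolic (w.map (letter (stepHomeo b p))).prod := by
        intro w hw
        obtain ⟨w', hw', e⟩ := exists_word_stepHomeo b p hw
        rw [e]
        exact hh w' hw'
      obtain ⟨F, hF⟩ := ih hb hh' (by rw [trComm_step]; exact hδ) (by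
        push_cast at hn
        rw [← hδ] at hlt
        linarith)
      exact ⟨b :: F, hF⟩
    · exact ⟨[], hp.1, hp.2.1, by rw [reduction_nil]; linarith⟩

/-! ### Closures of the pieces -/

/-- The closed counterpart of `schottkySet`. -/
def schottkyClosed : Set (SL(2, ℝ) × SL(2, ℝ)) := {p | 2 ≤ trA p ∧ 2 ≤ trB p ∧ trAB p ≤ -2}

/-- A closed set of opposed pairs containing all pairs that reduce to Schottky pairs. -/
def opposedClosed : Set (SL(2, ℝ) × SL(2, ℝ)) :=
  {p | 2 ≤ trA p ∧ 2 ≤ trB p ∧ 2 * trAB p ≤ trA p * trB p ∧ 18 ≤ trComm p}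

/-- The value 18 is that of `κ` at the extreme traces `(2, 2, -2)`. It provides the uniform gap
`√(18 - 2) = 4` of the steps below. -/
lemma schottkyClosed_subset : schottkyClosed ⊆ opposedClosed := by
  rintro p ⟨hx, hy, hz⟩
  have h1 : 4 ≤ trA p * trB p := by nlinarith
  refine ⟨hx, hy, by linarith, ?_⟩
  rw [trComm]
  nlinarith

/-- Opposition of `(A, AB)` is the inequality `xz ≤ 2y`, to which `reduction_gap` applies. In
particular a pair reduced by this step has the larger trace on `B`. -/
lemma of_stepHomeo_true_mem {p : SL(2, ℝ) × SL(2, ℝ)} (h : stepHomeo true p ∈ opposedClosed) :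
    p ∈ opposedClosed ∧ 2 ≤ trAB p ∧ trAB p + 4 ≤ trB p ∧ trA p + 4 ≤ trB p := by
  obtain ⟨hx, hz, hz', hk⟩ := h
  rw [trComm_step] at hk
  rw [trA_step_true] at hx hz'
  rw [trB_step_true] at hz hz'
  rw [trAB_step_true] at hz'
  have hk' := hk
  rw [trComm] at hk'
  obtain ⟨h1, h2⟩ := reduction_gap (δ := 4) (y := trB p) hx hz (by linarith)
    (by linarith)
  exact ⟨⟨hx, by linarith, by nlinarith, hk⟩, hz, h1, h2⟩

lemma of_stepHomeo_false_mem {p : SL(2, ℝ) × SL(2, ℝ)} (h : stepHomeo false p ∈ opposedClosed) :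
    p ∈ opposedClosed ∧ 2 ≤ trAB p ∧ trAB p + 4 ≤ trA p ∧ trB p + 4 ≤ trA p := by
  obtain ⟨hz, hy, hz', hk⟩ := h
  rw [trComm_step] at hk
  rw [trB_step_false] at hy hz'
  rw [trA_step_false] at hz hz'
  rw [trAB_step_false] at hz'
  have hk' := hk
  rw [trComm] at hk'
  obtain ⟨h1, h2⟩ := reduction_gap (δ := 4) (y := trA p) hy hz (by linarith)
    (by linarith)
  exact ⟨⟨by linarith, hy, by nlinarith, hk⟩, hz, h1, h2⟩

lemma mem_opposedClosed_of_reduction {F : List Bool} {p : SL(2, ℝ) × SL(2, ℝ)}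
    (h : reduction F p ∈ schottkyClosed) :
    p ∈ opposedClosed ∧ 4 * (F.length : ℝ) ≤ trA p + trB p := by
  induction F generalizing p with
  | nil =>
    have h1 := schottkyClosed_subset h
    rw [reduction_nil] at h1
    refine ⟨h1, ?_⟩
    obtain ⟨hx, hy, -⟩ := h1
    simp
    linarith
  | cons b F ih =>
    rw [reduction_cons] at h
    obtain ⟨h1, h2⟩ := ih h
    rw [List.length_cons]
    push_cast
    cases b
    · obtain ⟨h3, h4, h5, h6⟩ := of_stepHomeo_false_mem h1
      rw [trA_step_false, trB_step_false] at h2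
      exact ⟨h3, by linarith⟩
    · obtain ⟨h3, h4, h5, h6⟩ := of_stepHomeo_true_mem h1
      rw [trA_step_true, trB_step_true] at h2
      exact ⟨h3, by linarith⟩

/-- The sign of `tr AB` tells whether the reduction has ended, and the larger of the two traces
which step comes next. Both tests survive on the closed sets, so even the closures of the pieces are
disjoint. -/
lemma reduction_unique {F G : List Bool} {p : SL(2, ℝ) × SL(2, ℝ)}
    (hF : reduction F p ∈ schottkyClosed) (hG : reduction G p ∈ schottkyClosed) : F = G := by
  induction F generalizing p G with
  | nil =>
    cases G with
    | nil => rfl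
    | cons b G =>
      exfalso
      have h1 := (mem_opposedClosed_of_reduction (F := G) hG).1
      have h2 : trAB p ≤ -2 := hF.2.2
      cases b
      · linarith [(of_stepHomeo_false_mem h1).2.1]
      · linarith [(of_stepHomeo_true_mem h1).2.1]
  | cons a F ih =>
    have h0 := (mem_opposedClosed_of_reduction (F := F) hF).1
    cases G with
    | nil =>
      exfalso
      have h2 : trAB p ≤ -2 := hG.2.2
      cases a
      · linarith [(of_stepHomeo_false_mem h0).2.1]
      · linarith [(of_stepHomeo_true_mem h0).2.1]
    | cons b G =>
      have h1 := (mem_opposedClosed_of_reduction (F := G) hG).1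
      have hab : a = b := by
        cases a <;> cases b
        · rfl
        · exfalso
          linarith [(of_stepHomeo_false_mem h0).2.2.2, (of_stepHomeo_true_mem h1).2.2.2]
        · exfalso
          linarith [(of_stepHomeo_true_mem h0).2.2.2, (of_stepHomeo_false_mem h1).2.2.2]
        · rfl
      subst hab
      rw [ih hF hG]

/-! ### Common invariant directions -/

lemma exists_conj_diagonal {A : SL(2, ℝ)} (hA : 2 < A.1.trace) :
    ∃ (g : SL(2, ℝ)) (l : ℝ), 1 < l ∧ (g * A * g⁻¹).1 = !![l, 0; 0, l⁻¹] := by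
  have hd := det_eq A
  rw [Matrix.trace_fin_two] at hA
  set x := A.1 0 0 + A.1 1 1 with hx
  have hx4 : 0 < x ^ 2 / 4 - 1 := by nlinarith
  obtain ⟨r, hr0, hr2⟩ : ∃ r : ℝ, 0 < r ∧ r ^ 2 = x ^ 2 / 4 - 1 :=
    ⟨_, Real.sqrt_pos.2 hx4, Real.sq_sqrt hx4.le⟩
  obtain ⟨g, hg⟩ := exists_diagonalize (M := A.1 - (x / 2) • (1 : Mat2)) hr0
    (by simp; linarith) (by simp; rw [hr2, hx]; linarith)
  refine ⟨g, x / 2 + r, by linarith, ?_⟩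
  have hinv : (x / 2 + r)⁻¹ = x / 2 - r :=
    inv_eq_of_mul_eq_one_right (by nlinarith)
  rw [mul_sub, sub_mul, mul_smul_comm, smul_mul_assoc, mul_one, coe_mul_inv, sub_eq_iff_eq_add] at hg
  rw [Matrix.SpecialLinearGroup.coe_mul, Matrix.SpecialLinearGroup.coe_mul, hg, hinv]
  ext i j
  fin_cases i <;> fin_cases j <;> simp <;> ring

lemma mulVec_conj_inv {g A : SL(2, ℝ)} {v : Fin 2 → ℝ} {c : ℝ}
    (h : (g * A * g⁻¹).1 *ᵥ v = c • v) : A.1 *ᵥ ((g⁻¹).1 *ᵥ v) = c • ((g⁻¹).1 *ᵥ v) := by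
  have e : (A * g⁻¹) = g⁻¹ * (g * A * g⁻¹) := by simp [mul_assoc]
  rw [Matrix.mulVec_mulVec, ← Matrix.SpecialLinearGroup.coe_mul, e,
    Matrix.SpecialLinearGroup.coe_mul, ← Matrix.mulVec_mulVec, h, Matrix.mulVec_smul]

lemma isUnstableDir_mk {A : SL(2, ℝ)} (hA : Hyperbolic A) {v : Fin 2 → ℝ} (hv : v ≠ 0) {c : ℝ}
    (hc : 1 < |c|) (h : A.1 *ᵥ v = c • v) : IsUnstableDir A (Projectivization.mk ℝ v hv) := by
  refine Or.inl ⟨hA, c, hc, fun w hw => ?_⟩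
  obtain ⟨a, rfl⟩ := (mem_submodule_mk hv).1 hw
  rw [Matrix.mulVec_smul, h, smul_comm]

lemma isStableDir_mk {A : SL(2, ℝ)} (hA : Hyperbolic A) {v : Fin 2 → ℝ} (hv : v ≠ 0) {c : ℝ}
    (hc : |c| < 1) (h : A.1 *ᵥ v = c • v) : IsStableDir A (Projectivization.mk ℝ v hv) := by
  refine Or.inl ⟨hA, c, hc, fun w hw => ?_⟩
  obtain ⟨a, rfl⟩ := (mem_submodule_mk hv).1 hw
  rw [Matrix.mulVec_smul, h, smul_comm]

lemma hyperbolic_of_two_lt {A : SL(2, ℝ)} (h : 2 < A.1.trace) : Hyperbolic A :=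
  lt_of_lt_of_le h (le_abs_self _)

/-- The case of opposed axes with a common end point. -/
theorem unstableEqStable_of_trComm_eq_two {p : SL(2, ℝ) × SL(2, ℝ)} (hx : 2 < trA p)
    (hy : 2 < trB p) (hz : 2 * trAB p < trA p * trB p) (hk : trComm p = 2) :
    UnstableEqStable p.1 p.2 ∨ UnstableEqStable p.2 p.1 := by
  obtain ⟨g, l, hl, hg⟩ := exists_conj_diagonal hx
  have hA := hyperbolic_of_two_lt hx
  have hB := hyperbolic_of_two_lt hy
  have hX := commutator_sq (conjPair g p)
  have hd := det_eq (conjPair g p).2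
  rw [trComm_conjPair, hk, sub_self, zero_smul] at hX
  rw [← trA_conjPair g, ← trB_conjPair g, ← trAB_conjPair g, trAB_eq, trA_eq, trB_eq] at hz
  rw [← trB_conjPair g, trB_eq] at hy
  have hg' : (conjPair g p).1.1 = !![l, 0; 0, l⁻¹] := hg
  have hB' : (conjPair g p).2 = g * p.2 * g⁻¹ := rfl
  rw [hg'] at hX hz
  have hX0 := congrFun (congrFun hX 0) 0
  simp [Matrix.mul_apply, Fin.sum_univ_two, Matrix.vecMul, dotProduct] at hX0
  simp at hz
  have hl0 : 0 < l := by linarith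
  have hli : l⁻¹ < 1 := inv_lt_one_of_one_lt₀ hl
  have hli0 : 0 < l⁻¹ := by positivity
  -- With the first matrix diagonal, the upper left entry of the squared commutator is `-(l - l⁻¹)²`
  -- times this product, so the second matrix is triangular.
  have hbc : (conjPair g p).2.1 0 1 * (conjPair g p).2.1 1 0 = 0 := by
    have h1 : (l - l⁻¹) ^ 2 * ((conjPair g p).2.1 0 1 * (conjPair g p).2.1 1 0) = 0 := by
      rw [← neg_eq_zero, ← hX0]
      ring
    have h2 : (l - l⁻¹) ^ 2 ≠ 0 := pow_ne_zero _ (by linarith)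
    exact (mul_eq_zero.1 h1).resolve_left h2
  -- Opposition reads `(l - l⁻¹)(a - d) < 0`, with `a, d` the diagonal entries of the second matrix:
  -- its expanded and contracted directions are in the opposite order.
  have had : (conjPair g p).2.1 0 0 < (conjPair g p).2.1 1 1 := by nlinarith
  rw [hbc, sub_zero] at hd
  have ha0 : 0 < (conjPair g p).2.1 0 0 := by
    by_contra! h
    nlinarith
  have ha1 : (conjPair g p).2.1 0 0 < 1 := by nlinarith
  have hd1 : 1 < (conjPair g p).2.1 1 1 := by nlinarith
  have e1 : (![1, 0] : Fin 2 → ℝ) ≠ 0 := vec_one_ne_zero 0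
  have e2 : (![0, 1] : Fin 2 → ℝ) ≠ 0 := by
    intro h
    have := congrFun h 1
    simp at this
  rcases mul_eq_zero.1 hbc with hb | hc
  · right
    refine ⟨Projectivization.mk ℝ _ (mulVec_ne_zero g⁻¹ e2),
      isUnstableDir_mk hB _ (c := (conjPair g p).2.1 1 1) (by rwa [abs_of_pos (by linarith)])
        (mulVec_conj_inv ?_),
      isStableDir_mk hA _ (c := l⁻¹) (by rwa [abs_of_pos hli0]) (mulVec_conj_inv ?_)⟩
    · rw [← hB']
      ext i
      fin_cases i <;> simp [Matrix.mulVec, dotProduct, Fin.sum_univ_two, hb]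
    · rw [hg]
      ext i
      fin_cases i <;> simp
  · left
    refine ⟨Projectivization.mk ℝ _ (mulVec_ne_zero g⁻¹ e1),
      isUnstableDir_mk hA _ (c := l) (by rwa [abs_of_pos hl0]) (mulVec_conj_inv ?_),
      isStableDir_mk hB _ (c := (conjPair g p).2.1 0 0) (by rwa [abs_of_pos ha0])
        (mulVec_conj_inv ?_)⟩
    · rw [hg]
      ext i
      fin_cases i <;> simp
    · rw [← hB']
      ext i
      fin_cases i <;> simp [Matrix.mulVec, dotProduct, Fin.sum_univ_two, hc]

lemma exists_eigen_of_smul_eq {A : SL(2, ℝ)} {d : P1} (h : A • d = d) {v : Fin 2 → ℝ}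
    (hv : v ∈ d.submodule) (hv0 : v ≠ 0) : ∃ c : ℝ, A.1 *ᵥ v = c • v := by
  have h1 := mulVec_mem_smul A hv
  rw [h, ← mk_eq_of_mem hv0 hv, mem_submodule_mk] at h1
  obtain ⟨c, hc⟩ := h1
  exact ⟨c, hc.symm⟩

/-- A common eigenvector is killed by `AB - BA`, whose square is the scalar `trComm - 2`. -/
lemma trComm_eq_two_of_unstableEqStable {A B : SL(2, ℝ)} (h : UnstableEqStable A B) :
    trComm (A, B) = 2 := by
  obtain ⟨d, hA, hB⟩ := h
  obtain ⟨v, hv, hv0⟩ := exists_ne_zero_mem d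
  have hA' : ∃ a : ℝ, A.1 *ᵥ v = a • v := by
    rcases hA with ⟨-, c, -, hc⟩ | ⟨-, -, -, hd⟩
    · exact ⟨c, hc v hv⟩
    · exact exists_eigen_of_smul_eq hd hv hv0
  have hB' : ∃ b : ℝ, B.1 *ᵥ v = b • v := by
    rcases hB with ⟨-, c, -, hc⟩ | ⟨-, -, -, hd⟩
    · exact ⟨c, hc v hv⟩
    · exact exists_eigen_of_smul_eq hd hv hv0
  obtain ⟨a, ha⟩ := hA'
  obtain ⟨b, hb⟩ := hB'
  have hX : (A.1 * B.1 - B.1 * A.1) *ᵥ v = 0 := by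
    rw [Matrix.sub_mulVec, ← Matrix.mulVec_mulVec, ← Matrix.mulVec_mulVec, ha, hb,
      Matrix.mulVec_smul, Matrix.mulVec_smul, ha, hb, smul_comm, sub_self]
  have h1 := congrArg (· *ᵥ v) (commutator_sq (A, B))
  simp only at h1
  rw [← Matrix.mulVec_mulVec, hX, Matrix.mulVec_zero, Matrix.smul_mulVec, Matrix.one_mulVec,
    eq_comm, smul_eq_zero] at h1
  linarith [h1.resolve_right hv0]

lemma trComm_swap (A B : SL(2, ℝ)) : trComm (A, B) = trComm (B, A) := by
  have h : trAB (A, B) = trAB (B, A) := by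
    rw [trAB_eq, trAB_eq]
    ring
  have h1 : trA (A, B) = trB (B, A) := rfl
  have h2 : trB (A, B) = trA (B, A) := rfl
  rw [trComm, trComm, h, h1, h2]
  ring

/-! ### Orientation of Schottky pairs -/

/-- A function whose sign distinguishes the two orientations of Schottky pairs. -/
def orient (p : SL(2, ℝ) × SL(2, ℝ)) : ℝ := trB p * p.1.1 1 0 + trA p * p.2.1 1 0

/-- This is the lower left entry of `yA + xB`, whose discriminant `4(xyz - x² - y²)` is negative
because `z ≤ -2`. A matrix without real eigenvectors is not triangular. -/
lemma orient_ne_zero {p : SL(2, ℝ) × SL(2, ℝ)} (hp : p ∈ schottkyClosed) : orient p ≠ 0 := by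
  intro h0
  obtain ⟨hx, hy, hz⟩ := hp
  have hdA := det_eq p.1
  have hdB := det_eq p.2
  have h1 : (trB p * p.1.1 0 0 + trA p * p.2.1 0 0 - trB p * p.1.1 1 1 - trA p * p.2.1 1 1) ^ 2 +
      4 * (trB p * p.1.1 0 1 + trA p * p.2.1 0 1) * orient p =
      4 * (trA p * trB p * trAB p - trA p ^ 2 - trB p ^ 2) := by
    rw [orient, trAB_eq, trA_eq, trB_eq]
    linear_combination (-4 * (p.2.1 0 0 + p.2.1 1 1) ^ 2) * hdA -
      4 * (p.1.1 0 0 + p.1.1 1 1) ^ 2 * hdB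
  rw [h0, mul_zero, add_zero] at h1
  have h2 := sq_nonneg
    (trB p * p.1.1 0 0 + trA p * p.2.1 0 0 - trB p * p.1.1 1 1 - trA p * p.2.1 1 1)
  have h3 : 0 < trA p * trB p := by positivity
  nlinarith [sq_nonneg (trA p), sq_nonneg (trB p)]

lemma continuous_trA : Continuous trA := by
  have h : trA = fun p => p.1.1 0 0 + p.1.1 1 1 := funext trA_eq
  rw [h]
  exact (continuous_entry continuous_fst 0 0).add (continuous_entry continuous_fst 1 1)

lemma continuous_trB : Continuous trB := by
  have h : trB = fun p => p.2.1 0 0 + p.2.1 1 1 := funext trB_eq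
  rw [h]
  exact (continuous_entry continuous_snd 0 0).add (continuous_entry continuous_snd 1 1)

lemma continuous_trAB : Continuous trAB := by
  have h : trAB = fun p => (p.1 * p.2).1 0 0 + (p.1 * p.2).1 1 1 :=
    funext fun p => Matrix.trace_fin_two _
  rw [h]
  have hm : Continuous fun p : SL(2, ℝ) × SL(2, ℝ) => p.1 * p.2 := continuous_mul
  exact (continuous_entry hm 0 0).add (continuous_entry hm 1 1)

lemma continuous_trComm : Continuous trComm := by
  have hA := continuous_trA
  have hB := continuous_trB
  have hC := continuous_trAB
  change Continuous fun p => trA p ^ 2 + trB p ^ 2 + trAB p ^ 2 - trA p * trB p * trAB p - 2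
  fun_prop

lemma continuous_orient : Continuous orient :=
  (continuous_trB.mul (continuous_entry continuous_fst 1 0)).add
    (continuous_trA.mul (continuous_entry continuous_snd 1 0))

lemma continuous_conjPair : Continuous fun q : SL(2, ℝ) × (SL(2, ℝ) × SL(2, ℝ)) =>
    conjPair q.1 q.2 := by
  simp only [conjPair]
  fun_prop

lemma conjPair_mem_schottkyClosed {g : SL(2, ℝ)} {p : SL(2, ℝ) × SL(2, ℝ)}
    (hp : p ∈ schottkyClosed) : conjPair g p ∈ schottkyClosed := by
  obtain ⟨hx, hy, hz⟩ := hp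
  exact ⟨by rwa [trA_conjPair], by rwa [trB_conjPair], by rwa [trAB_conjPair]⟩

lemma conjPair_mem_schottkySet {g : SL(2, ℝ)} {p : SL(2, ℝ) × SL(2, ℝ)}
    (hp : p ∈ schottkySet) : conjPair g p ∈ schottkySet := by
  obtain ⟨hx, hy, hz⟩ := hp
  exact ⟨by rwa [trA_conjPair], by rwa [trB_conjPair], by rwa [trAB_conjPair]⟩

lemma schottkySet_subset : schottkySet ⊆ schottkyClosed := fun _ hp =>
  ⟨hp.1.le, hp.2.1.le, hp.2.2.le⟩

/-- A continuous function without zeros on the connected group `SL(2, ℝ)` keeps its sign. -/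
lemma orient_conjPair_pos {p : SL(2, ℝ) × SL(2, ℝ)} (hp : p ∈ schottkyClosed) (g : SL(2, ℝ))
    (h : 0 < orient p) : 0 < orient (conjPair g p) := by
  by_contra! hle
  have hc : Continuous fun g => orient (conjPair g p) :=
    continuous_orient.comp (continuous_conjPair.comp (by fun_prop : Continuous fun g => (g, p)))
  obtain ⟨g', hg'⟩ := mem_range_of_exists_le_of_exists_ge hc ⟨g, hle⟩
    ⟨1, by rw [conjPair_one]; exact h.le⟩
  exact orient_ne_zero (conjPair_mem_schottkyClosed hp) hg'

lemma orient_conjPair_neg {p : SL(2, ℝ) × SL(2, ℝ)} (hp : p ∈ schottkyClosed) (g : SL(2, ℝ))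
    (h : orient p < 0) : orient (conjPair g p) < 0 := by
  rcases (orient_ne_zero (conjPair_mem_schottkyClosed (g := g) hp)).lt_or_gt with h1 | h1
  · exact h1
  · have h2 := orient_conjPair_pos (conjPair_mem_schottkyClosed hp) g⁻¹ h1
    rw [conjPair_conjPair, inv_mul_cancel, conjPair_one] at h2
    exact absurd h2 h.not_gt

/-- The positive or negative half-line. -/
def halfLine : Bool → Set ℝ
  | true => Ioi 0
  | false => Iio 0

lemma isConnected_halfLine (e : Bool) : IsConnected (halfLine e) := by
  cases e
  · exact isConnected_Iio
  · exact isConnected_Ioi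

lemma isOpen_halfLine (e : Bool) : IsOpen (halfLine e) := by
  cases e
  · exact isOpen_Iio
  · exact isOpen_Ioi

lemma ne_zero_of_mem_halfLine {e : Bool} {t : ℝ} (h : t ∈ halfLine e) : t ≠ 0 := by
  cases e
  · exact ne_of_lt h
  · exact ne_of_gt h

lemma mul_mem_halfLine {e : Bool} {s t : ℝ} (hs : 0 < s) (h : t ∈ halfLine e) :
    s * t ∈ halfLine e := by
  cases e
  · exact mul_neg_of_pos_of_neg hs h
  · exact mul_pos hs h

/-- The Schottky pairs of a given orientation. -/
def schottkyOriented (e : Bool) : Set (SL(2, ℝ) × SL(2, ℝ)) :=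
  {p | p ∈ schottkySet ∧ orient p ∈ halfLine e}

lemma orient_conjPair_mem {e : Bool} {p : SL(2, ℝ) × SL(2, ℝ)} (hp : p ∈ schottkyClosed)
    (g : SL(2, ℝ)) (h : orient p ∈ halfLine e) : orient (conjPair g p) ∈ halfLine e := by
  cases e
  · exact orient_conjPair_neg hp g h
  · exact orient_conjPair_pos hp g h

lemma mem_halfLine_of_mul_mem {e : Bool} {s t : ℝ} (hs : 0 < s) (h : s * t ∈ halfLine e) :
    t ∈ halfLine e := by
  cases e
  · exact (pos_iff_neg_of_mul_neg h).1 hs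
  · exact (mul_pos_iff_of_pos_left hs).1 h

/-! ### Connectedness of the oriented Schottky sets. -/

/-- Parameters for the normal form of an oriented Schottky pair: the large eigenvalue of the first
matrix, two traces, and a lower left entry. -/
abbrev NormalForm (e : Bool) : Type :=
  Ioi (1 : ℝ) × Ioi (2 : ℝ) × Iio (-2 : ℝ) × halfLine e

lemma exists_normalForm_map (e : Bool) :
    ∃ F : NormalForm e → SL(2, ℝ) × SL(2, ℝ),
      Continuous F ∧ ∀ q, (F q).1.1 = !![q.1.1, 0; 0, (q.1.1)⁻¹] ∧
        trB (F q) = q.2.1.1 ∧ trAB (F q) = q.2.2.1.1 ∧ (F q).2.1 1 0 = q.2.2.2.1 := by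
  have hl0 : ∀ q : NormalForm e, q.1.1 ≠ 0 := fun q => (zero_lt_one.trans (mem_Ioi.1 q.1.2)).ne'
  have hl1 : ∀ q : NormalForm e, q.1.1 ^ 2 - 1 ≠ 0 := fun q => by
    have := mem_Ioi.1 q.1.2
    nlinarith
  have ht : ∀ q : NormalForm e, q.2.2.2.1 ≠ 0 := fun q => ne_zero_of_mem_halfLine q.2.2.2.2
  -- The solution of `l a + l⁻¹ (y - a) = z`, which makes the product have trace `z`.
  let a : NormalForm e → ℝ := fun q => (q.1.1 * q.2.2.1.1 - q.2.1.1) / (q.1.1 ^ 2 - 1)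
  have ha : Continuous a := Continuous.div (by fun_prop) (by fun_prop) hl1
  let A : NormalForm e → SL(2, ℝ) := fun q => ⟨!![q.1.1, 0; 0, (q.1.1)⁻¹], by
    rw [Matrix.det_fin_two_of, mul_inv_cancel₀ (hl0 q)]; ring⟩
  let B : NormalForm e → SL(2, ℝ) := fun q =>
    ⟨!![a q, (a q * (q.2.1.1 - a q) - 1) / q.2.2.2.1; q.2.2.2.1, q.2.1.1 - a q], by
      rw [Matrix.det_fin_two_of, div_mul_cancel₀ _ (ht q)]; ring⟩
  have hAc : Continuous A := continuous_mk_SL fun i j => by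
    fin_cases i <;> fin_cases j <;> simp [A]
    · fun_prop
    · exact continuous_const
    · exact continuous_const
    · exact Continuous.inv₀ (by fun_prop) hl0
  have hBc : Continuous B := continuous_mk_SL fun i j => by
    fin_cases i <;> fin_cases j <;> simp [B]
    · exact ha
    · exact Continuous.div (by fun_prop) (by fun_prop) ht
    · fun_prop
    · fun_prop
  refine ⟨fun q => (A q, B q), hAc.prodMk hBc, fun q => ⟨rfl, ?_, ?_, rfl⟩⟩
  · rw [trB_eq]
    change a q + (q.2.1.1 - a q) = _
    ring
  · rw [trAB_eq]
    change q.1.1 * a q + 0 * q.2.2.2.1 + 0 * _ + (q.1.1)⁻¹ * (q.2.1.1 - a q) = _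
    have h0 := hl0 q
    have h1 := hl1 q
    simp only [a]
    field_simp
    ring

lemma SL2_ext_of_traces {p q : SL(2, ℝ) × SL(2, ℝ)} {l : ℝ} (hl : 1 < l)
    (hp : p.1.1 = !![l, 0; 0, l⁻¹]) (hq : q.1.1 = !![l, 0; 0, l⁻¹]) (hB : trB p = trB q)
    (hAB : trAB p = trAB q) (hc : p.2.1 1 0 = q.2.1 1 0) (hc0 : p.2.1 1 0 ≠ 0) : p = q := by
  have hl0 : 0 < l := by linarith
  have hli : l⁻¹ < 1 := inv_lt_one_of_one_lt₀ hl
  rw [trB_eq, trB_eq] at hB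
  rw [trAB_eq, trAB_eq, hp, hq] at hAB
  simp at hAB
  have h00 : p.2.1 0 0 = q.2.1 0 0 := by
    have h1 : (l - l⁻¹) * (p.2.1 0 0 - q.2.1 0 0) = 0 := by
      linear_combination hAB - l⁻¹ * hB
    have h2 : l - l⁻¹ ≠ 0 := by linarith
    linarith [(mul_eq_zero.1 h1).resolve_left h2]
  have h11 : p.2.1 1 1 = q.2.1 1 1 := by linarith
  have h01 : p.2.1 0 1 = q.2.1 0 1 := by
    have e1 := det_eq p.2
    have e2 := det_eq q.2
    apply mul_right_cancel₀ hc0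
    rw [h00, h11] at e1
    rw [← hc] at e2
    linarith
  refine Prod.ext (Subtype.ext (hp.trans hq.symm)) (Subtype.ext ?_)
  ext i j
  fin_cases i <;> fin_cases j <;> assumption

lemma orient_of_diagonal {p : SL(2, ℝ) × SL(2, ℝ)} {l : ℝ} (hp : p.1.1 = !![l, 0; 0, l⁻¹]) :
    orient p = trA p * p.2.1 1 0 := by
  rw [orient, hp]
  simp

/-- Every such pair is conjugate to one with diagonal first matrix, determined by its parameters,
and conjugation keeps the orientation. So the set is a continuous image of `SL(2, ℝ)` times four
intervals. -/
theorem isConnected_schottkyOriented (e : Bool) : IsConnected (schottkyOriented e) := by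
  obtain ⟨F, hF, hq⟩ := exists_normalForm_map e
  have hx : ∀ q, 2 < trA (F q) := by
    intro q
    have hl : 1 < q.1.1 := q.1.2
    have hl0 : 0 < q.1.1 := by linarith
    rw [trA_eq, (hq q).1]
    simp
    have h1 : q.1.1 * (q.1.1)⁻¹ = 1 := mul_inv_cancel₀ hl0.ne'
    have h2 : (q.1.1)⁻¹ < 1 := inv_lt_one_of_one_lt₀ hl
    nlinarith
  have himg : schottkyOriented e = (fun q : SL(2, ℝ) × (SL(2, ℝ) × SL(2, ℝ)) => conjPair q.1 q.2) ''
      (univ ×ˢ range F) := by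
    ext p
    constructor
    · rintro ⟨hp, ho⟩
      obtain ⟨g, l, hl, hg⟩ := exists_conj_diagonal hp.1
      have hg' : (conjPair g p).1.1 = !![l, 0; 0, l⁻¹] := hg
      have ho' := orient_conjPair_mem (schottkySet_subset hp) g ho
      rw [orient_of_diagonal hg', trA_conjPair] at ho'
      have hc := mem_halfLine_of_mul_mem (by linarith [hp.1]) ho'
      let q : NormalForm e :=
        (⟨l, hl⟩, ⟨trB p, hp.2.1⟩, ⟨trAB p, hp.2.2⟩, ⟨_, hc⟩)
      obtain ⟨h1, h2, h3, h4⟩ := hq q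
      have heq : conjPair g p = F q := SL2_ext_of_traces hl hg' h1
        (by rw [trB_conjPair, h2]) (by rw [trAB_conjPair, h3]) h4.symm (ne_zero_of_mem_halfLine hc)
      refine ⟨(g⁻¹, F q), ⟨mem_univ _, q, rfl⟩, ?_⟩
      simp only
      rw [← heq, conjPair_conjPair, inv_mul_cancel, conjPair_one]
    · rintro ⟨⟨g, -⟩, ⟨-, q, rfl⟩, rfl⟩
      obtain ⟨h1, h2, h3, h4⟩ := hq q
      have hmem : F q ∈ schottkySet := ⟨hx q, h2 ▸ q.2.1.2, h3 ▸ q.2.2.1.2⟩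
      refine ⟨conjPair_mem_schottkySet hmem, orient_conjPair_mem (schottkySet_subset hmem) g ?_⟩
      rw [orient_of_diagonal h1, h4]
      exact mul_mem_halfLine (by linarith [hx q]) q.2.2.2.2
  have c1 : ConnectedSpace (Ioi (1 : ℝ)) := Subtype.connectedSpace isConnected_Ioi
  have c2 : ConnectedSpace (Ioi (2 : ℝ)) := Subtype.connectedSpace isConnected_Ioi
  have c3 : ConnectedSpace (Iio (-2 : ℝ)) := Subtype.connectedSpace isConnected_Iio
  have c4 : ConnectedSpace (halfLine e) := Subtype.connectedSpace (isConnected_halfLine e)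
  rw [himg]
  exact (isConnected_univ.prod (isConnected_range hF)).image _ continuous_conjPair.continuousOn

/-! ### Locally finite families of components -/

section Components

variable {X ι : Type*} [TopologicalSpace X] {U : ι → Set X}

lemma componentsOf_iUnion (ho : ∀ i, IsOpen (U i)) (hc : ∀ i, IsConnected (U i))
    (hd : Pairwise fun i j => Disjoint (closure (U i)) (closure (U j))) :
    componentsOf (⋃ i, U i) = range U := by
  have key : ∀ i, ∀ x ∈ U i, connectedComponentIn (⋃ i, U i) x = U i := by
    intro i x hx
    have hxU : x ∈ ⋃ i, U i := mem_iUnion.2 ⟨i, hx⟩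
    refine Subset.antisymm ?_ ((hc i).isPreconnected.subset_connectedComponentIn hx
      (subset_iUnion U i))
    refine IsPreconnected.subset_left_of_subset_union (ho i)
      (isOpen_biUnion fun j (_ : j ∈ {j | j ≠ i}) => ho j) ?_ ?_
      ⟨x, mem_connectedComponentIn hxU, hx⟩ isPreconnected_connectedComponentIn
    · refine disjoint_iUnion₂_right.2 fun j hj => ?_
      exact (hd (Ne.symm hj)).mono subset_closure subset_closure
    · refine (connectedComponentIn_subset _ _).trans (iUnion_subset fun j => ?_)
      by_cases hj : j = i
      · exact hj ▸ subset_union_left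
      · exact (subset_biUnion_of_mem (u := U) (show j ∈ {j | j ≠ i} from hj)).trans
          subset_union_right
  ext C
  constructor
  · rintro ⟨x, hx, rfl⟩
    obtain ⟨i, hi⟩ := mem_iUnion.1 hx
    exact ⟨i, (key i x hi).symm⟩
  · rintro ⟨i, rfl⟩
    obtain ⟨x, hx⟩ := (hc i).nonempty
    exact ⟨x, mem_iUnion.2 ⟨i, hx⟩, (key i x hx).symm⟩

/-- Local finiteness lets the closure pass through the union, and a point of one closure lies in no
other member. -/
lemma frontier_iUnion_of_disjoint_closure (ho : ∀ i, IsOpen (U i)) (hf : LocallyFinite U)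
    (hd : Pairwise fun i j => Disjoint (closure (U i)) (closure (U j))) :
    frontier (⋃ i, U i) = ⋃ i, frontier (U i) := by
  rw [(isOpen_iUnion ho).frontier_eq, hf.closure_iUnion]
  ext x
  simp only [Set.mem_sdiff, mem_iUnion, not_exists, (ho _).frontier_eq]
  constructor
  · rintro ⟨⟨i, hi⟩, hn⟩
    exact ⟨i, hi, hn i⟩
  · rintro ⟨i, hi, hn⟩
    refine ⟨⟨i, hi⟩, fun j hj => ?_⟩
    have hij : i ≠ j := by
      rintro rfl
      exact hn hj
    exact disjoint_left.1 (hd hij) hi (subset_closure hj)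

lemma pairwiseDisjoint_frontier_range
    (hd : Pairwise fun i j => Disjoint (closure (U i)) (closure (U j))) :
    (range U).PairwiseDisjoint frontier := by
  rintro _ ⟨i, rfl⟩ _ ⟨j, rfl⟩ hne
  have hij : i ≠ j := fun h => hne (h ▸ rfl)
  exact (hd hij).mono frontier_subset_closure frontier_subset_closure

end Components

/-! ### Changes of sign -/

/-- The sign `-1` or `1`. -/
def sgn (b : Bool) : ℝ := cond b (-1) 1

/-- Change the signs of the two matrices. -/
def signHomeo (s : Bool × Bool) : (SL(2, ℝ) × SL(2, ℝ)) ≃ₜ (SL(2, ℝ) × SL(2, ℝ)) :=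
  (Homeomorph.mulLeft (cond s.1 (-1) 1)).prodCongr (Homeomorph.mulLeft (cond s.2 (-1) 1))

lemma signHomeo_fst (s : Bool × Bool) (p : SL(2, ℝ) × SL(2, ℝ)) :
    (signHomeo s p).1 = p.1 ∨ (signHomeo s p).1 = -p.1 := by
  rcases s with ⟨_ | _, _⟩ <;> simp [signHomeo]

lemma signHomeo_snd (s : Bool × Bool) (p : SL(2, ℝ) × SL(2, ℝ)) :
    (signHomeo s p).2 = p.2 ∨ (signHomeo s p).2 = -p.2 := by
  rcases s with ⟨_, _ | _⟩ <;> simp [signHomeo]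

lemma trA_signHomeo (s : Bool × Bool) (p : SL(2, ℝ) × SL(2, ℝ)) :
    trA (signHomeo s p) = sgn s.1 * trA p := by
  rcases s with ⟨_ | _, _⟩ <;> simp [signHomeo, trA, sgn]

lemma trB_signHomeo (s : Bool × Bool) (p : SL(2, ℝ) × SL(2, ℝ)) :
    trB (signHomeo s p) = sgn s.2 * trB p := by
  rcases s with ⟨_, _ | _⟩ <;> simp [signHomeo, trB, sgn]

lemma trAB_signHomeo (s : Bool × Bool) (p : SL(2, ℝ) × SL(2, ℝ)) :
    trAB (signHomeo s p) = sgn s.1 * sgn s.2 * trAB p := by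
  rcases s with ⟨_ | _, _ | _⟩ <;> simp [signHomeo, trAB, sgn]

lemma trComm_signHomeo (s : Bool × Bool) (p : SL(2, ℝ) × SL(2, ℝ)) :
    trComm (signHomeo s p) = trComm p := by
  rw [trComm, trA_signHomeo, trB_signHomeo, trAB_signHomeo, trComm]
  rcases s with ⟨_ | _, _ | _⟩ <;> simp [sgn]

lemma signHomeo_signHomeo (s : Bool × Bool) (p : SL(2, ℝ) × SL(2, ℝ)) :
    signHomeo s (signHomeo s p) = p := by
  rcases s with ⟨_ | _, _ | _⟩ <;> simp [signHomeo, Prod.map]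

lemma letter_signHomeo (s : Bool × Bool) (p : SL(2, ℝ) × SL(2, ℝ)) (i : Fin 2) :
    letter (signHomeo s p) i = letter p i ∨ letter (signHomeo s p) i = -letter p i := by
  fin_cases i
  · exact signHomeo_fst s p
  · exact signHomeo_snd s p

lemma prod_letter_signHomeo (s : Bool × Bool) (p : SL(2, ℝ) × SL(2, ℝ)) (w : List (Fin 2)) :
    (w.map (letter (signHomeo s p))).prod = (w.map (letter p)).prod ∨
      (w.map (letter (signHomeo s p))).prod = -(w.map (letter p)).prod := by
  induction w with
  | nil => simp
  | cons a w ih =>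
    rcases ih with h | h <;> rcases letter_signHomeo s p a with h' | h' <;> simp [h, h']

lemma signHomeo_mem_hypLocus {s : Bool × Bool} {p : SL(2, ℝ) × SL(2, ℝ)} :
    signHomeo s p ∈ hypLocus ↔ p ∈ hypLocus := by
  have h : ∀ q, q ∈ hypLocus → signHomeo s q ∈ hypLocus := fun q hq =>
    mem_hypLocus_of_eq_or_eq_neg hq (signHomeo_fst s q) (signHomeo_snd s q)
  refine ⟨fun hs => ?_, h p⟩
  rw [← signHomeo_signHomeo s p]
  exact h _ hs

lemma Hyperbolic.neg {A : SL(2, ℝ)} (h : Hyperbolic A) : Hyperbolic (-A) := by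
  rwa [Hyperbolic, Matrix.SpecialLinearGroup.coe_neg, Matrix.trace_neg, abs_neg]

lemma Parabolic.neg {A : SL(2, ℝ)} (h : Parabolic A) : Parabolic (-A) := by
  rwa [Parabolic, Matrix.SpecialLinearGroup.coe_neg, Matrix.trace_neg, abs_neg]

lemma IsUnstableDir.neg {A : SL(2, ℝ)} {d : P1} (h : IsUnstableDir A d) :
    IsUnstableDir (-A) d := by
  rcases h with ⟨hA, c, hc, h⟩ | ⟨hA, h1, h2, h⟩
  · exact Or.inl ⟨hA.neg, -c, by rwa [abs_neg], fun v hv => by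
      rw [Matrix.SpecialLinearGroup.coe_neg, Matrix.neg_mulVec, h v hv, neg_smul]⟩
  · exact Or.inr ⟨hA.neg, fun e => h2 (by rw [← e, neg_neg]), fun e => h1 (neg_injective e),
      by rw [neg_smul_P1, h]⟩

lemma IsStableDir.neg {A : SL(2, ℝ)} {d : P1} (h : IsStableDir A d) : IsStableDir (-A) d := by
  rcases h with ⟨hA, c, hc, h⟩ | ⟨hA, h1, h2, h⟩
  · exact Or.inl ⟨hA.neg, -c, by rwa [abs_neg], fun v hv => by
      rw [Matrix.SpecialLinearGroup.coe_neg, Matrix.neg_mulVec, h v hv, neg_smul]⟩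
  · exact Or.inr ⟨hA.neg, fun e => h2 (by rw [← e, neg_neg]), fun e => h1 (neg_injective e),
      by rw [neg_smul_P1, h]⟩

lemma UnstableEqStable.of_eq_or_eq_neg {A B A' B' : SL(2, ℝ)} (h : UnstableEqStable A B)
    (hA : A' = A ∨ A' = -A) (hB : B' = B ∨ B' = -B) : UnstableEqStable A' B' := by
  obtain ⟨d, hu, hs⟩ := h
  refine ⟨d, ?_, ?_⟩
  · rcases hA with rfl | rfl
    exacts [hu, hu.neg]
  · rcases hB with rfl | rfl
    exacts [hs, hs.neg]

lemma unstableEqStable_of_signHomeo {s : Bool × Bool} {p : SL(2, ℝ) × SL(2, ℝ)}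
    (h : UnstableEqStable (signHomeo s p).1 (signHomeo s p).2 ∨
      UnstableEqStable (signHomeo s p).2 (signHomeo s p).1) :
    UnstableEqStable p.1 p.2 ∨ UnstableEqStable p.2 p.1 := by
  have h1 := signHomeo_fst s (signHomeo s p)
  have h2 := signHomeo_snd s (signHomeo s p)
  rw [signHomeo_signHomeo] at h1 h2
  exact h.imp (fun h => h.of_eq_or_eq_neg h1 h2) (fun h => h.of_eq_or_eq_neg h2 h1)

lemma HasParabolicProduct.of_signHomeo {s : Bool × Bool} {p : SL(2, ℝ) × SL(2, ℝ)}
    (h : HasParabolicProduct (signHomeo s p)) : HasParabolicProduct p := by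
  obtain ⟨w, hw, h⟩ := h
  refine ⟨w, hw, ?_⟩
  rcases prod_letter_signHomeo s p w with h1 | h1
  · rwa [h1] at h
  · rw [h1] at h
    simpa using h.neg

lemma HasParabolicProduct.of_reduction {F : List Bool} {p : SL(2, ℝ) × SL(2, ℝ)}
    (h : HasParabolicProduct (reduction F p)) : HasParabolicProduct p := by
  obtain ⟨w, hw, h⟩ := h
  obtain ⟨w', hw', e⟩ := exists_word_reduction F p hw
  exact ⟨w', hw', e ▸ h⟩

lemma hasParabolicProduct_of_trA {p : SL(2, ℝ) × SL(2, ℝ)} (h : |trA p| = 2) :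
    HasParabolicProduct p :=
  ⟨[0], by simp, by simpa [Parabolic, letter, trA] using h⟩

lemma hasParabolicProduct_of_trB {p : SL(2, ℝ) × SL(2, ℝ)} (h : |trB p| = 2) :
    HasParabolicProduct p :=
  ⟨[1], by simp, by simpa [Parabolic, letter, trB] using h⟩

lemma hasParabolicProduct_of_trAB {p : SL(2, ℝ) × SL(2, ℝ)} (h : |trAB p| = 2) :
    HasParabolicProduct p :=
  ⟨[0, 1], by simp, by simpa [Parabolic, letter, trAB] using h⟩

lemma isMulticone_of_signHomeo {s : Bool × Bool} {p : SL(2, ℝ) × SL(2, ℝ)} {M : Set P1}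
    (h : IsMulticone (signHomeo s p) M) : IsMulticone p M where
  nonempty := h.nonempty
  isOpen := h.isOpen
  closure_ne_univ := h.closure_ne_univ
  closure_image_subset i := by
    have e : (fun x : P1 => letter p i • x) = fun x : P1 => letter (signHomeo s p) i • x := by
      funext x
      rcases letter_signHomeo s p i with h1 | h1
      · rw [h1]
      · rw [h1, neg_smul_P1]
    rw [e]
    exact h.closure_image_subset i
  finite_components := h.finite_components
  disjoint_closures := h.disjoint_closures

/-! ### The components of the hyperbolicity locus -/

/-- The components of the hyperbolicity locus on which both traces are positive. -/
def basePiece : Option (List Bool × Bool) → Set (SL(2, ℝ) × SL(2, ℝ))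
  | none => principalSet
  | some (F, e) => reduction F ⁻¹' schottkyOriented e

/-- The components of the hyperbolicity locus: up to signs, the principal one, and those obtained
from the two sets of Schottky pairs by the reduction. -/
def piece (i : (Bool × Bool) × Option (List Bool × Bool)) : Set (SL(2, ℝ) × SL(2, ℝ)) :=
  signHomeo i.1 ⁻¹' basePiece i.2

/-- A closed set containing `principalSet`. -/
def principalClosed : Set (SL(2, ℝ) × SL(2, ℝ)) :=
  {p | 2 ≤ trA p ∧ 2 ≤ trB p ∧ (trComm p ≤ 2 ∨ trA p * trB p ≤ 2 * trAB p)}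

/-- Closed sets containing the sets `basePiece i`. -/
def baseClosed : Option (List Bool × Bool) → Set (SL(2, ℝ) × SL(2, ℝ))
  | none => principalClosed
  | some (F, e) => reduction F ⁻¹' {p | p ∈ schottkyClosed ∧ orient p ∈ halfLine e}

lemma isOpen_principalSet : IsOpen principalSet :=
  (isOpen_lt continuous_const continuous_trA).inter
    ((isOpen_lt continuous_const continuous_trB).inter
      ((isOpen_lt continuous_trComm continuous_const).union
        (isOpen_lt (continuous_trA.mul continuous_trB) (continuous_const.mul continuous_trAB))))

lemma isOpen_schottkySet : IsOpen schottkySet :=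
  (isOpen_lt continuous_const continuous_trA).inter
    ((isOpen_lt continuous_const continuous_trB).inter (isOpen_lt continuous_trAB continuous_const))

lemma isOpen_schottkyOriented (e : Bool) : IsOpen (schottkyOriented e) :=
  isOpen_schottkySet.inter ((isOpen_halfLine e).preimage continuous_orient)

lemma isClosed_principalClosed : IsClosed principalClosed :=
  (isClosed_le continuous_const continuous_trA).inter
    ((isClosed_le continuous_const continuous_trB).inter
      ((isClosed_le continuous_trComm continuous_const).union
        (isClosed_le (continuous_trA.mul continuous_trB) (continuous_const.mul continuous_trAB))))

lemma isClosed_schottkyClosed : IsClosed schottkyClosed :=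
  (isClosed_le continuous_const continuous_trA).inter
    ((isClosed_le continuous_const continuous_trB).inter
      (isClosed_le continuous_trAB continuous_const))

/-- `orient` has no zero on `schottkyClosed`, so there the open half-line may be replaced by its
closure. -/
lemma isClosed_schottkyClosed_oriented (e : Bool) :
    IsClosed {p | p ∈ schottkyClosed ∧ orient p ∈ halfLine e} := by
  have h : {p | p ∈ schottkyClosed ∧ orient p ∈ halfLine e} =
      schottkyClosed ∩ orient ⁻¹' closure (halfLine e) := by
    ext p
    refine and_congr_right fun hp => ⟨fun h => subset_closure h, fun h => ?_⟩
    have h0 := orient_ne_zero hp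
    cases e
    · simp only [halfLine, closure_Iio, mem_preimage, mem_Iic] at h
      exact h.lt_of_ne h0
    · simp only [halfLine, closure_Ioi, mem_preimage, mem_Ici] at h
      exact h.lt_of_ne h0.symm
  rw [h]
  exact isClosed_schottkyClosed.inter (isClosed_closure.preimage continuous_orient)

lemma isClosed_baseClosed (j : Option (List Bool × Bool)) : IsClosed (baseClosed j) := by
  rcases j with _ | ⟨F, e⟩
  · exact isClosed_principalClosed
  · exact (isClosed_schottkyClosed_oriented e).preimage (reduction F).continuous

lemma basePiece_subset_baseClosed (j : Option (List Bool × Bool)) :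
    basePiece j ⊆ baseClosed j := by
  rcases j with _ | ⟨F, e⟩
  · exact fun p hp => ⟨hp.1.le, hp.2.1.le, hp.2.2.imp le_of_lt le_of_lt⟩
  · exact fun p hp => ⟨schottkySet_subset hp.1, hp.2⟩

lemma closure_piece_subset (i : (Bool × Bool) × Option (List Bool × Bool)) :
    closure (piece i) ⊆ signHomeo i.1 ⁻¹' baseClosed i.2 :=
  closure_minimal (preimage_mono (basePiece_subset_baseClosed i.2))
    ((isClosed_baseClosed i.2).preimage (signHomeo i.1).continuous)

lemma two_le_of_mem_baseClosed {j : Option (List Bool × Bool)} {p : SL(2, ℝ) × SL(2, ℝ)}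
    (h : p ∈ baseClosed j) : 2 ≤ trA p ∧ 2 ≤ trB p := by
  rcases j with _ | ⟨F, e⟩
  · exact ⟨h.1, h.2.1⟩
  · have h1 := (mem_opposedClosed_of_reduction h.1).1
    exact ⟨h1.1, h1.2.1⟩

/-- If `κ ≤ 2` fails, both sets together force `2z = xy`, and then `κ ≤ 2` anyway, against `κ ≥ 18`.
-/
lemma not_mem_opposedClosed_of_mem_principalClosed {p : SL(2, ℝ) × SL(2, ℝ)}
    (h : p ∈ principalClosed) : p ∉ opposedClosed := by
  rintro ⟨hx, hy, hz, hk⟩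
  rcases h.2.2 with h1 | h1
  · linarith
  · have h2 := four_mul_trComm_sub p
    have h3 : 2 * trAB p - trA p * trB p = 0 := by linarith
    rw [h3] at h2
    have h4 : 0 ≤ (trA p ^ 2 - 4) * (trB p ^ 2 - 4) :=
      mul_nonneg (by nlinarith) (by nlinarith)
    linarith

lemma eq_of_mem_halfLine {e e' : Bool} {t : ℝ} (h : t ∈ halfLine e) (h' : t ∈ halfLine e') :
    e = e' := by
  cases e <;> cases e' <;> simp only [halfLine, mem_Iio, mem_Ioi] at h h' <;> first | rfl | linarith

lemma eq_of_mem_baseClosed {j k : Option (List Bool × Bool)} {p : SL(2, ℝ) × SL(2, ℝ)}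
    (hj : p ∈ baseClosed j) (hk : p ∈ baseClosed k) : j = k := by
  rcases j with _ | ⟨F, e⟩ <;> rcases k with _ | ⟨G, e'⟩
  · rfl
  · exact absurd (mem_opposedClosed_of_reduction hk.1).1
      (not_mem_opposedClosed_of_mem_principalClosed hj)
  · exact absurd (mem_opposedClosed_of_reduction hj.1).1
      (not_mem_opposedClosed_of_mem_principalClosed hk)
  · obtain rfl := reduction_unique hj.1 hk.1
    rw [eq_of_mem_halfLine hj.2 hk.2]

lemma sgn_unique {a b : Bool} {t : ℝ} (ha : 2 ≤ sgn a * t) (hb : 2 ≤ sgn b * t) : a = b := by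
  cases a <;> cases b <;> simp only [sgn, cond_true, cond_false] at ha hb <;>
    first | rfl | linarith

lemma disjoint_closure_piece :
    Pairwise fun i j => Disjoint (closure (piece i)) (closure (piece j)) := by
  intro i j hij
  rw [disjoint_left]
  intro p hi hj
  apply hij
  have h1 := closure_piece_subset i hi
  have h2 := closure_piece_subset j hj
  have t1 := two_le_of_mem_baseClosed h1
  have t2 := two_le_of_mem_baseClosed h2
  rw [trA_signHomeo, trB_signHomeo] at t1 t2
  have hs : i.1 = j.1 := Prod.ext (sgn_unique t1.1 t2.1) (sgn_unique t1.2 t2.2)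
  rw [hs] at h1
  exact Prod.ext hs (eq_of_mem_baseClosed h1 h2)

lemma isOpen_piece (i : (Bool × Bool) × Option (List Bool × Bool)) : IsOpen (piece i) := by
  refine IsOpen.preimage (signHomeo i.1).continuous ?_
  rcases i with ⟨s, _ | ⟨F, e⟩⟩
  · exact isOpen_principalSet
  · exact (isOpen_schottkyOriented e).preimage (reduction F).continuous

lemma isConnected_piece (i : (Bool × Bool) × Option (List Bool × Bool)) :
    IsConnected (piece i) := by
  refine (signHomeo i.1).isConnected_preimage.2 ?_
  rcases i with ⟨s, _ | ⟨F, e⟩⟩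
  · exact isConnected_principalSet
  · exact (reduction F).isConnected_preimage.2 (isConnected_schottkyOriented e)

lemma not_unstableEqStable_of_mem_hypLocus {p : SL(2, ℝ) × SL(2, ℝ)} (hp : p ∈ hypLocus) :
    ¬ (UnstableEqStable p.1 p.2 ∨ UnstableEqStable p.2 p.1) := by
  have hyp : ∀ a, Hyperbolic (letter p a) := fun a => by
    simpa using hyperbolic_of_mem_hypLocus hp (w := [a]) (by simp)
  have key : ∀ a b, ¬ UnstableEqStable (letter p a) (letter p b) := by
    rintro a b ⟨d, hu, hs⟩
    rcases hu with ⟨-, c, hc, hu⟩ | ⟨hu, -⟩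
    · rcases hs with ⟨-, c', hc', hs⟩ | ⟨hs, -⟩
      · exact not_unstable_eq_stable_of_mem_hypLocus hp hc hc' hu hs
      · exact (hyp b).ne' hs
    · exact (hyp a).ne' hu
  rintro (h | h)
  · exact key 0 1 h
  · exact key 1 0 h

lemma exists_two_lt_sgn_mul {t : ℝ} (h : 2 < |t|) : ∃ b, 2 < sgn b * t := by
  rcases lt_abs.1 h with h | h
  · exact ⟨false, by simpa [sgn] using h⟩
  · exact ⟨true, by simpa [sgn] using h⟩

/-- A pair of the hyperbolicity locus with positive traces lies in one of the base pieces. -/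
lemma exists_mem_basePiece {p : SL(2, ℝ) × SL(2, ℝ)} (hp : p ∈ hypLocus) (hx : 2 < trA p)
    (hy : 2 < trB p) : ∃ j, p ∈ basePiece j := by
  by_cases hpr : p ∈ principalSet
  · exact ⟨none, hpr⟩
  have hn : ¬ (trComm p < 2 ∨ trA p * trB p < 2 * trAB p) := fun h => hpr ⟨hx, hy, h⟩
  push Not at hn
  obtain ⟨hk, hz⟩ := hn
  -- Equality would give `κ < 2`. Next, `κ = 2` is ruled out by the absence of common stable and
  -- unstable directions.
  have hz' : 2 * trAB p < trA p * trB p := by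
    refine hz.lt_of_ne fun h => ?_
    have h1 := four_mul_trComm_sub p
    rw [h, sub_self] at h1
    have h2 : 0 < (trA p ^ 2 - 4) * (trB p ^ 2 - 4) := mul_pos (by nlinarith) (by nlinarith)
    linarith
  have hk' : 2 < trComm p := hk.lt_of_ne fun h =>
    not_unstableEqStable_of_mem_hypLocus hp (unstableEqStable_of_trComm_eq_two hx hy hz' h.symm)
  obtain ⟨F, hF⟩ := exists_reduction_mem_schottkySet (p := p) ⟨hx, hy, hz', hk'⟩
    fun w hw => hyperbolic_of_mem_hypLocus hp hw
  rcases (orient_ne_zero (schottkySet_subset hF)).lt_or_gt with h | h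
  · exact ⟨some (F, false), hF, h⟩
  · exact ⟨some (F, true), hF, h⟩

theorem hypLocus_eq_iUnion_piece : hypLocus = ⋃ i, piece i := by
  ext p
  rw [mem_iUnion]
  constructor
  · intro hp
    have hA : 2 < |trA p| := by
      simpa [Hyperbolic, letter, trA] using hyperbolic_of_mem_hypLocus hp (w := [0]) (by simp)
    have hB : 2 < |trB p| := by
      simpa [Hyperbolic, letter, trB] using hyperbolic_of_mem_hypLocus hp (w := [1]) (by simp)
    obtain ⟨a, ha⟩ := exists_two_lt_sgn_mul hA
    obtain ⟨b, hb⟩ := exists_two_lt_sgn_mul hB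
    obtain ⟨j, hj⟩ := exists_mem_basePiece (signHomeo_mem_hypLocus (s := (a, b)).2 hp)
      (by rwa [trA_signHomeo]) (by rwa [trB_signHomeo])
    exact ⟨((a, b), j), hj⟩
  · rintro ⟨⟨s, j⟩, hp⟩
    rw [← signHomeo_mem_hypLocus (s := s)]
    rcases j with _ | ⟨F, e⟩
    · exact principalSet_subset_hypLocus hp
    · exact (hasFreeGrowth_of_reduction hp.1).hasGrowth.mem_hypLocus

lemma length_le_of_mem_piece {s : Bool × Bool} {F : List Bool} {e : Bool}
    {p : SL(2, ℝ) × SL(2, ℝ)} (h : p ∈ piece (s, some (F, e))) :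
    4 * (F.length : ℝ) ≤ |trA p| + |trB p| := by
  have h1 := (mem_opposedClosed_of_reduction (schottkySet_subset h.1)).2
  rw [trA_signHomeo, trB_signHomeo] at h1
  refine h1.trans (add_le_add ?_ ?_)
  · rcases s with ⟨_ | _, _⟩ <;> simp [sgn, le_abs_self, neg_le_abs]
  · rcases s with ⟨_, _ | _⟩ <;> simp [sgn, le_abs_self, neg_le_abs]

/-- The traces are locally bounded and bound the length of the reduction, and there are finitely
many words of bounded length. -/
theorem locallyFinite_piece : LocallyFinite piece := by
  intro p
  obtain ⟨N, hN⟩ := exists_nat_gt (|trA p| + |trB p|)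
  refine ⟨{q | |trA q| + |trB q| < N},
    (isOpen_lt (continuous_trA.abs.add continuous_trB.abs) continuous_const).mem_nhds hN, ?_⟩
  have hfin : ((univ : Set (Bool × Bool)) ×ˢ
      insert none (some '' ({F : List Bool | F.length ≤ N} ×ˢ (univ : Set Bool)))).Finite :=
    finite_univ.prod ((((List.finite_length_le Bool N).prod finite_univ).image _).insert _)
  refine hfin.subset ?_
  rintro ⟨s, j⟩ ⟨q, hq, hqN⟩
  refine ⟨mem_univ _, ?_⟩
  rcases j with _ | ⟨F, e⟩
  · exact mem_insert _ _
  · refine mem_insert_of_mem _ ⟨(F, e), ⟨?_, mem_univ _⟩, rfl⟩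
    have h1 := length_le_of_mem_piece hq
    have h2 : |trA q| + |trB q| < N := hqN
    have h3 : (F.length : ℝ) ≤ N := by
      have : (0 : ℝ) ≤ F.length := Nat.cast_nonneg _
      linarith
    exact_mod_cast h3

theorem componentsOf_hypLocus : componentsOf hypLocus = range piece := by
  rw [hypLocus_eq_iUnion_piece]
  exact componentsOf_iUnion isOpen_piece isConnected_piece disjoint_closure_piece

lemma isPrincipalComponent_piece (s : Bool × Bool) : IsPrincipalComponent (piece (s, none)) := by
  refine ⟨componentsOf_hypLocus ▸ mem_range_self _, fun p hp => ?_⟩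
  obtain ⟨g, hg⟩ := exists_conjPair_positive hp
  exact ⟨openQuadrant g, isMulticone_of_signHomeo (isMulticone_openQuadrant hg),
    isOpenInterval_openQuadrant g⟩

/-! ### Boundary points -/

lemma exists_mem_frontier_piece {p : SL(2, ℝ) × SL(2, ℝ)} (hp : p ∈ frontier hypLocus) :
    ∃ i, p ∈ frontier (piece i) := by
  rw [hypLocus_eq_iUnion_piece, frontier_iUnion_of_disjoint_closure isOpen_piece
    locallyFinite_piece disjoint_closure_piece] at hp
  exact mem_iUnion.1 hp

/-- If neither matrix has trace two, the only way to leave the open set is `κ = 2` with opposed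
axes. -/
lemma hasParabolicProduct_or_of_mem_principalClosed {p : SL(2, ℝ) × SL(2, ℝ)}
    (hp : p ∈ principalClosed) (hn : p ∉ principalSet) :
    HasParabolicProduct p ∨ (UnstableEqStable p.1 p.2 ∨ UnstableEqStable p.2 p.1) := by
  obtain ⟨hx, hy, hz⟩ := hp
  rcases hx.eq_or_lt with hx' | hx'
  · exact Or.inl (hasParabolicProduct_of_trA (by rw [← hx']; norm_num))
  rcases hy.eq_or_lt with hy' | hy'
  · exact Or.inl (hasParabolicProduct_of_trB (by rw [← hy']; norm_num))
  have hn' : ¬ (trComm p < 2 ∨ trA p * trB p < 2 * trAB p) := fun h => hn ⟨hx', hy', h⟩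
  push Not at hn'
  obtain ⟨hk, hle⟩ := hn'
  have h1 := four_mul_trComm_sub p
  have h2 : 0 < (trA p ^ 2 - 4) * (trB p ^ 2 - 4) := mul_pos (by nlinarith) (by nlinarith)
  have hlt : 2 * trAB p < trA p * trB p := by
    refine hle.lt_of_ne fun h => ?_
    rw [h, sub_self] at h1
    linarith
  have hk2 : trComm p = 2 := le_antisymm (hz.resolve_right hlt.not_ge) hk
  exact Or.inr (unstableEqStable_of_trComm_eq_two hx' hy' hlt hk2)

lemma hasParabolicProduct_of_mem_schottkyClosed {p : SL(2, ℝ) × SL(2, ℝ)}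
    (hp : p ∈ schottkyClosed) (hn : p ∉ schottkySet) : HasParabolicProduct p := by
  obtain ⟨hx, hy, hz⟩ := hp
  rcases hx.eq_or_lt with hx' | hx'
  · exact hasParabolicProduct_of_trA (by rw [← hx']; norm_num)
  rcases hy.eq_or_lt with hy' | hy'
  · exact hasParabolicProduct_of_trB (by rw [← hy']; norm_num)
  rcases hz.eq_or_lt with hz' | hz'
  · exact hasParabolicProduct_of_trAB (by rw [hz']; norm_num)
  exact absurd ⟨hx', hy', hz'⟩ hn

theorem hasParabolicProduct_or_of_mem_frontier {p : SL(2, ℝ) × SL(2, ℝ)}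
    (hp : p ∈ frontier hypLocus) :
    HasParabolicProduct p ∨ (UnstableEqStable p.1 p.2 ∨ UnstableEqStable p.2 p.1) := by
  obtain ⟨⟨s, j⟩, hi⟩ := exists_mem_frontier_piece hp
  rw [(isOpen_piece _).frontier_eq] at hi
  have hc := closure_piece_subset _ hi.1
  rcases j with _ | ⟨F, e⟩
  · exact (hasParabolicProduct_or_of_mem_principalClosed hc hi.2).imp (fun h => h.of_signHomeo)
      unstableEqStable_of_signHomeo
  · exact Or.inl (hasParabolicProduct_of_mem_schottkyClosed hc.1
      fun h => hi.2 ⟨h, hc.2⟩).of_reduction.of_signHomeo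

theorem exists_isPrincipalComponent_of_mem_frontier {p : SL(2, ℝ) × SL(2, ℝ)}
    (hp : p ∈ frontier hypLocus) (h : UnstableEqStable p.1 p.2 ∨ UnstableEqStable p.2 p.1) :
    ∃ C, IsPrincipalComponent C ∧ p ∈ frontier C := by
  have hk : trComm p = 2 := by
    rcases h with h | h
    · exact trComm_eq_two_of_unstableEqStable h
    · exact (trComm_swap p.1 p.2).trans (trComm_eq_two_of_unstableEqStable h)
  obtain ⟨⟨s, j⟩, hi⟩ := exists_mem_frontier_piece hp
  rcases j with _ | ⟨F, e⟩
  · exact ⟨_, isPrincipalComponent_piece s, hi⟩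
  -- A shared direction forces `κ = 2`, while `κ ≥ 18` on the closure of a non-principal piece.
  · have hc := closure_piece_subset _ (frontier_subset_closure hi)
    have h1 := (mem_opposedClosed_of_reduction hc.1).1.2.2.2
    rw [trComm_signHomeo, hk] at h1
    norm_num at h1

theorem finite_components_meeting_compact {K : Set (SL(2, ℝ) × SL(2, ℝ))} (hK : IsCompact K) :
    {C ∈ componentsOf hypLocus | (C ∩ K).Nonempty}.Finite := by
  refine ((locallyFinite_piece.finite_nonempty_inter_compact hK).image piece).subset ?_
  rintro C ⟨hC, hCK⟩
  rw [componentsOf_hypLocus] at hC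
  obtain ⟨i, rfl⟩ := hC
  exact ⟨i, hCK, rfl⟩

theorem frontier_hypLocus :
    frontier hypLocus = ⋃ C ∈ componentsOf hypLocus, frontier C := by
  rw [componentsOf_hypLocus, biUnion_range, hypLocus_eq_iUnion_piece]
  exact frontier_iUnion_of_disjoint_closure isOpen_piece locallyFinite_piece disjoint_closure_piece

theorem pairwiseDisjoint_frontier_components :
    (componentsOf hypLocus).PairwiseDisjoint frontier := by
  rw [componentsOf_hypLocus]
  exact pairwiseDisjoint_frontier_range disjoint_closure_piece

end FullTwoShift

theorem theorem3p2 :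
    -- a compact set meets only finitely many components
    (∀ K : Set (SL(2, ℝ) × SL(2, ℝ)), IsCompact K →
      {C ∈ FullTwoShift.componentsOf FullTwoShift.hypLocus | (C ∩ K).Nonempty}.Finite) ∧
    -- the boundary is the disjoint union of the boundaries of the components
    (frontier FullTwoShift.hypLocus =
      ⋃ C ∈ FullTwoShift.componentsOf FullTwoShift.hypLocus, frontier C) ∧
    (FullTwoShift.componentsOf FullTwoShift.hypLocus).PairwiseDisjoint frontier ∧
    -- the two possibilities at a boundary point
    (∀ A B : SL(2, ℝ), (A, B) ∈ frontier FullTwoShift.hypLocus →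
      FullTwoShift.HasParabolicProduct (A, B) ∨
        (FullTwoShift.UnstableEqStable A B ∨ FullTwoShift.UnstableEqStable B A)) ∧
    -- the second one occurs only on the boundary of a principal component
    (∀ A B : SL(2, ℝ), (A, B) ∈ frontier FullTwoShift.hypLocus →
      (FullTwoShift.UnstableEqStable A B ∨ FullTwoShift.UnstableEqStable B A) →
        ∃ C, FullTwoShift.IsPrincipalComponent C ∧ (A, B) ∈ frontier C) := by
  exact ⟨fun K hK => FullTwoShift.finite_components_meeting_compact hK,
    FullTwoShift.frontier_hypLocus, FullTwoShift.pairwiseDisjoint_frontier_components,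
    fun A B h => FullTwoShift.hasParabolicProduct_or_of_mem_frontier h,
    fun A B h h' => FullTwoShift.exists_isPrincipalComponent_of_mem_frontier h h'⟩
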